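/- Consider in $\mathbb{R}^3$ a plasma of density $f(x,v,t)$ and $N\ge 1$ unit point charges with positions $\xi_\alpha(t)$ and velocities $\eta_\alpha(t)$, interacting by repulsion. Put $$\rho(x,t)=\int f(x,v,t)\,dv,\qquad E(x,t)=\int\frac{x-y}{|x-y|^3}\,\rho(y,t)\,dy .$$ **Initial data.** $\{(\xi_{\alpha0},\eta_{\alpha0})\}_{\alpha=1}^N\subset\mathbb{R}^3\times\mathbb{R}^3$ and a bounded, compactly supported probability density $f_0$ on $\mathbb{R}^3\times\mathbb{R}^3$ such that, for some $\delta_0>0$, $|x-\xi_{\alpha0}|\ge\delta_0$ for all $(x,v)\in\mathrm{supp}(f_0)$ and all $\alpha$. **Solutions.** Let $T>0$. A solution on $[0,T]$ consists of $\xi_\alpha\in C^2([0,T])$ with $\xi_\alpha(t)\ne\xi_\beta(t)$ for $\alpha\neq\beta$, and $f\in L^\infty([0,T],L^1\cap L^\infty)$ with $\rho\in L^\infty([0,T],L^\infty)$, such that for all $t\in[0,T]$ $$\dot\xi_\alpha=\eta_\alpha,\qquad \dot\eta_\alpha(t)=E(\xi_\alpha(t),t)+\sum_{\beta\ne\alpha}\frac{\xi_\alpha(t)-\xi_\beta(t)}{|\xi_\alpha(t)-\xi_\beta(t)|^3},\qquad(\xi_\alpha,\eta_\alpha)(0)=(\xi_{\alpha0},\eta_{\alpha0}),$$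 and $f(X(x,v,0,t),V(x,v,0,t),t)=f_0(x,v)$ whenever $x\ne\xi_\alpha(0)$ for all $\alpha$. Here, for $\tau,t\in[0,T]$, $(X,V)(\cdot,\cdot,\tau,t)$ is an invertible flow from $(\mathbb{R}^3\setminus\bigcup_\alpha\{\xi_\alpha(\tau)\})\times\mathbb{R}^3$ to $(\mathbb{R}^3\setminus\bigcup_\alpha\{\xi_\alpha(t)\})\times\mathbb{R}^3$ such that, for some $\delta>0$, all $\tau,t\in[0,T]$ and all $(x,v)\in\mathrm{supp}(f(\tau))$: $|X(x,v,\tau,t)-\xi_\alpha(t)|\ge\delta$ for all $\alpha$, $(X,V)(x,v,\tau,\tau)=(x,v)$, and $$\frac{d}{dt}X=V,\qquad \frac{d}{dt}V=E(X,t)+\sum_{\alpha=1}^N\frac{X-\xi_\alpha(t)}{|X-\xi_\alpha(t)|^3}.$$ **Notation.** Let $H$ be the total energy of the initial data, $$H=\tfrac12\int|v|^2f_0\,dx\,dv+\tfrac12\sum_\alpha|\eta_{\alpha0}|^2+\sum_\alpha\int\frac{\rho(x,0)}{|x-\xi_{\alpha0}|}dx+\tfrac12\iint\frac{\rho(x,0)\rho(y,0)}{|x-y|}dx\,dy+\tfrac12\sum_{\alpha\ne\beta}\frac1{|\xi_{\alpha0}-\xi_{\beta0}|}.$$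 Given $K_1\ge\max(8H,1)$ and $K_2>0$, set $h_\alpha(x,v,t)=\frac12|v-\eta_\alpha(t)|^2+\frac1{|x-\xi_\alpha(t)|}+K_1$ and $$Q=\max_{\alpha}\,\sup\Big\{\sqrt{h_\alpha}\big(X(x,v,0,t),V(x,v,0,t),t\big)\ :\ t\in[0,T],\ (x,v)\in\mathrm{supp}(f_0)\Big\},\qquad \Delta T=\frac1{K_2Q}.$$ If $\Delta T<T$, let $n=[T/\Delta T]$ (integer part), $t_i=i\,\Delta T$ for $0\le i\le n-1$, and $t_n=T$. For $1\le i\le n$ put $$Q_i=\max_{\alpha}\,\sup\Big\{\sqrt{h_\alpha}\big(X(x,v,t_{i-1},t),V(x,v,t_{i-1},t),t\big)\ :\ t\in(t_{i-1},t_i),\ (x,v)\in\mathrm{supp}(f(t_{i-1}))\Big\},$$ and $Q_0=\max_\alpha\sup\{\sqrt{h_\alpha}(x,v,0): (x,v)\in\mathrm{supp}(f_0)\}$. **Proposition.** For every choice of $K_1\ge\max(8H,1)$ there is a threshold depending only on $\|f_0\|_{L^\infty}$, $H$ and $K_1$ such that for every $K_2$ above it there is a constant $C_1>0$, depending only on $\|f_0\|_{L^\infty}$,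 $H$, $K_1$ and $K_2$ (in particular neither on $T$ nor on $N$), with the following property. For every solution on $[0,T]$ as above, $Q$ is finite, and if $\Delta T<T$, then for all $i=1,\dots,n$ the quantity $Q_i$ is finite and $$Q_i\le Q_{i-1}+C_1\,Q\,\Delta T .$$ -/

import Mathlib

open MeasureTheory Set
open scoped ENNReal NNReal

namespace PlasmaCharge

/-- Physical space `ℝ³` with its Euclidean norm. -/
abbrev Space : Type := EuclideanSpace ℝ (Fin 3)

/-- Phase space: pairs `(x, v)` of a position and a velocity. -/
abbrev Phase : Type := Space × Space

/-- The repulsive Coulomb kernel `z / |z|³`. -/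
noncomputable def coulomb (z : Space) : Space := (‖z‖ ^ 3)⁻¹ • z

/-- The spatial density `ρ(x) = ∫ g(x, v) dv` of a phase space density `g`. -/
noncomputable def spatialDensity (g : Phase → ℝ) (x : Space) : ℝ := ∫ v : Space, g (x, v)

/-- The electric field `E(x) = ∫ (x - y) / |x - y|³ ρ(y) dy` created by a phase space density. -/
noncomputable def electricField (g : Phase → ℝ) (x : Space) : Space :=
  ∫ y : Space, spatialDensity g y • coulomb (x - y)

/-- The total energy of a plasma with phase space density `g` and of `N` unit charges at the
positions `p α` with the velocities `w α`. -/
noncomputable def totalEnergy {N : ℕ} (g : Phase → ℝ) (p w : Fin N → Space) : ℝ :=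
  (1 / 2) * (∫ z : Phase, ‖z.2‖ ^ 2 * g z)
    + (1 / 2) * (∑ α, ‖w α‖ ^ 2)
    + (∑ α, (∫ x : Space, spatialDensity g x / ‖x - p α‖))
    + (1 / 2) * (∫ x : Space, ∫ y : Space, spatialDensity g x * spatialDensity g y / ‖x - y‖)
    + (1 / 2) * (∑ α, ∑ β ∈ Finset.univ.erase α, 1 / ‖p α - p β‖)

/-- Admissible initial data: a bounded, compactly supported probability density whose support
stays at a positive distance from the initial positions of the charges. -/
structure IsInitialDatum {N : ℕ} (f₀ : Phase → ℝ) (ξ₀ : Fin N → Space) : Prop where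
  nonneg : ∀ z, 0 ≤ f₀ z
  integrable : Integrable f₀ volume
  integral_eq_one : ∫ z, f₀ z = 1
  memLp_top : MemLp f₀ ∞ volume
  hasCompactSupport : HasCompactSupport f₀
  away : ∃ δ₀ : ℝ, 0 < δ₀ ∧ ∀ z ∈ tsupport f₀, ∀ α, δ₀ ≤ ‖z.1 - ξ₀ α‖

/-- The phase space at time `t` without the positions of the charges,
`(ℝ³ ∖ ⋃_α {ξ_α(t)}) × ℝ³`. -/
def freePhase {N : ℕ} (ξ : Fin N → ℝ → Space) (t : ℝ) : Set Phase :=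
  {z | ∀ α, z.1 ≠ ξ α t}

/-- `(ξ, η, f)` is a solution on `[0, T]` of the system coupling the Vlasov–Poisson plasma `f` with
`N` point charges of positions `ξ α` and velocities `η α`, with initial datum `(ξ₀, η₀, f₀)`.
Here `Φ τ t (x, v) = (X(x, v, τ, t), V(x, v, τ, t))` is the flow of the plasma particles. -/
structure IsSolution {N : ℕ} (T : ℝ) (f₀ : Phase → ℝ) (ξ₀ η₀ : Fin N → Space)
    (ξ η : Fin N → ℝ → Space) (f : ℝ → Phase → ℝ) (Φ : ℝ → ℝ → Phase → Phase) : Prop where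
  /-- `ξ_α ∈ C²([0, T])`. -/
  charge_contDiffOn : ∀ α, ContDiffOn ℝ 2 (ξ α) (Icc 0 T)
  /-- `f ∈ L^∞([0, T], L¹ ∩ L^∞)`. -/
  plasma_measurable : AEStronglyMeasurable (fun p : ℝ × Phase => f p.1 p.2)
    ((volume.restrict (Icc 0 T)).prod volume)
  plasma_bounded : ∃ M : ℝ≥0, ∀ᵐ t ∂(volume.restrict (Icc (0 : ℝ) T)),
    eLpNorm (f t) 1 volume ≤ M ∧ eLpNorm (f t) ∞ volume ≤ M
  /-- `ρ ∈ L^∞([0, T], L^∞)`. -/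
  density_bounded : ∃ M : ℝ≥0, ∀ᵐ t ∂(volume.restrict (Icc (0 : ℝ) T)),
    eLpNorm (spatialDensity (f t)) ∞ volume ≤ M
  /-- The charges are at distinct positions, so that the forces between them are defined. -/
  charge_ne : ∀ t ∈ Icc 0 T, ∀ α β, α ≠ β → ξ α t ≠ ξ β t
  charge_initial : ∀ α, ξ α 0 = ξ₀ α ∧ η α 0 = η₀ α
  charge_position : ∀ α, ∀ t ∈ Icc 0 T, HasDerivWithinAt (ξ α) (η α t) (Icc 0 T) t
  charge_velocity : ∀ α, ∀ t ∈ Icc 0 T, HasDerivWithinAt (η α)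
    (electricField (f t) (ξ α t) + ∑ β ∈ Finset.univ.erase α, coulomb (ξ α t - ξ β t))
    (Icc 0 T) t
  /-- `Φ` is an invertible flow between the phase spaces without the charges. -/
  flow_mapsTo : ∀ τ ∈ Icc 0 T, ∀ t ∈ Icc 0 T, MapsTo (Φ τ t) (freePhase ξ τ) (freePhase ξ t)
  flow_self : ∀ τ ∈ Icc 0 T, ∀ z ∈ freePhase ξ τ, Φ τ τ z = z
  flow_comp : ∀ τ ∈ Icc 0 T, ∀ s ∈ Icc 0 T, ∀ t ∈ Icc 0 T, ∀ z ∈ freePhase ξ τ,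
    Φ s t (Φ τ s z) = Φ τ t z
  /-- The density is transported by the flow. -/
  transport : ∀ t ∈ Icc 0 T, ∀ z ∈ freePhase ξ 0, f t (Φ 0 t z) = f₀ z
  /-- The plasma particles stay at a positive distance from the charges. -/
  away : ∃ δ : ℝ, 0 < δ ∧ ∀ τ ∈ Icc 0 T, ∀ t ∈ Icc 0 T, ∀ z ∈ tsupport (f τ), ∀ α,
    δ ≤ ‖(Φ τ t z).1 - ξ α t‖
  /-- The plasma particles follow the characteristics. -/
  plasma_initial : ∀ τ ∈ Icc 0 T, ∀ z ∈ tsupport (f τ), Φ τ τ z = z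
  plasma_position : ∀ τ ∈ Icc 0 T, ∀ z ∈ tsupport (f τ), ∀ t ∈ Icc 0 T,
    HasDerivWithinAt (fun s => (Φ τ s z).1) (Φ τ t z).2 (Icc 0 T) t
  plasma_velocity : ∀ τ ∈ Icc 0 T, ∀ z ∈ tsupport (f τ), ∀ t ∈ Icc 0 T,
    HasDerivWithinAt (fun s => (Φ τ s z).2)
      (electricField (f t) (Φ τ t z).1 + ∑ α, coulomb ((Φ τ t z).1 - ξ α t)) (Icc 0 T) t

/-- The energy `|v - η|² / 2 + 1 / |x - ξ| + K₁` of a plasma particle `(x, v)` relative to a charge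
with position `p` and velocity `w`. -/
noncomputable def chargeEnergy (K₁ : ℝ) (p w : Space) (z : Phase) : ℝ :=
  ‖z.2 - w‖ ^ 2 / 2 + 1 / ‖z.1 - p‖ + K₁

/-- The values `√h_α(X(t), V(t), t)` for `t ∈ I` along the trajectories that leave a point of the
set `S` of phase space at time `τ`. -/
def energyValues {N : ℕ} (K₁ : ℝ) (ξ η : Fin N → ℝ → Space) (Φ : ℝ → ℝ → Phase → Phase)
    (τ : ℝ) (S : Set Phase) (I : Set ℝ) (α : Fin N) : Set ℝ :=
  {q | ∃ t ∈ I, ∃ z ∈ S, q = √(chargeEnergy K₁ (ξ α t) (η α t) (Φ τ t z))}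

/-- `Q`: the maximum over the charges of the supremum of `√h_α` along all the trajectories of the
plasma on `[0, T]`. -/
noncomputable def globalQ {N : ℕ} (K₁ T : ℝ) (f₀ : Phase → ℝ) (ξ η : Fin N → ℝ → Space)
    (Φ : ℝ → ℝ → Phase → Phase) : ℝ :=
  ⨆ α, sSup (energyValues K₁ ξ η Φ 0 (tsupport f₀) (Icc 0 T) α)

/-- The time step `ΔT = 1 / (K₂ Q)`. -/
noncomputable def timeStep (K₂ Q : ℝ) : ℝ := 1 / (K₂ * Q)

/-- The number `n = [T / ΔT]` of steps. -/
noncomputable def numSteps (T ΔT : ℝ) : ℕ := ⌊T / ΔT⌋₊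

/-- The times `t_i = i ΔT` for `i < n`, and `t_n = T`. -/
noncomputable def node (T ΔT : ℝ) (i : ℕ) : ℝ :=
  if i = numSteps T ΔT then T else i * ΔT

/-- The values of `√h_α` on the time step `(t_{i-1}, t_i)` with `i = j + 1`, along the trajectories
that leave the support of `f(t_{i-1})` at time `t_{i-1}`. -/
noncomputable def stepValues {N : ℕ} (K₁ T ΔT : ℝ) (ξ η : Fin N → ℝ → Space) (f : ℝ → Phase → ℝ)
    (Φ : ℝ → ℝ → Phase → Phase) (j : ℕ) (α : Fin N) : Set ℝ :=
  energyValues K₁ ξ η Φ (node T ΔT j) (tsupport (f (node T ΔT j)))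
    (Ioo (node T ΔT j) (node T ΔT (j + 1))) α

/-- The quantities `Q_i`: `Q_0` is the maximum over the charges of the supremum of `√h_α` over the
support of the initial density at time `0`, and, for `i ≥ 1`, `Q_i` is the maximum over the charges
of the supremum of `√h_α` on the `i`-th time step. -/
noncomputable def stepQ {N : ℕ} (K₁ T ΔT : ℝ) (f₀ : Phase → ℝ) (ξ η : Fin N → ℝ → Space)
    (f : ℝ → Phase → ℝ) (Φ : ℝ → ℝ → Phase → Phase) : ℕ → ℝ
  | 0 => ⨆ α, sSup ((fun z => √(chargeEnergy K₁ (ξ α 0) (η α 0) z)) '' tsupport f₀)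
  | j + 1 => ⨆ α, sSup (stepValues K₁ T ΔT ξ η f Φ j α)

end PlasmaCharge

open PlasmaCharge

/-! Since Q ΔT = 1/K₂, the claim is that the quantities √h_α grow by at most a constant over one
time step, whose length is at most 2ΔT. Along a trajectory the repulsion by the charge α cancels in
the derivative of h_α, so √h_α varies at most as fast as the size of the remaining relative
acceleration (`IsRelativeMotion.hasDerivWithinAt_sqrt_energy`,
`IsRelativeMotion.abs_deriv_sqrt_energy_le`). During such a step a particle stays away from all
charges but the one nearest initially; the conserved energy bounds the total force of the others,
uniformly in N, and also the cost of replacing one reference charge by another. It remains to bound,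
uniformly in Q, the time integral of the plasma field over a step along a particle or a charge
(`lintegral_fieldMajorant_plasma_le`, `lintegral_fieldMajorant_charge_le`).

The bound on the phase space density and the kinetic energy give |E| ≲ Q^(4/3) pointwise, which is
too large by a factor Q^(1/3) after integration over a time of order 1/Q. Write Q = q^24. The plasma
particles whose speed, absolute or relative to the test body, is at most q^18 = Q^(3/4), and those
closer than q^(-48) = Q^(-2), create a field O(Q), harmless after integration. For the others, the
time and phase space integrals are exchanged. Two particles of relative speed above q^18 separate
almost linearly, so the time integral of their truncated inverse square distance is O(q^30), less
than the energy q^34/16 that a fast particle has at the beginning of the step. Integrating these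
energies over the plasma gives at most H.

The linear picture fails only next to a charge. There the squared distance to the charge is strongly
convex in time, so that a fast particle has a single passage, leaves it at speed at least q^17/8,
and has almost constant velocity before and after it (`IsRelativeMotion.exists_isPassage`). The
exceptional times have length O(q^(-51)), and crude bounds suffice on them.

Two facts on solutions support this. The flow preserves volume although the force is only
log-Lipschitz in space and measurable in time (`map_flow_restrict`); this follows from approximation
by compositions of shears. The energy does not increase (`IsLagrangian.externalEnergy_le`); this
follows by softening the self-interaction of the plasma. -/

namespace PlasmaCharge

open MeasureTheory Set
open scoped ENNReal NNReal

/-! ### Radial integrals and the truncated Coulomb kernel. -/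

/-- The volume of the unit ball of physical space. -/
noncomputable def ballVolume : ℝ := (volume (Metric.ball (0 : Space) 1)).toReal

theorem ballVolume_nonneg : 0 ≤ ballVolume := ENNReal.toReal_nonneg

theorem ofReal_ballVolume : ENNReal.ofReal ballVolume = volume (Metric.ball (0 : Space) 1) :=
  ENNReal.ofReal_toReal measure_ball_lt_top.ne

/-- Integration of radial functions in polar coordinates. -/
theorem lintegral_fun_norm {g : ℝ → ℝ≥0∞} (hg : Measurable g) :
    ∫⁻ x : Space, g ‖x‖ =
      ENNReal.ofReal (3 * ballVolume) * ∫⁻ r in Ioi (0 : ℝ), ENNReal.ofReal (r ^ 2) * g r := by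
  have hd : Module.finrank ℝ Space = 3 := by simp
  calc ∫⁻ x : Space, g ‖x‖
      = ∫⁻ x : ({(0)}ᶜ : Set Space), g ‖x.1‖ ∂((volume : Measure Space).comap (↑)) := by
        rw [lintegral_subtype_comap (measurableSet_singleton _).compl (fun x : Space => g ‖x‖),
          restrict_compl_singleton]
    _ = ∫⁻ x, g x.2 ∂(volume : Measure Space).toSphere.prod (.volumeIoiPow 2) := by
        have h := (volume : Measure Space).measurePreserving_homeomorphUnitSphereProd
        rw [hd] at h
        rw [← h.lintegral_comp_emb (Homeomorph.measurableEmbedding _)]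
        simp
    _ = (volume : Measure Space).toSphere univ * ∫⁻ x : Ioi (0 : ℝ), g x ∂.volumeIoiPow 2 := by
        rw [lintegral_prod _ (by fun_prop)]
        simp [mul_comm]
    _ = _ := by
        congr 1
        · rw [Measure.toSphere_apply_univ, hd, ENNReal.ofReal_mul (by norm_num), ofReal_ballVolume]
          norm_num
        · rw [Measure.volumeIoiPow, lintegral_withDensity_eq_lintegral_mul _ (by fun_prop)
            (by fun_prop), ← lintegral_subtype_comap measurableSet_Ioi]
          rfl

theorem lintegral_inv_sq_ball (x : Space) (R : ℝ) :
    ∫⁻ y in Metric.ball x R, ENNReal.ofReal ((‖x - y‖ ^ 2)⁻¹) ≤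
      ENNReal.ofReal (3 * ballVolume * R) := by
  have h1 : ∫⁻ y in Metric.ball x R, ENNReal.ofReal ((‖x - y‖ ^ 2)⁻¹) =
      ∫⁻ y : Space, (Iio R).indicator (fun r => ENNReal.ofReal ((r ^ 2)⁻¹)) ‖y‖ := by
    rw [← lintegral_indicator measurableSet_ball]
    rw [← lintegral_sub_left_eq_self _ x]
    refine lintegral_congr fun y => ?_
    simp [indicator]
  rw [h1, lintegral_fun_norm (Measurable.indicator (by fun_prop) measurableSet_Iio),
    ENNReal.ofReal_mul (p := 3 * ballVolume) (by have := ballVolume_nonneg; positivity)]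
  gcongr
  calc ∫⁻ r in Ioi (0 : ℝ), ENNReal.ofReal (r ^ 2) *
        (Iio R).indicator (fun r => ENNReal.ofReal ((r ^ 2)⁻¹)) r
      = ∫⁻ r in Ioi (0 : ℝ), (Iio R).indicator (fun _ => 1) r := by
        refine setLIntegral_congr_fun measurableSet_Ioi fun r (hr : 0 < r) => ?_
        by_cases h : r < R
        · simp only [indicator, mem_Iio, h, if_true]
          rw [← ENNReal.ofReal_mul (by positivity), mul_inv_cancel₀ (by positivity)]
          simp
        · simp [indicator, h]
    _ = volume (Ioo 0 R) := by
        rw [lintegral_indicator measurableSet_Iio]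
        simp [Measure.restrict_apply, Set.inter_comm, Iio_inter_Ioi]
    _ ≤ _ := by simp

/-- In polar coordinates the integrand is r² / max(r, e^(-l))³: the radii below e^(-l) contribute at
most 1 and the others contribute log(1/e^(-l)) = l. This logarithm is the reason why the field of a
bounded density is only log-Lipschitz. -/
theorem lintegral_inv_max_cube_ball (x : Space) {l : ℝ} (hl : 0 ≤ l) :
    ∫⁻ y in Metric.ball x 1, ENNReal.ofReal (((max ‖x - y‖ (Real.exp (-l))) ^ 3)⁻¹) ≤
      ENNReal.ofReal (3 * ballVolume * (1 + l)) := by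
  have h1 : ∫⁻ y in Metric.ball x 1, ENNReal.ofReal (((max ‖x - y‖ (Real.exp (-l))) ^ 3)⁻¹) =
      ∫⁻ y : Space, (Iio (1 : ℝ)).indicator
        (fun r => ENNReal.ofReal (((max r (Real.exp (-l))) ^ 3)⁻¹)) ‖y‖ := by
    rw [← lintegral_indicator measurableSet_ball]
    rw [← lintegral_sub_left_eq_self _ x]
    refine lintegral_congr fun y => ?_
    simp [indicator]
  have he : Real.exp (-l) ≤ 1 := by simpa using hl
  have he0 := Real.exp_pos (-l)
  rw [h1, lintegral_fun_norm (Measurable.indicator (by fun_prop) measurableSet_Iio),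
    ENNReal.ofReal_mul (p := 3 * ballVolume) (by have := ballVolume_nonneg; positivity)]
  gcongr
  calc ∫⁻ r in Ioi (0 : ℝ), ENNReal.ofReal (r ^ 2) *
        (Iio (1 : ℝ)).indicator (fun r => ENNReal.ofReal (((max r (Real.exp (-l))) ^ 3)⁻¹)) r
      ≤ ∫⁻ r in Ioi (0 : ℝ), ((Ioc 0 (Real.exp (-l))).indicator
          (fun _ => ENNReal.ofReal (Real.exp (-l))⁻¹) r +
          (Ioc (Real.exp (-l)) 1).indicator (fun r => ENNReal.ofReal (r⁻¹)) r) := by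
        refine setLIntegral_mono' measurableSet_Ioi fun r (hr : 0 < r) => ?_
        by_cases h : r < 1
        · by_cases h2 : r ≤ Real.exp (-l)
          · have h3 : ¬ (Real.exp (-l) < r) := not_lt.2 h2
            simp only [indicator, mem_Iio, h, if_true, mem_Ioc, hr, h2, true_and, h3, false_and,
              if_false, add_zero, max_eq_right h2]
            rw [← ENNReal.ofReal_mul (by positivity)]
            apply ENNReal.ofReal_le_ofReal
            calc r ^ 2 * (Real.exp (-l) ^ 3)⁻¹ ≤ Real.exp (-l) ^ 2 * (Real.exp (-l) ^ 3)⁻¹ := by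
                  gcongr
              _ = _ := by field_simp
          · have h3 : Real.exp (-l) < r := not_le.1 h2
            simp only [indicator, mem_Iio, h, if_true, mem_Ioc, hr, h2, true_and, h3, h.le,
              if_false, zero_add, max_eq_left h3.le]
            rw [← ENNReal.ofReal_mul (by positivity)]
            apply ENNReal.ofReal_le_ofReal
            apply le_of_eq
            field_simp
        · simp [indicator, h]
    _ ≤ ∫⁻ r : ℝ, ((Ioc 0 (Real.exp (-l))).indicator
          (fun _ => ENNReal.ofReal (Real.exp (-l))⁻¹) r +
          (Ioc (Real.exp (-l)) 1).indicator (fun r => ENNReal.ofReal (r⁻¹)) r) :=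
        setLIntegral_le_lintegral _ _
    _ = 1 + ENNReal.ofReal l := by
        rw [lintegral_add_left (by fun_prop (disch := measurability)),
          lintegral_indicator measurableSet_Ioc,
          lintegral_indicator measurableSet_Ioc]
        congr 1
        · simp only [lintegral_const, Measure.restrict_apply MeasurableSet.univ, univ_inter,
            Real.volume_Ioc, sub_zero]
          rw [← ENNReal.ofReal_mul (by positivity), inv_mul_cancel₀ he0.ne']
          simp
        · rw [← ofReal_integral_eq_lintegral_ofReal]
          · rw [← intervalIntegral.integral_of_le he, integral_inv_of_pos he0 one_pos]
            simp [Real.exp_neg]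
          · have : IntervalIntegrable (fun r : ℝ => r⁻¹) volume (Real.exp (-l)) 1 := by
              refine intervalIntegral.intervalIntegrable_inv (fun r hr => ?_) continuousOn_id
              rw [uIcc_of_le he] at hr
              exact (he0.trans_le hr.1).ne'
            exact (intervalIntegrable_iff_integrableOn_Ioc_of_le he).1 this
          · filter_upwards [ae_restrict_mem measurableSet_Ioc] with r hr
            exact inv_nonneg.2 (he0.trans hr.1).le
    _ = _ := by rw [ENNReal.ofReal_add zero_le_one hl]; simp

theorem lintegral_inv_pow_five_compl_ball (x : Space) {R : ℝ} (hR : 0 < R) :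
    ∫⁻ y in (Metric.ball x R)ᶜ, ENNReal.ofReal ((‖x - y‖ ^ 5)⁻¹) ≤
      ENNReal.ofReal (3 * ballVolume * (R ^ 2)⁻¹) := by
  have h1 : ∫⁻ y in (Metric.ball x R)ᶜ, ENNReal.ofReal ((‖x - y‖ ^ 5)⁻¹) =
      ∫⁻ y : Space, (Ici R).indicator (fun r => ENNReal.ofReal ((r ^ 5)⁻¹)) ‖y‖ := by
    rw [← lintegral_indicator measurableSet_ball.compl]
    rw [← lintegral_sub_left_eq_self _ x]
    refine lintegral_congr fun y => ?_
    simp [indicator]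
  rw [h1, lintegral_fun_norm (Measurable.indicator (by fun_prop) measurableSet_Ici),
    ENNReal.ofReal_mul (p := 3 * ballVolume) (by have := ballVolume_nonneg; positivity)]
  gcongr
  calc ∫⁻ r in Ioi (0 : ℝ), ENNReal.ofReal (r ^ 2) *
        (Ici R).indicator (fun r => ENNReal.ofReal ((r ^ 5)⁻¹)) r
      = ∫⁻ r in Ioi (0 : ℝ), (Ici R).indicator (fun r => ENNReal.ofReal (r ^ (-3 : ℝ))) r := by
        refine setLIntegral_congr_fun measurableSet_Ioi fun r (hr : 0 < r) => ?_
        by_cases h : R ≤ r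
        · simp only [indicator, mem_Ici, h, if_true]
          rw [← ENNReal.ofReal_mul (by positivity)]
          congr 1
          rw [Real.rpow_neg hr.le]
          norm_cast
          field_simp
        · simp [indicator, h]
    _ = ∫⁻ r in Ioi R, ENNReal.ofReal (r ^ (-3 : ℝ)) := by
        rw [setLIntegral_indicator measurableSet_Ici,
          inter_eq_left.2 (show Ici R ⊆ Ioi 0 from fun r hr => hR.trans_le hr)]
        exact setLIntegral_congr Ioi_ae_eq_Ici.symm
    _ = ENNReal.ofReal (∫ r in Ioi R, r ^ (-3 : ℝ)) := by
        rw [ofReal_integral_eq_lintegral_ofReal]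
        · exact integrableOn_Ioi_rpow_of_lt (by norm_num) hR
        · filter_upwards [ae_restrict_mem measurableSet_Ioi] with r hr
          exact Real.rpow_nonneg (hR.trans hr).le _
    _ ≤ _ := by
        apply ENNReal.ofReal_le_ofReal
        rw [integral_Ioi_rpow_of_lt (by norm_num) hR]
        norm_num
        positivity

theorem norm_coulomb (z : Space) : ‖coulomb z‖ = (‖z‖ ^ 2)⁻¹ := by
  rcases eq_or_ne z 0 with rfl | hz
  · simp [coulomb]
  · have : 0 < ‖z‖ := norm_pos_iff.2 hz
    rw [coulomb, norm_smul, norm_inv, norm_pow, norm_norm]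
    field_simp

theorem measurable_coulomb : Measurable coulomb := by
  unfold coulomb; fun_prop

theorem coulomb_neg (z : Space) : coulomb (-z) = -coulomb z := by simp [coulomb]

/-- The Coulomb kernel truncated at the scale `δ`. -/
noncomputable def coulombReg (δ : ℝ) (z : Space) : Space := ((max ‖z‖ δ) ^ 3)⁻¹ • z

theorem continuous_coulombReg {δ : ℝ} (hδ : 0 < δ) : Continuous (coulombReg δ) := by
  unfold coulombReg
  refine Continuous.smul (Continuous.inv₀ ((continuous_norm.max continuous_const).pow 3)
    fun z => ?_) continuous_id
  exact (pow_pos (lt_max_of_lt_right hδ) 3).ne'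

theorem coulombReg_eq {δ : ℝ} {z : Space} (h : δ ≤ ‖z‖) : coulombReg δ z = coulomb z := by
  rw [coulombReg, coulomb, max_eq_left h]

theorem norm_coulombReg_le {δ : ℝ} (hδ : 0 < δ) (z : Space) : ‖coulombReg δ z‖ ≤ (δ ^ 2)⁻¹ := by
  have h : 0 < max ‖z‖ δ := lt_max_of_lt_right hδ
  rw [coulombReg, norm_smul, norm_inv, norm_pow, Real.norm_of_nonneg h.le]
  calc ((max ‖z‖ δ) ^ 3)⁻¹ * ‖z‖ ≤ ((max ‖z‖ δ) ^ 3)⁻¹ * max ‖z‖ δ := by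
        gcongr; exact le_max_left _ _
    _ = ((max ‖z‖ δ) ^ 2)⁻¹ := by field_simp
    _ ≤ _ := by gcongr; exact le_max_right _ _

theorem norm_coulomb_sub_coulombReg_le {δ : ℝ} (hδ : 0 < δ) (z : Space) :
    ‖coulomb z - coulombReg δ z‖ ≤ (Iio δ).indicator (fun r => (r ^ 2)⁻¹) ‖z‖ := by
  by_cases h : ‖z‖ < δ
  · rcases eq_or_ne z 0 with rfl | hz
    · simp [coulomb, coulombReg, indicator, hδ]
    have hz0 : 0 < ‖z‖ := norm_pos_iff.2 hz
    simp only [indicator, mem_Iio, h, if_true]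
    rw [← norm_coulomb, coulomb, coulombReg, max_eq_right h.le, ← sub_smul, norm_smul, norm_smul]
    gcongr
    have : (δ ^ 3)⁻¹ ≤ (‖z‖ ^ 3)⁻¹ := by gcongr
    have h0 : 0 ≤ (δ ^ 3)⁻¹ := by positivity
    rw [Real.norm_of_nonneg (by linarith), Real.norm_of_nonneg (by positivity)]
    linarith
  · rw [coulombReg_eq (not_lt.1 h)]
    simp [indicator, h]

/-- With m ≤ n the two truncated norms, the difference is n⁻³(z - w) + (m⁻³ - n⁻³)z, and the second
coefficient is controlled by n - m ≤ ‖z - w‖. Keeping the cubes of the truncated norms, instead of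
δ³, makes the integral against a bounded density grow only logarithmically in δ. -/
theorem norm_coulombReg_sub_le {δ : ℝ} (hδ : 0 < δ) (z w : Space) :
    ‖coulombReg δ z - coulombReg δ w‖ ≤
      4 * ‖z - w‖ * (((max ‖z‖ δ) ^ 3)⁻¹ + ((max ‖w‖ δ) ^ 3)⁻¹) := by
  wlog h : ‖z‖ ≤ ‖w‖ generalizing z w
  · have := this w z (le_of_not_ge h)
    rwa [norm_sub_rev, norm_sub_rev z w, add_comm (((max ‖z‖ δ) ^ 3)⁻¹)]
  set m := max ‖z‖ δ with hm
  set n := max ‖w‖ δ with hn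
  have hm0 : 0 < m := lt_max_of_lt_right hδ
  have hn0 : 0 < n := lt_max_of_lt_right hδ
  have hmn : m ≤ n := max_le_max_right _ h
  have hnm : n - m ≤ ‖z - w‖ := by
    have h1 : |n - m| ≤ |‖w‖ - ‖z‖| := abs_max_sub_max_le_abs _ _ _
    have h2 : |‖w‖ - ‖z‖| ≤ ‖w - z‖ := abs_norm_sub_norm_le _ _
    rw [norm_sub_rev]
    exact (le_abs_self _).trans (h1.trans h2)
  have hzm : ‖z‖ ≤ m := le_max_left _ _
  have key : coulombReg δ z - coulombReg δ w =
      (n ^ 3)⁻¹ • (z - w) + ((m ^ 3)⁻¹ - (n ^ 3)⁻¹) • z := by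
    simp only [coulombReg, ← hm, ← hn, smul_sub, sub_smul]; abel
  have hle : (n ^ 3)⁻¹ ≤ (m ^ 3)⁻¹ := by gcongr
  have h3 : ((m ^ 3)⁻¹ - (n ^ 3)⁻¹) * m ≤ 3 * (n - m) * (m ^ 3)⁻¹ := by
    have : ((m ^ 3)⁻¹ - (n ^ 3)⁻¹) * m = (n - m) * (m ^ 3)⁻¹ * (m * (n ^ 2 + n * m + m ^ 2) / n ^ 3)
      := by field_simp; ring
    rw [this]
    have h4 : m * (n ^ 2 + n * m + m ^ 2) / n ^ 3 ≤ 3 := by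
      rw [div_le_iff₀ (by positivity)]
      have : m * (n ^ 2 + n * m + m ^ 2) ≤ n * (n ^ 2 + n * n + n ^ 2) := by gcongr
      linarith
    have h5 : 0 ≤ (n - m) * (m ^ 3)⁻¹ := mul_nonneg (by linarith) (by positivity)
    nlinarith
  calc ‖coulombReg δ z - coulombReg δ w‖
      ≤ (n ^ 3)⁻¹ * ‖z - w‖ + ((m ^ 3)⁻¹ - (n ^ 3)⁻¹) * ‖z‖ := by
        rw [key]
        refine (norm_add_le _ _).trans (le_of_eq ?_)
        rw [norm_smul, norm_smul, Real.norm_of_nonneg (by positivity),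
          Real.norm_of_nonneg (by linarith)]
    _ ≤ (n ^ 3)⁻¹ * ‖z - w‖ + ((m ^ 3)⁻¹ - (n ^ 3)⁻¹) * m := by
        gcongr
    _ ≤ (n ^ 3)⁻¹ * ‖z - w‖ + 3 * ‖z - w‖ * (m ^ 3)⁻¹ := by
        refine add_le_add le_rfl (h3.trans ?_)
        gcongr
    _ ≤ _ := by
        have h0 : 0 ≤ ‖z - w‖ * (m ^ 3)⁻¹ := by positivity
        have h1 : 0 ≤ ‖z - w‖ * (n ^ 3)⁻¹ := by positivity
        nlinarith

theorem lipschitz_coulombReg {δ : ℝ} (hδ : 0 < δ) (z w : Space) :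
    ‖coulombReg δ z - coulombReg δ w‖ ≤ 8 * (δ ^ 3)⁻¹ * ‖z - w‖ := by
  calc ‖coulombReg δ z - coulombReg δ w‖
      ≤ 4 * ‖z - w‖ * (((max ‖z‖ δ) ^ 3)⁻¹ + ((max ‖w‖ δ) ^ 3)⁻¹) := norm_coulombReg_sub_le hδ z w
    _ ≤ 4 * ‖z - w‖ * ((δ ^ 3)⁻¹ + (δ ^ 3)⁻¹) := by
        gcongr
        · exact le_max_right _ _
        · exact le_max_right _ _
    _ = _ := by ring

end PlasmaCharge

/-! ### The field of a bounded integrable density. -/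

namespace PlasmaCharge

open MeasureTheory Set
open scoped ENNReal NNReal

theorem setLIntegral_density_inv_sq_ball {ρ : Space → ℝ} {M : ℝ} (hM : 0 ≤ M)
    (hb : ∀ᵐ y, ‖ρ y‖ ≤ M) (x : Space) (R : ℝ) :
    ∫⁻ y in Metric.ball x R, ‖ρ y‖ₑ * ENNReal.ofReal ((‖x - y‖ ^ 2)⁻¹) ≤
      ENNReal.ofReal (M * (3 * ballVolume * R)) := by
  calc _ ≤ ∫⁻ y in Metric.ball x R, ENNReal.ofReal M * ENNReal.ofReal ((‖x - y‖ ^ 2)⁻¹) := by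
        refine lintegral_mono_ae (ae_restrict_of_ae ?_)
        filter_upwards [hb] with y hy
        gcongr
        rw [← ofReal_norm]
        exact ENNReal.ofReal_le_ofReal hy
    _ ≤ _ := by
        rw [lintegral_const_mul _ (by fun_prop), ENNReal.ofReal_mul hM]
        gcongr
        exact lintegral_inv_sq_ball x R

theorem lintegral_density_inv_sq {ρ : Space → ℝ} {M : ℝ} (hM : 0 ≤ M)
    (hb : ∀ᵐ y, ‖ρ y‖ ≤ M) (hi : ∫⁻ y, ‖ρ y‖ₑ ≤ ENNReal.ofReal M) (x : Space) :
    ∫⁻ y, ‖ρ y‖ₑ * ENNReal.ofReal ((‖x - y‖ ^ 2)⁻¹) ≤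
      ENNReal.ofReal (M * (3 * ballVolume + 1)) := by
  have hv := ballVolume_nonneg
  rw [← lintegral_add_compl _ (measurableSet_ball (x := x) (ε := 1)), mul_add,
    ENNReal.ofReal_add (by positivity) (by positivity)]
  refine add_le_add ?_ ?_
  · simpa using setLIntegral_density_inv_sq_ball hM hb x 1
  · calc _ ≤ ∫⁻ y in (Metric.ball x 1)ᶜ, ‖ρ y‖ₑ := by
          refine setLIntegral_mono' measurableSet_ball.compl fun y hy => ?_
          have : 1 ≤ ‖x - y‖ := by
            simpa [dist_eq_norm, norm_sub_rev] using hy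
          calc _ ≤ ‖ρ y‖ₑ * ENNReal.ofReal 1 := by
                gcongr
                exact inv_le_one_of_one_le₀ (one_le_pow₀ this)
            _ = _ := by simp
      _ ≤ ∫⁻ y, ‖ρ y‖ₑ := setLIntegral_le_lintegral _ _
      _ ≤ _ := by simpa using hi

theorem lintegral_density_inv_max_cube {ρ : Space → ℝ} {M : ℝ} (hM : 0 ≤ M)
    (hb : ∀ᵐ y, ‖ρ y‖ ≤ M) (hi : ∫⁻ y, ‖ρ y‖ₑ ≤ ENNReal.ofReal M) {l : ℝ} (hl : 0 ≤ l)
    (x : Space) :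
    ∫⁻ y, ‖ρ y‖ₑ * ENNReal.ofReal (((max ‖x - y‖ (Real.exp (-l))) ^ 3)⁻¹) ≤
      ENNReal.ofReal (M * (3 * ballVolume * (1 + l) + 1)) := by
  have hv := ballVolume_nonneg
  rw [← lintegral_add_compl _ (measurableSet_ball (x := x) (ε := 1)), mul_add,
    ENNReal.ofReal_add (by positivity) (by positivity)]
  refine add_le_add ?_ ?_
  · calc _ ≤ ∫⁻ y in Metric.ball x 1,
          ENNReal.ofReal M * ENNReal.ofReal (((max ‖x - y‖ (Real.exp (-l))) ^ 3)⁻¹) := by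
          refine lintegral_mono_ae (ae_restrict_of_ae ?_)
          filter_upwards [hb] with y hy
          gcongr
          rw [← ofReal_norm]
          exact ENNReal.ofReal_le_ofReal hy
      _ ≤ _ := by
          rw [lintegral_const_mul _ (by fun_prop), ENNReal.ofReal_mul hM]
          gcongr
          exact lintegral_inv_max_cube_ball x hl
  · calc _ ≤ ∫⁻ y in (Metric.ball x 1)ᶜ, ‖ρ y‖ₑ := by
          refine setLIntegral_mono' measurableSet_ball.compl fun y hy => ?_
          have : 1 ≤ ‖x - y‖ := by
            simpa [dist_eq_norm, norm_sub_rev] using hy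
          calc _ ≤ ‖ρ y‖ₑ * ENNReal.ofReal 1 := by
                gcongr
                exact inv_le_one_of_one_le₀ (one_le_pow₀ (this.trans (le_max_left _ _)))
            _ = _ := by simp
      _ ≤ ∫⁻ y, ‖ρ y‖ₑ := setLIntegral_le_lintegral _ _
      _ ≤ _ := by simpa using hi

theorem enorm_smul_coulomb (ρ : Space → ℝ) (x y : Space) :
    ‖ρ y • coulomb (x - y)‖ₑ = ‖ρ y‖ₑ * ENNReal.ofReal ((‖x - y‖ ^ 2)⁻¹) := by
  rw [enorm_smul, ← norm_coulomb, ofReal_norm]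

theorem integrable_density_smul_coulomb {ρ : Space → ℝ} {M : ℝ} (hM : 0 ≤ M)
    (hm : AEStronglyMeasurable ρ volume)
    (hb : ∀ᵐ y, ‖ρ y‖ ≤ M) (hi : ∫⁻ y, ‖ρ y‖ₑ ≤ ENNReal.ofReal M) (x : Space) :
    Integrable (fun y => ρ y • coulomb (x - y)) := by
  refine ⟨hm.smul (measurable_coulomb.comp (by fun_prop)).aestronglyMeasurable, ?_⟩
  rw [hasFiniteIntegral_iff_enorm]
  simp_rw [enorm_smul_coulomb]
  exact (lintegral_density_inv_sq hM hb hi x).trans_lt ENNReal.ofReal_lt_top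

theorem norm_integral_le_of_lintegral {α E : Type*} [MeasurableSpace α] [NormedAddCommGroup E]
    [NormedSpace ℝ E] {μ : Measure α} {g : α → E} {C : ℝ} (hC : 0 ≤ C) (h : ∫⁻ a, ‖g a‖ₑ ∂μ ≤ ENNReal.ofReal C) :
    ‖∫ a, g a ∂μ‖ ≤ C := by
  have := (enorm_integral_le_lintegral_enorm g).trans h
  rw [← ofReal_norm] at this
  exact (ENNReal.ofReal_le_ofReal_iff hC).1 this

theorem norm_density_field_le {ρ : Space → ℝ} {M : ℝ} (hM : 0 ≤ M)
    (hb : ∀ᵐ y, ‖ρ y‖ ≤ M) (hi : ∫⁻ y, ‖ρ y‖ₑ ≤ ENNReal.ofReal M) (x : Space) :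
    ‖∫ y, ρ y • coulomb (x - y)‖ ≤ M * (3 * ballVolume + 1) := by
  have hv := ballVolume_nonneg
  refine norm_integral_le_of_lintegral (by positivity) ?_
  simp_rw [enorm_smul_coulomb]
  exact lintegral_density_inv_sq hM hb hi x

/-- The field of a bounded integrable density is log-Lipschitz. -/
theorem norm_density_field_sub_le {ρ : Space → ℝ} {M : ℝ} (hM : 0 ≤ M)
    (hm : AEStronglyMeasurable ρ volume)
    (hb : ∀ᵐ y, ‖ρ y‖ ≤ M) (hi : ∫⁻ y, ‖ρ y‖ₑ ≤ ENNReal.ofReal M) (x x' : Space) {l : ℝ}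
    (hl : 0 ≤ l) :
    ‖(∫ y, ρ y • coulomb (x - y)) - ∫ y, ρ y • coulomb (x' - y)‖ ≤
      M * (24 * ballVolume + 8) * ((1 + l) * ‖x - x'‖ + Real.exp (-l)) := by
  have hv := ballVolume_nonneg
  have he := Real.exp_pos (-l)
  rw [← integral_sub (integrable_density_smul_coulomb hM hm hb hi x)
    (integrable_density_smul_coulomb hM hm hb hi x')]
  refine norm_integral_le_of_lintegral (by positivity) ?_
  set δ := Real.exp (-l) with hδ
  -- The kernel is truncated at δ = e^(-l). The two balls of radius δ, where it was altered,
  -- contribute O(δ); the truncated kernel contributes ‖x - x'‖ times an integral of order 1 + l.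
  have hpt : ∀ y, ‖ρ y • coulomb (x - y) - ρ y • coulomb (x' - y)‖ₑ ≤
      (Metric.ball x δ).indicator (fun y => ‖ρ y‖ₑ * ENNReal.ofReal ((‖x - y‖ ^ 2)⁻¹)) y +
      (Metric.ball x' δ).indicator (fun y => ‖ρ y‖ₑ * ENNReal.ofReal ((‖x' - y‖ ^ 2)⁻¹)) y +
      (ENNReal.ofReal (4 * ‖x - x'‖) *
          (‖ρ y‖ₑ * ENNReal.ofReal (((max ‖x - y‖ δ) ^ 3)⁻¹)) +
        ENNReal.ofReal (4 * ‖x - x'‖) *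
          (‖ρ y‖ₑ * ENNReal.ofReal (((max ‖x' - y‖ δ) ^ 3)⁻¹))) := by
    intro y
    have hind : ∀ u : Space, ‖ρ y‖ₑ * ENNReal.ofReal ((Iio δ).indicator (fun r => (r ^ 2)⁻¹) ‖u - y‖)
        = (Metric.ball u δ).indicator
          (fun y => ‖ρ y‖ₑ * ENNReal.ofReal ((‖u - y‖ ^ 2)⁻¹)) y := by
      intro u
      by_cases h : ‖u - y‖ < δ
      · simp [indicator, h, dist_eq_norm, norm_sub_rev y u]
      · simp [indicator, h, dist_eq_norm, norm_sub_rev y u]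
    have h1 := norm_coulomb_sub_coulombReg_le he (x - y)
    have h2 := norm_coulomb_sub_coulombReg_le he (x' - y)
    have h3 := norm_coulombReg_sub_le he (x - y) (x' - y)
    rw [sub_sub_sub_cancel_right] at h3
    have h4 : ‖coulomb (x - y) - coulomb (x' - y)‖ ≤
        (Iio δ).indicator (fun r => (r ^ 2)⁻¹) ‖x - y‖ +
        (Iio δ).indicator (fun r => (r ^ 2)⁻¹) ‖x' - y‖ +
        (4 * ‖x - x'‖ * ((max ‖x - y‖ δ) ^ 3)⁻¹ + 4 * ‖x - x'‖ * ((max ‖x' - y‖ δ) ^ 3)⁻¹) := by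
      have : coulomb (x - y) - coulomb (x' - y) = (coulomb (x - y) - coulombReg δ (x - y)) -
          (coulomb (x' - y) - coulombReg δ (x' - y)) +
          (coulombReg δ (x - y) - coulombReg δ (x' - y)) := by abel
      rw [this, ← mul_add]
      refine (norm_add_le _ _).trans (add_le_add ((norm_sub_le _ _).trans (add_le_add h1 h2)) h3)
    rw [← smul_sub, enorm_smul, ← hind x, ← hind x', ← ofReal_norm (coulomb _ - _)]
    have hn : ∀ u : Space, 0 ≤ (Iio δ).indicator (fun r : ℝ => (r ^ 2)⁻¹) ‖u‖ := fun u =>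
      indicator_nonneg (fun r _ => by positivity) _
    have hp : ∀ u : Space, 0 ≤ 4 * ‖x - x'‖ * ((max ‖u‖ δ) ^ 3)⁻¹ := fun u => by
      have : 0 ≤ max ‖u‖ δ := (norm_nonneg u).trans (le_max_left _ _)
      positivity
    refine (mul_le_mul' le_rfl (ENNReal.ofReal_le_ofReal h4)).trans (le_of_eq ?_)
    rw [ENNReal.ofReal_add (add_nonneg (hn _) (hn _)) (add_nonneg (hp _) (hp _)),
      ENNReal.ofReal_add (hn _) (hn _), ENNReal.ofReal_add (hp _) (hp _),
      ENNReal.ofReal_mul (p := 4 * ‖x - x'‖) (by positivity),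
      ENNReal.ofReal_mul (p := 4 * ‖x - x'‖) (by positivity)]
    ring
  refine (lintegral_mono hpt).trans ?_
  have hρ : AEMeasurable (fun y => ‖ρ y‖ₑ) volume := hm.enorm
  have hmi : ∀ u : Space, AEMeasurable ((Metric.ball u δ).indicator
      (fun y => ‖ρ y‖ₑ * ENNReal.ofReal ((‖u - y‖ ^ 2)⁻¹))) volume := fun u =>
    (hρ.mul (by fun_prop)).indicator measurableSet_ball
  have hmc : ∀ u : Space, AEMeasurable
      (fun y => ‖ρ y‖ₑ * ENNReal.ofReal (((max ‖u - y‖ δ) ^ 3)⁻¹)) volume := fun u =>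
    hρ.mul (by fun_prop)
  rw [lintegral_add_left' ((hmi x).fun_add (hmi x')), lintegral_add_left' (hmi x),
    lintegral_add_left' ((hmc x).const_mul _), lintegral_const_mul'' _ (hmc x),
    lintegral_const_mul'' _ (hmc x'),
    lintegral_indicator measurableSet_ball, lintegral_indicator measurableSet_ball]
  have b1 := setLIntegral_density_inv_sq_ball hM hb x δ
  have b2 := setLIntegral_density_inv_sq_ball hM hb x' δ
  have b3 := lintegral_density_inv_max_cube hM hb hi hl x
  have b4 := lintegral_density_inv_max_cube hM hb hi hl x'
  refine (add_le_add (add_le_add b1 b2) (add_le_add (mul_le_mul' le_rfl b3)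
    (mul_le_mul' le_rfl b4))).trans ?_
  rw [← ENNReal.ofReal_mul (by positivity), ← ENNReal.ofReal_add (by positivity) (by positivity),
    ← ENNReal.ofReal_add (by positivity) (by positivity),
    ← ENNReal.ofReal_add (by positivity) (by positivity)]
  apply ENNReal.ofReal_le_ofReal
  have e1 : 0 ≤ M * ballVolume * δ := by positivity
  have e2 : 0 ≤ M * δ := by positivity
  have e3 : 0 ≤ M * l * ‖x - x'‖ := by positivity
  nlinarith

end PlasmaCharge

/-! ### A splitting scheme by volume preserving shears. -/

namespace PlasmaCharge

open MeasureTheory Set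
open scoped ENNReal NNReal Interval

/-- One step of the splitting scheme: free transport during the time `τ`, followed by the
velocity increment `g`. -/
def splitStep (τ : ℝ) (g : Space → Space) (z : Phase) : Phase :=
  (z.1 + τ • z.2, z.2 + g (z.1 + τ • z.2))

/-- The inverse of `splitStep`. -/
def splitStepInv (τ : ℝ) (g : Space → Space) (z : Phase) : Phase :=
  (z.1 - τ • (z.2 - g z.1), z.2 - g z.1)

theorem splitStep_splitStepInv (τ : ℝ) (g : Space → Space) (z : Phase) :
    splitStep τ g (splitStepInv τ g z) = z := by
  simp [splitStep, splitStepInv]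

theorem continuous_splitStep (τ : ℝ) {g : Space → Space} (hg : Continuous g) :
    Continuous (splitStep τ g) := by
  unfold splitStep; fun_prop

/-- The map is a shear in the velocity followed by a shear in the position, the latter conjugated by
the exchange of the two factors. A shear translates each fibre, hence preserves volume whatever the
regularity of `g` beyond measurability. -/
theorem measurePreserving_splitStepInv (τ : ℝ) {g : Space → Space} (hg : Measurable g) :
    MeasurePreserving (splitStepInv τ g) (volume : Measure Phase) volume := by
  have h1 : MeasurePreserving (fun z : Phase => ((z.1, z.2 - g z.1) : Phase)) volume volume :=
    MeasurePreserving.skew_product (f := id) (g := fun x v => v - g x)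
      (MeasurePreserving.id _) (by fun_prop)
      (Filter.Eventually.of_forall fun x => (measurePreserving_sub_right volume (g x)).map_eq)
  have h2 : MeasurePreserving (fun z : Phase => ((z.1, z.2 - τ • z.1) : Phase)) volume volume :=
    MeasurePreserving.skew_product (f := id) (g := fun x v => v - τ • x)
      (MeasurePreserving.id _) (by fun_prop)
      (Filter.Eventually.of_forall fun x => (measurePreserving_sub_right volume (τ • x)).map_eq)
  have h3 : MeasurePreserving (Prod.swap : Phase → Phase) volume volume :=
    Measure.measurePreserving_swap
  exact (h3.comp (h2.comp h3)).comp h1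

/-- The composition of the first `n` steps of the splitting scheme. -/
def splitFlow (τ : ℝ) (g : ℕ → Space → Space) : ℕ → Phase → Phase
  | 0 => id
  | n + 1 => splitStep τ (g n) ∘ splitFlow τ g n

/-- The inverse of `splitFlow`. -/
def splitFlowInv (τ : ℝ) (g : ℕ → Space → Space) : ℕ → Phase → Phase
  | 0 => id
  | n + 1 => splitFlowInv τ g n ∘ splitStepInv τ (g n)

theorem splitFlow_splitFlowInv (τ : ℝ) (g : ℕ → Space → Space) (n : ℕ) (z : Phase) :
    splitFlow τ g n (splitFlowInv τ g n z) = z := by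
  induction n generalizing z with
  | zero => rfl
  | succ n ih => simp [splitFlow, splitFlowInv, ih, splitStep_splitStepInv]

theorem continuous_splitFlow (τ : ℝ) {g : ℕ → Space → Space} (n : ℕ)
    (hn : ∀ k < n, Continuous (g k)) : Continuous (splitFlow τ g n) := by
  induction n with
  | zero => exact continuous_id
  | succ n ih =>
    exact (continuous_splitStep τ (hn n n.lt_succ_self)).comp
      (ih fun k hk => hn k (hk.trans n.lt_succ_self))

theorem measurePreserving_splitFlowInv (τ : ℝ) {g : ℕ → Space → Space} (n : ℕ)
    (hn : ∀ k < n, Measurable (g k)) :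
    MeasurePreserving (splitFlowInv τ g n) (volume : Measure Phase) volume := by
  induction n with
  | zero => exact MeasurePreserving.id _
  | succ n ih =>
    exact (ih fun k hk => hn k (hk.trans n.lt_succ_self)).comp
      (measurePreserving_splitStepInv τ (hn n n.lt_succ_self))

/-- Measurability of `V'` comes for free, because it agrees with `deriv V` inside the interval. The
bound is only needed almost everywhere, which matches what is known of the field of a solution. -/
theorem intervalIntegrable_and_integral_eq_sub {E : Type*} [NormedAddCommGroup E] [NormedSpace ℝ E]
    [CompleteSpace E] {V V' : ℝ → E} {s t C : ℝ}
    (h : ∀ r ∈ uIcc s t, HasDerivWithinAt V (V' r) (uIcc s t) r)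
    (hb : ∀ᵐ r ∂(volume.restrict (Ι s t)), ‖V' r‖ ≤ C) :
    IntervalIntegrable V' volume s t ∧ ∫ r in s..t, V' r = V t - V s := by
  have hd : ∀ r ∈ Ioo (min s t) (max s t), HasDerivAt V (V' r) r := fun r hr =>
    (h r (Ioo_subset_Icc_self hr)).hasDerivAt (Icc_mem_nhds hr.1 hr.2)
  have hint : IntervalIntegrable V' volume s t := by
    rw [intervalIntegrable_iff]
    have hm : AEStronglyMeasurable V' (volume.restrict (Ι s t)) := by
      refine AEStronglyMeasurable.congr
        (stronglyMeasurable_deriv V).aestronglyMeasurable ?_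
      have : (volume.restrict (Ι s t)) = volume.restrict (Ioo (min s t) (max s t)) := by
        rw [uIoc, Measure.restrict_congr_set Ioo_ae_eq_Ioc]
      rw [this]
      filter_upwards [ae_restrict_mem measurableSet_Ioo] with r hr
      exact (hd r hr).deriv
    have : IsFiniteMeasure (volume.restrict (Ι s t)) := ⟨by simp [uIoc]⟩
    exact Integrable.of_bound hm C hb
  refine ⟨hint, intervalIntegral.integral_eq_sub_of_hasDeriv_right
    (fun r hr => (h r hr).continuousWithinAt) (fun r hr => (hd r hr).hasDerivWithinAt) hint⟩

/-- The discrete Gronwall estimate of the splitting scheme. -/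
theorem splitting_gronwall {a b : ℕ → ℝ} {n : ℕ} {h lam C W d : ℝ} (hh : 0 ≤ h) (hlam : 1 ≤ lam)
    (hhl : h * lam ≤ 1) (hC : 0 ≤ C) (hW : 0 ≤ W) (hd : 0 ≤ d) (ha : ∀ k, 0 ≤ a k)
    (hb : ∀ k, 0 ≤ b k) (ha0 : a 0 = 0) (hb0 : b 0 = 0)
    (hsa : ∀ k < n, a (k + 1) ≤ a k + h * b k + C * h ^ 2)
    (hsb : ∀ k < n, b (k + 1) ≤ b k + h * (lam ^ 2 * (W * h + a (k + 1)) + d)) :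
    lam * a n + b n ≤ n * h * (2 * lam * C * h + lam ^ 2 * W * h + d) *
      Real.exp (2 * lam * (n * h)) := by
  set κ := 2 * lam * C * h + lam ^ 2 * W * h + d with hκ
  have hκ0 : 0 ≤ κ := by positivity
  -- Velocity errors feed the position at rate 1 and position errors feed the velocity at rate lam².
  -- Weighting the position error by lam balances the two, and the growth rate is of order lam
  -- instead of lam².
  have key : ∀ k ≤ n, lam * a k + b k ≤ k * h * κ * (1 + 2 * (h * lam)) ^ k := by
    intro k hk
    induction k with
    | zero => simp [ha0, hb0]
    | succ k ih =>
      have ih := ih (by omega)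
      have h1 := hsa k (by omega)
      have h2 := hsb k (by omega)
      have hak := ha k
      have hbk := hb k
      have hl0 : 0 ≤ lam := by linarith
      have e1 : lam * a (k + 1) + b (k + 1) ≤ (1 + 2 * (h * lam)) * (lam * a k + b k) + h * κ := by
        have s1 : (lam + h * lam ^ 2) * a (k + 1) ≤
            (lam + h * lam ^ 2) * (a k + h * b k + C * h ^ 2) := by gcongr
        have s2 : h * lam * (h * lam * b k) ≤ 1 * (h * lam * b k) := by gcongr
        have s3 : h * lam * (lam * C * h ^ 2) ≤ 1 * (lam * C * h ^ 2) := by gcongr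
        have s4 : 0 ≤ h * lam * (lam * a k) := by positivity
        rw [hκ]
        nlinarith
      have hone : 1 ≤ 1 + 2 * (h * lam) := by nlinarith [mul_nonneg hh hl0]
      calc _ ≤ _ := e1
        _ ≤ (1 + 2 * (h * lam)) * (k * h * κ * (1 + 2 * (h * lam)) ^ k) +
            h * κ * (1 + 2 * (h * lam)) ^ (k + 1) := by
          refine add_le_add (by gcongr) ?_
          exact le_mul_of_one_le_right (by positivity : 0 ≤ h * κ) (one_le_pow₀ hone)
        _ = _ := by push_cast; ring
  refine (key n le_rfl).trans ?_
  gcongr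
  have : 1 + 2 * (h * lam) ≤ Real.exp (2 * (h * lam)) := by
    linarith [Real.add_one_le_exp (2 * (h * lam))]
  calc (1 + 2 * (h * lam)) ^ n ≤ Real.exp (2 * (h * lam)) ^ n := by
        have : 0 ≤ h * lam := by positivity
        gcongr
    _ = _ := by rw [← Real.exp_nat_mul]; congr 1; ring

end PlasmaCharge

/-! ### Trajectories of log-Lipschitz force fields. -/

namespace PlasmaCharge

open MeasureTheory Set
open scoped ENNReal NNReal Interval

/-- `F` is a time dependent force field, bounded by `C` and log-Lipschitz in space with constant
`C` at almost every time between `s` and `t`. -/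
structure IsLogLipschitzField (F : ℝ → Space → Space) (C s t : ℝ) : Prop where
  one_le : 1 ≤ C
  meas : ∀ x, AEStronglyMeasurable (fun r => F r x) (volume.restrict (Ι s t))
  bound : ∀ᵐ r ∂(volume.restrict (Ι s t)), ∀ x, ‖F r x‖ ≤ C
  logLip : ∀ᵐ r ∂(volume.restrict (Ι s t)), ∀ x y l, 0 ≤ l →
    ‖F r x - F r y‖ ≤ C * ((1 + l) * ‖x - y‖ + Real.exp (-l))

/-- `(X, V)` follows the force field `F` between the times `s` and `t`. -/
structure IsTrajectory (F : ℝ → Space → Space) (W s t : ℝ) (X V : ℝ → Space) : Prop where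
  pos : ∀ r ∈ uIcc s t, HasDerivWithinAt X (V r) (uIcc s t) r
  vel : ∀ r ∈ uIcc s t, HasDerivWithinAt V (F r (X r)) (uIcc s t) r
  le : ∀ r ∈ uIcc s t, ‖V r‖ ≤ W

variable {F : ℝ → Space → Space} {C W s t s' t' : ℝ} {X V : ℝ → Space}

theorem IsLogLipschitzField.mono (h : IsLogLipschitzField F C s t) (hs : s' ∈ uIcc s t)
    (ht : t' ∈ uIcc s t) : IsLogLipschitzField F C s' t' := by
  have hsub : Ι s' t' ⊆ Ι s t := by
    have := uIcc_subset_uIcc hs ht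
    rw [uIcc, uIcc, Icc_subset_Icc_iff inf_le_sup] at this
    exact Ioc_subset_Ioc this.1 this.2
  have hle := Measure.restrict_mono_set volume hsub
  exact ⟨h.one_le, fun x => (h.meas x).mono_measure hle, ae_mono hle h.bound, ae_mono hle h.logLip⟩

theorem IsTrajectory.mono (h : IsTrajectory F W s t X V) (hs : s' ∈ uIcc s t)
    (ht : t' ∈ uIcc s t) : IsTrajectory F W s' t' X V := by
  have hsub := uIcc_subset_uIcc hs ht
  exact ⟨fun r hr => (h.pos r (hsub hr)).mono hsub, fun r hr => (h.vel r (hsub hr)).mono hsub,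
    fun r hr => h.le r (hsub hr)⟩

theorem IsTrajectory.integral (h : IsTrajectory F W s t X V) (hF : IsLogLipschitzField F C s t) :
    IntervalIntegrable (fun r => F r (X r)) volume s t ∧ ∫ r in s..t, F r (X r) = V t - V s :=
  intervalIntegrable_and_integral_eq_sub h.vel (by filter_upwards [hF.bound] with r hr using hr _)

theorem norm_intervalIntegral_le_of_ae_restrict {f : ℝ → Space} {C : ℝ}
    (h : ∀ᵐ r ∂(volume.restrict (Ι s t)), ‖f r‖ ≤ C) : ‖∫ r in s..t, f r‖ ≤ C * |t - s| :=
  intervalIntegral.norm_integral_le_of_norm_le_const_ae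
    ((ae_restrict_iff' measurableSet_uIoc).1 h)

theorem IsLogLipschitzField.intervalIntegrable (hF : IsLogLipschitzField F C s t) (x : Space) :
    IntervalIntegrable (fun r => F r x) volume s t := by
  rw [intervalIntegrable_iff]
  have : IsFiniteMeasure (volume.restrict (Ι s t)) := ⟨by simp [uIoc]⟩
  exact Integrable.of_bound (hF.meas x) C (by filter_upwards [hF.bound] with r hr using hr _)

theorem IsTrajectory.norm_velocity_sub_le (h : IsTrajectory F W s t X V)
    (hF : IsLogLipschitzField F C s t) : ‖V t - V s‖ ≤ C * |t - s| := by
  rw [← (h.integral hF).2]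
  exact norm_intervalIntegral_le_of_ae_restrict (by filter_upwards [hF.bound] with r hr using hr _)

theorem IsTrajectory.norm_position_sub_le (h : IsTrajectory F W s t X V) :
    ‖X t - X s‖ ≤ W * |t - s| :=
  Convex.norm_image_sub_le_of_norm_hasDerivWithin_le h.pos h.le (convex_uIcc s t)
    left_mem_uIcc right_mem_uIcc

theorem IsTrajectory.norm_position_sub_sub_le (h : IsTrajectory F W s t X V)
    (hF : IsLogLipschitzField F C s t) : ‖X t - X s - (t - s) • V s‖ ≤ C * |t - s| ^ 2 := by
  have hC : 0 ≤ C := zero_le_one.trans hF.one_le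
  have h1 : ∀ r ∈ uIcc s t, HasDerivWithinAt (fun r => X r - r • V s) (V r - (1 : ℝ) • V s)
      (uIcc s t) r := fun r hr =>
    (h.pos r hr).sub ((hasDerivWithinAt_id r _).smul_const (V s))
  have h2 : ∀ r ∈ uIcc s t, ‖V r - (1 : ℝ) • V s‖ ≤ C * |t - s| := fun r hr => by
    rw [one_smul]
    refine ((h.mono left_mem_uIcc hr).norm_velocity_sub_le (hF.mono left_mem_uIcc hr)).trans ?_
    exact mul_le_mul_of_nonneg_left (abs_sub_left_of_mem_uIcc hr) hC
  have h3 := Convex.norm_image_sub_le_of_norm_hasDerivWithin_le h1 h2 (convex_uIcc s t)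
    left_mem_uIcc right_mem_uIcc
  have e : X t - t • V s - (X s - s • V s) = X t - X s - (t - s) • V s := by
    rw [sub_smul]; abel
  rw [e] at h3
  refine h3.trans (le_of_eq ?_)
  rw [Real.norm_eq_abs]; ring

/-- The parameter l is taken large enough to make the term e^(-l) small, and then y close to x.
Continuity is what makes the kicks of the splitting scheme measurable and its steps continuous. -/
theorem IsLogLipschitzField.continuous_integral (hF : IsLogLipschitzField F C s t) :
    Continuous fun x => ∫ r in s..t, F r x := by
  have hC : 0 < C := zero_lt_one.trans_le hF.one_le
  rw [Metric.continuous_iff]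
  intro x ε hε
  obtain ⟨l, hl, hle⟩ : ∃ l : ℝ, 0 ≤ l ∧ C * Real.exp (-l) * |t - s| ≤ ε / 2 := by
    refine ⟨2 * C * |t - s| / ε, by positivity, ?_⟩
    rw [Real.exp_neg]
    have h1 := Real.add_one_le_exp (2 * C * |t - s| / ε)
    have h2 : 0 < Real.exp (2 * C * |t - s| / ε) := Real.exp_pos _
    rw [mul_assoc, mul_comm _ |t - s|, ← mul_assoc, ← div_eq_mul_inv, div_le_iff₀ h2]
    calc C * |t - s| = ε / 2 * (2 * C * |t - s| / ε) := by field_simp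
      _ ≤ _ := by gcongr; linarith
  refine ⟨ε / (4 * C * (1 + l) * (|t - s| + 1)), by positivity, fun y hy => ?_⟩
  rw [dist_eq_norm, ← intervalIntegral.integral_sub (hF.intervalIntegrable y)
    (hF.intervalIntegrable x)]
  have h1 : ‖∫ r in s..t, (F r y - F r x)‖ ≤
      C * ((1 + l) * ‖y - x‖ + Real.exp (-l)) * |t - s| :=
    norm_intervalIntegral_le_of_ae_restrict
      (by filter_upwards [hF.logLip] with r hr using hr _ _ _ hl)
  rw [dist_eq_norm, lt_div_iff₀ (by positivity)] at hy
  have h3 : C * (1 + l) * ‖y - x‖ * |t - s| ≤ ε / 4 := by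
    have : 0 ≤ C * (1 + l) * ‖y - x‖ := by positivity
    nlinarith
  nlinarith

end PlasmaCharge

/-! ### Convergence of the splitting scheme. -/

namespace PlasmaCharge

open MeasureTheory Set
open scoped ENNReal NNReal Interval

variable {F : ℝ → Space → Space} {C W s t s' t' : ℝ} {X V : ℝ → Space}

theorem add_mul_sub_mem_uIcc (s t : ℝ) {θ : ℝ} (h0 : 0 ≤ θ) (h1 : θ ≤ 1) :
    s + θ * (t - s) ∈ uIcc s t := by
  rcases le_total s t with h | h
  · rw [uIcc_of_le h]; constructor <;> nlinarith
  · rw [uIcc_of_ge h]; constructor <;> nlinarith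

/-- The error of the splitting scheme for the time step `(t - s) / n`. -/
theorem norm_splitFlow_sub_le (hF : IsLogLipschitzField F C s t) (hW : 0 ≤ W) {n : ℕ} (hn : 0 < n)
    {l : ℝ} (hl : 0 ≤ l) (hnl : |t - s| / n * √(C * (1 + l)) ≤ 1)
    (hX : IsTrajectory F W s t X V) :
    ‖splitFlow ((t - s) / n) (fun k x => ∫ r in (s + k * ((t - s) / n))..(s + (k + 1) * ((t - s) / n)),
      F r x) n (X s, V s) - (X t, V t)‖ ≤
    |t - s| * (2 * √(C * (1 + l)) * C * (|t - s| / n) + C * (1 + l) * W * (|t - s| / n) +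
      C * Real.exp (-l)) * Real.exp (2 * √(C * (1 + l)) * |t - s|) := by
  have hn' : (0 : ℝ) < n := Nat.cast_pos.2 hn
  set τ := (t - s) / n with hτ
  set g : ℕ → Space → Space := fun k x => ∫ r in (s + k * τ)..(s + (k + 1) * τ), F r x with hg
  set T : ℕ → ℝ := fun k => s + k * τ with hT
  have hC1 := hF.one_le
  have hC : 0 ≤ C := zero_le_one.trans hC1
  have hmem : ∀ k ≤ n, T k ∈ uIcc s t := by
    intro k hk
    have : T k = s + (k / n) * (t - s) := by simp only [hT, hτ]; ring
    rw [this]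
    refine add_mul_sub_mem_uIcc s t (by positivity) ?_
    rw [div_le_one hn']
    exact_mod_cast hk
  have hTn : T n = t := by simp only [hT, hτ]; field_simp; ring
  have hT0 : T 0 = s := by simp [hT]
  have hTs : ∀ k, T (k + 1) - T k = τ := fun k => by simp only [hT]; push_cast; ring
  set h := |τ| with hh
  have hhn : h = |t - s| / n := by rw [hh, hτ, abs_div, Nat.abs_cast]
  set Y : ℕ → Phase := fun k => splitFlow τ g k (X s, V s) with hY
  have hY1 : ∀ k, (Y (k + 1)).1 = (Y k).1 + τ • (Y k).2 := fun k => rfl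
  have hY2 : ∀ k, (Y (k + 1)).2 = (Y k).2 + g k (Y (k + 1)).1 := fun k => rfl
  set a : ℕ → ℝ := fun k => ‖(Y k).1 - X (T k)‖ with ha
  set b : ℕ → ℝ := fun k => ‖(Y k).2 - V (T k)‖ with hb
  set lam := √(C * (1 + l)) with hlam
  have hlam2 : lam ^ 2 = C * (1 + l) := Real.sq_sqrt (by positivity)
  have hlam1 : 1 ≤ lam := by
    rw [hlam, Real.one_le_sqrt]
    nlinarith
  have hsub : ∀ k < n, IsTrajectory F W (T k) (T (k + 1)) X V := fun k hk =>
    hX.mono (hmem k hk.le) (hmem (k + 1) hk)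
  have hFsub : ∀ k < n, IsLogLipschitzField F C (T k) (T (k + 1)) := fun k hk =>
    hF.mono (hmem k hk.le) (hmem (k + 1) hk)
  -- Free transport only misses the effect C h² of the acceleration on the position.
  have hsa : ∀ k < n, a (k + 1) ≤ a k + h * b k + C * h ^ 2 := by
    intro k hk
    have h1 := (hsub k hk).norm_position_sub_sub_le (hFsub k hk)
    rw [hTs] at h1
    have e : (Y (k + 1)).1 - X (T (k + 1)) = ((Y k).1 - X (T k)) + τ • ((Y k).2 - V (T k)) -
        (X (T (k + 1)) - X (T k) - τ • V (T k)) := by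
      rw [hY1, smul_sub]; abel
    calc a (k + 1) = ‖((Y k).1 - X (T k)) + τ • ((Y k).2 - V (T k)) -
        (X (T (k + 1)) - X (T k) - τ • V (T k))‖ := by rw [← e]
      _ ≤ ‖(Y k).1 - X (T k)‖ + ‖τ • ((Y k).2 - V (T k))‖ +
          ‖X (T (k + 1)) - X (T k) - τ • V (T k)‖ :=
        (norm_sub_le _ _).trans (add_le_add (norm_add_le _ _) le_rfl)
      _ ≤ _ := by
        rw [norm_smul, Real.norm_eq_abs]
        exact add_le_add le_rfl h1
  -- The kick integrates the field over the substep at the frozen point `(Y (k + 1)).1`. Its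
  -- distance to the trajectory is at most W h, the displacement during the substep, plus the
  -- position error.
  have hsb : ∀ k < n, b (k + 1) ≤ b k + h * (lam ^ 2 * (W * h + a (k + 1)) + C * Real.exp (-l)) := by
    intro k hk
    obtain ⟨hi, he⟩ := (hsub k hk).integral (hFsub k hk)
    have hgk : g k (Y (k + 1)).1 = ∫ r in (T k)..(T (k + 1)), F r (Y (k + 1)).1 := by
      simp only [hg, hT]; push_cast; rfl
    have e : (Y (k + 1)).2 - V (T (k + 1)) = ((Y k).2 - V (T k)) +
        ∫ r in (T k)..(T (k + 1)), (F r (Y (k + 1)).1 - F r (X r)) := by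
      rw [intervalIntegral.integral_sub ((hFsub k hk).intervalIntegrable _) hi, he, hY2, ← hgk]
      abel
    have hdiff : ‖∫ r in (T k)..(T (k + 1)), (F r (Y (k + 1)).1 - F r (X r))‖ ≤
        (lam ^ 2 * (W * h + a (k + 1)) + C * Real.exp (-l)) * |T (k + 1) - T k| := by
      refine norm_intervalIntegral_le_of_ae_restrict ?_
      filter_upwards [(hFsub k hk).logLip, ae_restrict_mem measurableSet_uIoc] with r hr hrm
      refine (hr _ _ l hl).trans ?_
      have hr' : r ∈ uIcc (T k) (T (k + 1)) := uIoc_subset_uIcc hrm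
      have h1 : ‖X (T (k + 1)) - X r‖ ≤ W * h := by
        refine ((hsub k hk).mono hr' right_mem_uIcc).norm_position_sub_le.trans ?_
        have := abs_sub_right_of_mem_uIcc hr'
        rw [hTs] at this
        gcongr
      have h2 : ‖(Y (k + 1)).1 - X r‖ ≤ W * h + a (k + 1) := by
        have : (Y (k + 1)).1 - X r = (X (T (k + 1)) - X r) + ((Y (k + 1)).1 - X (T (k + 1))) := by
          abel
        rw [this]
        exact (norm_add_le _ _).trans (add_le_add h1 le_rfl)
      rw [hlam2, mul_add]
      have := mul_le_mul_of_nonneg_left h2 (by positivity : 0 ≤ C * (1 + l))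
      linarith
    rw [hTs] at hdiff
    calc b (k + 1) = ‖((Y k).2 - V (T k)) +
        ∫ r in (T k)..(T (k + 1)), (F r (Y (k + 1)).1 - F r (X r))‖ := by rw [← e]
      _ ≤ b k + _ := (norm_add_le _ _).trans (add_le_add le_rfl hdiff)
      _ = _ := by ring
  have hgr := splitting_gronwall (a := a) (b := b) (n := n) (abs_nonneg τ) hlam1
    (by rw [← hh, hhn]; exact hnl) hC hW (by positivity) (fun _ => norm_nonneg _)
    (fun _ => norm_nonneg _) (by simp [ha, hT0, hY, splitFlow]) (by simp [hb, hT0, hY, splitFlow])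
    hsa hsb
  have hnh : n * h = |t - s| := by rw [hhn]; field_simp
  rw [← hh, hnh, hlam2, hhn] at hgr
  refine le_trans ?_ hgr
  have han : 0 ≤ a n := norm_nonneg _
  have hbn : 0 ≤ b n := norm_nonneg _
  have : ‖Y n - (X t, V t)‖ = max (a n) (b n) := by
    rw [Prod.norm_def]; simp only [ha, hb, hTn]; rfl
  rw [this]
  refine max_le ?_ ?_ <;> nlinarith

/-- The flow of a log-Lipschitz force field is approximated uniformly by continuous maps with
volume preserving inverses. -/
theorem IsLogLipschitzField.exists_approx (hF : IsLogLipschitzField F C s t) (hW : 0 ≤ W) {ε : ℝ}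
    (hε : 0 < ε) : ∃ S R : Phase → Phase, Continuous S ∧
      MeasurePreserving R (volume : Measure Phase) volume ∧ (∀ z, S (R z) = z) ∧
      ∀ X V, IsTrajectory F W s t X V → ‖S (X s, V s) - (X t, V t)‖ ≤ ε := by
  have hC1 := hF.one_le
  have hC : 0 < C := zero_lt_one.trans_le hC1
  set D := |t - s| with hD
  have hD0 : 0 ≤ D := abs_nonneg _
  -- The Gronwall factor grows like the exponential of √l, so e^(-l) wins. With 1 + l = m² the total
  -- exponent is 1 + 2√C D m - m², and the choice of m makes it at most -y, where y e^(-y) ≤ 1.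
  obtain ⟨l, hl, hle⟩ : ∃ l : ℝ, 0 ≤ l ∧
      D * (C * Real.exp (-l)) * Real.exp (2 * √(C * (1 + l)) * D) ≤ ε / 2 := by
    set y := 2 * D * C / ε with hy
    have hy0 : 0 ≤ y := by positivity
    set m := 2 * D * √C + 1 + y with hm
    have hm1 : 1 ≤ m := by
      have : 0 ≤ 2 * D * √C := by positivity
      linarith
    refine ⟨m ^ 2 - 1, by nlinarith, ?_⟩
    have h1 : √(C * (1 + (m ^ 2 - 1))) = √C * m := by
      rw [add_sub_cancel, Real.sqrt_mul hC.le, Real.sqrt_sq (by linarith)]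
    have h2 : D * (C * Real.exp (-(m ^ 2 - 1))) * Real.exp (2 * (√C * m) * D) =
        D * C * Real.exp (-(m ^ 2 - 1) + 2 * (√C * m) * D) := by
      rw [Real.exp_add]; ring
    have h3 : -(m ^ 2 - 1) + 2 * (√C * m) * D ≤ -y := by
      have : m ^ 2 - 2 * (√C * m) * D = m * (1 + y) := by rw [hm]; ring
      nlinarith
    rw [h1, h2]
    calc D * C * Real.exp (-(m ^ 2 - 1) + 2 * (√C * m) * D) ≤ D * C * Real.exp (-y) := by gcongr
      _ = ε / 2 * (y * Real.exp (-y)) := by rw [hy]; field_simp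
      _ ≤ ε / 2 * 1 := by
        gcongr
        rw [Real.exp_neg, ← div_eq_mul_inv, div_le_one (Real.exp_pos _)]
        linarith [Real.add_one_le_exp y]
      _ = _ := mul_one _
  set lam := √(C * (1 + l)) with hlam
  have hlam0 : 0 ≤ lam := Real.sqrt_nonneg _
  set E := Real.exp (2 * lam * D) with hE
  have hE0 : 0 < E := Real.exp_pos _
  set A := D * (2 * lam * C + C * (1 + l) * W) * E with hA
  have hA0 : 0 ≤ A := by positivity
  -- Now that l is fixed, the number of substeps makes the remaining errors, of first order in D/n,
  -- at most ε/2. The term D lam ensures the smallness condition of the Gronwall estimate.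
  obtain ⟨n, hn⟩ := exists_nat_gt (D * lam + 2 * A * D / ε)
  have hn0 : (0 : ℝ) < n := lt_of_le_of_lt (by positivity) hn
  have hnn : 0 < n := Nat.cast_pos.1 hn0
  have hA1 : 0 ≤ 2 * A * D / ε := by positivity
  have hb1 : D / n * lam ≤ 1 := by
    rw [div_mul_eq_mul_div, div_le_one hn0]; linarith
  have hb2 : A * (D / n) ≤ ε / 2 := by
    rw [← mul_div_assoc, div_le_iff₀ hn0]
    have h1 : 2 * A * D / ε ≤ n := by
      have : 0 ≤ D * lam := by positivity
      linarith
    rw [div_le_iff₀ hε] at h1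
    linarith
  set g : ℕ → Space → Space := fun k x =>
    ∫ r in (s + k * ((t - s) / n))..(s + (k + 1) * ((t - s) / n)), F r x with hg
  have hmem : ∀ k : ℕ, k ≤ n → s + k * ((t - s) / n) ∈ uIcc s t := by
    intro k hk
    have : s + k * ((t - s) / n) = s + (k / n) * (t - s) := by ring
    rw [this]
    refine add_mul_sub_mem_uIcc s t (by positivity) ?_
    rw [div_le_one hn0]
    exact_mod_cast hk
  have hgc : ∀ k < n, Continuous (g k) := by
    intro k hk
    have h2 := hmem (k + 1) hk
    push_cast at h2
    exact (hF.mono (hmem k hk.le) h2).continuous_integral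
  refine ⟨splitFlow ((t - s) / n) g n, splitFlowInv ((t - s) / n) g n, continuous_splitFlow _ n hgc,
    measurePreserving_splitFlowInv _ n fun k hk => (hgc k hk).measurable,
    splitFlow_splitFlowInv _ _ n, fun X V hX => ?_⟩
  refine (norm_splitFlow_sub_le hF hW hnn hl hb1 hX).trans ?_
  have : D * (2 * lam * C * (D / n) + C * (1 + l) * W * (D / n) + C * Real.exp (-l)) * E =
      A * (D / n) + D * (C * Real.exp (-l)) * E := by rw [hA]; ring
  rw [this]
  linarith

end PlasmaCharge

/-! ### Continuity of the flow and Liouville's theorem. -/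

namespace PlasmaCharge

open MeasureTheory Set Filter Topology
open scoped ENNReal NNReal Interval

variable {ι : Type*} [TopologicalSpace ι] {K : Set ι} {F : ℝ → Space → Space} {C W s t : ℝ}
  {X V : ι → ℝ → Space}

theorem continuousOn_flow (hF : IsLogLipschitzField F C s t) (hW : 0 ≤ W)
    (hX : ∀ z ∈ K, IsTrajectory F W s t (X z) (V z))
    (hs : ContinuousOn (fun z => ((X z s, V z s) : Phase)) K) :
    ContinuousOn (fun z => ((X z t, V z t) : Phase)) K := by
  refine continuousOn_of_uniform_approx_of_continuousOn fun u hu => ?_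
  obtain ⟨ε, hε, hu⟩ := Metric.mem_uniformity_dist.1 hu
  obtain ⟨S, R, hS, -, -, h⟩ := hF.exists_approx hW (half_pos hε)
  refine ⟨fun z => S (X z s, V z s), hS.comp_continuousOn hs, fun z hz => hu ?_⟩
  rw [dist_comm, dist_eq_norm]
  exact (h _ _ (hX z hz)).trans_lt (half_lt_self hε)

/-- Let S approximate the flow within ε, with volume preserving right inverse R. If R w lies in the
image at time s, then w = S(R w) lies within ε of the image at time t. The preimage by R thus sits
in the closed ε-thickening of that image, and the volumes of these thickenings decrease to the
volume of the compact image as ε tends to 0. -/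
theorem volume_image_flow_le (hF : IsLogLipschitzField F C s t) (hW : 0 ≤ W)
    (hX : ∀ z ∈ K, IsTrajectory F W s t (X z) (V z))
    (hs : ContinuousOn (fun z => ((X z s, V z s) : Phase)) K)
    (ht : ContinuousOn (fun z => ((X z t, V z t) : Phase)) K) (hK : IsCompact K) :
    volume ((fun z => ((X z s, V z s) : Phase)) '' K) ≤
      volume ((fun z => ((X z t, V z t) : Phase)) '' K) := by
  have hc := (hK.image_of_continuousOn ht)
  refine ge_of_tendsto ((tendsto_measure_cthickening_of_isCompact hc).mono_left
    (nhdsWithin_le_nhds (s := Ioi 0))) ?_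
  filter_upwards [self_mem_nhdsWithin] with ε hε
  obtain ⟨S, R, -, hR, hSR, h⟩ := hF.exists_approx hW hε
  rw [← hR.measure_preimage (hK.image_of_continuousOn hs).measurableSet.nullMeasurableSet]
  refine measure_mono fun w hw => ?_
  obtain ⟨z, hz, hzw⟩ := hw
  refine Metric.mem_cthickening_of_dist_le w _ ε _ (mem_image_of_mem _ hz) ?_
  rw [← hSR w, ← hzw, dist_eq_norm]
  exact h _ _ (hX z hz)

theorem IsLogLipschitzField.symm (hF : IsLogLipschitzField F C s t) :
    IsLogLipschitzField F C t s := hF.mono right_mem_uIcc left_mem_uIcc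

theorem IsTrajectory.symm {X V : ℝ → Space} (h : IsTrajectory F W s t X V) :
    IsTrajectory F W t s X V := h.mono right_mem_uIcc left_mem_uIcc

/-- Liouville's theorem for the trajectories of a log-Lipschitz force field. -/
theorem map_flow_restrict {K : Set Phase} {X V : Phase → ℝ → Space}
    (hF : IsLogLipschitzField F C s t) (hW : 0 ≤ W)
    (hX : ∀ z ∈ K, IsTrajectory F W s t (X z) (V z)) (hK : IsCompact K)
    (hs : ∀ z ∈ K, (X z s, V z s) = z) :
    (volume.restrict K).map (fun z => ((X z t, V z t) : Phase)) =
      volume.restrict ((fun z => ((X z t, V z t) : Phase)) '' K) := by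
  have hcs : ContinuousOn (fun z => ((X z s, V z s) : Phase)) K :=
    continuousOn_id.congr fun z hz => hs z hz
  have hct := continuousOn_flow hF hW hX hcs
  have hm : AEMeasurable (fun z => ((X z t, V z t) : Phase)) (volume.restrict K) :=
    hct.aemeasurable hK.measurableSet
  have hfin : IsFiniteMeasure (volume.restrict K) := ⟨by simpa using hK.measure_lt_top⟩
  have hfin : IsFiniteMeasure ((volume.restrict K).map (fun z => ((X z t, V z t) : Phase))) :=
    inferInstance
  -- Closed sets form a generating π-system and their traces on K are compact. The one-sided volume
  -- comparison, used forwards and backwards in time, gives equality on them.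
  have key : ∀ D : Set Phase, IsClosed D →
      (volume.restrict K).map (fun z => ((X z t, V z t) : Phase)) D =
      volume.restrict ((fun z => ((X z t, V z t) : Phase)) '' K) D := by
    intro D hD
    obtain ⟨u, hu, he⟩ := continuousOn_iff_isClosed.1 hct D hD
    have hB : IsCompact (K ∩ (fun z => ((X z t, V z t) : Phase)) ⁻¹' D) := by
      rw [inter_comm, he]
      exact hK.inter_left hu
    rw [Measure.map_apply_of_aemeasurable hm hD.measurableSet,
      Measure.restrict_apply₀' hK.measurableSet.nullMeasurableSet,
      Measure.restrict_apply hD.measurableSet, inter_comm D, ← image_inter_preimage, inter_comm _ K]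
    set B := K ∩ (fun z => ((X z t, V z t) : Phase)) ⁻¹' D with hBdef
    have hXB : ∀ z ∈ B, IsTrajectory F W s t (X z) (V z) := fun z hz => hX z hz.1
    have h1 : (fun z => ((X z s, V z s) : Phase)) '' B = B := by
      rw [image_congr fun z hz => hs z hz.1]; simp
    have l1 := volume_image_flow_le hF hW hXB (hcs.mono inter_subset_left)
      (hct.mono inter_subset_left) hB
    have l2 := volume_image_flow_le hF.symm hW (fun z hz => (hXB z hz).symm)
      (hct.mono inter_subset_left) (hcs.mono inter_subset_left) hB
    rw [h1] at l1 l2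
    exact le_antisymm l1 l2
  refine ext_of_generate_finite {D | IsClosed D} ?_ isPiSystem_isClosed (fun D hD => key D hD)
    (key _ isClosed_univ)
  rw [BorelSpace.measurable_eq (α := Phase), borel_eq_generateFrom_isClosed]

end PlasmaCharge

/-! ### Lagrangian description and qualitative bounds on the field. -/

namespace PlasmaCharge

open MeasureTheory Set Filter Topology
open scoped ENNReal NNReal Interval

/-- The electric field created at time `t` by plasma particles of positions `X z t` distributed
with respect to `μ`. -/
noncomputable def lagrangianField (μ : Measure Phase) (X : Phase → ℝ → Space) (t : ℝ) (x : Space) :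
    Space := ∫ z, coulomb (x - X z t) ∂μ

/-- The Lagrangian description of a solution: the plasma particles are labelled by the points of the
compact set `K`, distributed with respect to the probability measure `μ`. -/
structure IsLagrangian {N : ℕ} (T A W δ : ℝ) (K : Set Phase) (μ : Measure Phase)
    (ξ η : Fin N → ℝ → Space) (X V : Phase → ℝ → Space) : Prop where
  prob : IsProbabilityMeasure μ
  compact : IsCompact K
  supp : μ Kᶜ = 0
  density_nonneg : 0 ≤ A
  speed_nonneg : 0 ≤ W
  dist_pos : 0 < δ
  cont : ∀ t ∈ Icc 0 T, ContinuousOn (fun z => ((X z t, V z t) : Phase)) K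
  map_le : ∀ t ∈ Icc 0 T, μ.map (fun z => ((X z t, V z t) : Phase)) ≤ ENNReal.ofReal A • volume
  speed_le : ∀ z ∈ K, ∀ t ∈ Icc 0 T, ‖V z t‖ ≤ W
  away : ∀ z ∈ K, ∀ t ∈ Icc 0 T, ∀ α, δ ≤ ‖X z t - ξ α t‖
  charge_ne : ∀ t ∈ Icc 0 T, ∀ α β, α ≠ β → ξ α t ≠ ξ β t
  charge_pos : ∀ α, ∀ t ∈ Icc 0 T, HasDerivWithinAt (ξ α) (η α t) (Icc 0 T) t
  charge_vel : ∀ α, ∀ t ∈ Icc 0 T, HasDerivWithinAt (η α)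
    (lagrangianField μ X t (ξ α t) + ∑ β ∈ Finset.univ.erase α, coulomb (ξ α t - ξ β t))
    (Icc 0 T) t
  pos : ∀ z ∈ K, ∀ t ∈ Icc 0 T, HasDerivWithinAt (X z) (V z t) (Icc 0 T) t
  vel : ∀ z ∈ K, ∀ t ∈ Icc 0 T, HasDerivWithinAt (V z)
    (lagrangianField μ X t (X z t) + ∑ α, coulomb (X z t - ξ α t)) (Icc 0 T) t

variable {K : Set Phase} {μ : Measure Phase} {X V : Phase → ℝ → Space} {A W t P R : ℝ}

theorem volume_closedBall_space (b : Space) {P : ℝ} (hP : 0 ≤ P) :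
    volume (Metric.closedBall b P) = ENNReal.ofReal (ballVolume * P ^ 3) := by
  rw [Measure.addHaar_closedBall _ _ hP, ← ofReal_ballVolume, mul_comm ballVolume,
    ENNReal.ofReal_mul (by positivity)]
  simp

theorem lintegral_comp_le {Z : Phase → Phase} (hZ : AEMeasurable Z μ)
    (h : μ.map Z ≤ ENNReal.ofReal A • volume) {G : Phase → ℝ≥0∞} (hG : Measurable G) :
    ∫⁻ z, G (Z z) ∂μ ≤ ENNReal.ofReal A * ∫⁻ w : Phase, G w := by
  rw [← lintegral_map' hG.aemeasurable hZ, ← smul_eq_mul, ← lintegral_smul_measure]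
  exact lintegral_mono' h le_rfl

/-- The mass of slow particles close to a point, weighted by the inverse square distance. -/
theorem lintegral_near_le {Z : Phase → Phase} (hZ : AEMeasurable Z μ) (hA : 0 ≤ A)
    (h : μ.map Z ≤ ENNReal.ofReal A • volume) (x b : Space) (hP : 0 ≤ P) (R : ℝ) :
    ∫⁻ z, {w : Phase | ‖w.2 - b‖ ≤ P ∧ ‖x - w.1‖ < R}.indicator
      (fun w => ENNReal.ofReal ((‖x - w.1‖ ^ 2)⁻¹)) (Z z) ∂μ ≤
    ENNReal.ofReal (A * (3 * ballVolume * R) * (ballVolume * P ^ 3)) := by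
  have hms : MeasurableSet {w : Phase | ‖w.2 - b‖ ≤ P ∧ ‖x - w.1‖ < R} :=
    (measurableSet_le (f := fun w : Phase => ‖w.2 - b‖) (g := fun _ => P) (by fun_prop)
      (by fun_prop)).inter (measurableSet_lt (f := fun w : Phase => ‖x - w.1‖) (g := fun _ => R)
      (by fun_prop) (by fun_prop))
  refine (lintegral_comp_le hZ h (Measurable.indicator (by fun_prop) hms)).trans ?_
  have e : ∀ w : Phase, {w : Phase | ‖w.2 - b‖ ≤ P ∧ ‖x - w.1‖ < R}.indicator
      (fun w => ENNReal.ofReal ((‖x - w.1‖ ^ 2)⁻¹)) w =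
      (Metric.ball x R).indicator (fun y => ENNReal.ofReal ((‖x - y‖ ^ 2)⁻¹)) w.1 *
      (Metric.closedBall b P).indicator (fun _ => 1) w.2 := by
    intro w
    by_cases h1 : ‖w.2 - b‖ ≤ P <;> by_cases h2 : ‖x - w.1‖ < R <;>
      simp [indicator, h1, h2, dist_eq_norm, norm_sub_rev w.1 x]
  simp_rw [e]
  rw [Measure.volume_eq_prod, lintegral_prod_mul
    (f := (Metric.ball x R).indicator (fun y => ENNReal.ofReal ((‖x - y‖ ^ 2)⁻¹)))
    (g := (Metric.closedBall b P).indicator (fun _ => 1))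
    (Measurable.indicator (by fun_prop) measurableSet_ball).aemeasurable
    (Measurable.indicator (by fun_prop) measurableSet_closedBall).aemeasurable,
    lintegral_indicator measurableSet_ball, lintegral_indicator measurableSet_closedBall,
    lintegral_one, Measure.restrict_apply_univ, volume_closedBall_space b hP]
  have hv := ballVolume_nonneg
  rw [ENNReal.ofReal_mul' (p := A * (3 * ballVolume * R)) (by positivity), ENNReal.ofReal_mul hA,
    mul_assoc]
  gcongr
  exact lintegral_inv_sq_ball x R

theorem aemeasurable_of_continuousOn_supp {E : Type*} [TopologicalSpace E] [MeasurableSpace E]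
    [BorelSpace E] {Z : Phase → E} (hK : IsCompact K) (hs : μ Kᶜ = 0)
    (hZ : ContinuousOn Z K) : AEMeasurable Z μ := by
  have : μ.restrict K = μ := by
    rw [Measure.restrict_eq_self_of_ae_mem]
    exact mem_ae_iff.2 hs
  rw [← this]
  exact hZ.aemeasurable hK.measurableSet

theorem aestronglyMeasurable_of_continuousOn_supp {E : Type*} [NormedAddCommGroup E]
    {Z : Phase → E} (hK : IsCompact K) (hs : μ Kᶜ = 0)
    (hZ : ContinuousOn Z K) : AEStronglyMeasurable Z μ := by
  have : μ.restrict K = μ := by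
    rw [Measure.restrict_eq_self_of_ae_mem]
    exact mem_ae_iff.2 hs
  rw [← this]
  exact hZ.aestronglyMeasurable_of_isCompact hK hK.measurableSet

theorem integrable_of_continuousOn_supp [IsFiniteMeasure μ] {E : Type*} [NormedAddCommGroup E]
    {Z : Phase → E} (hK : IsCompact K) (hs : μ Kᶜ = 0)
    (hZ : ContinuousOn Z K) : Integrable Z μ := by
  have : μ.restrict K = μ := by
    rw [Measure.restrict_eq_self_of_ae_mem]
    exact mem_ae_iff.2 hs
  rw [← this]
  exact hZ.integrableOn_compact hK

/-- The speed bound W depends on the solution. The estimates in terms of W serve for integrability,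
continuity and limits, and never enter the final constants. -/
theorem lintegral_near_bounded_le (hK : IsCompact K) (hs : μ Kᶜ = 0) (hA : 0 ≤ A) (hW : 0 ≤ W)
    (hc : ContinuousOn (fun z => ((X z t, V z t) : Phase)) K)
    (hm : μ.map (fun z => ((X z t, V z t) : Phase)) ≤ ENNReal.ofReal A • volume)
    (hV : ∀ z ∈ K, ‖V z t‖ ≤ W) (x : Space) (R : ℝ) :
    ∫⁻ z, {z | ‖x - X z t‖ < R}.indicator (fun z => ENNReal.ofReal ((‖x - X z t‖ ^ 2)⁻¹)) z ∂μ ≤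
    ENNReal.ofReal (A * (3 * ballVolume * R) * (ballVolume * W ^ 3)) := by
  refine le_trans (lintegral_mono_ae ?_)
    (lintegral_near_le (aemeasurable_of_continuousOn_supp hK hs hc) hA hm x 0 hW R)
  have : ∀ᵐ z ∂μ, z ∈ K := mem_ae_iff.2 hs
  filter_upwards [this] with z hz
  have := hV z hz
  by_cases h2 : ‖x - X z t‖ < R <;> simp [indicator, h2, this]

theorem lintegral_inv_sq_le [IsProbabilityMeasure μ] (hK : IsCompact K) (hs : μ Kᶜ = 0)
    (hA : 0 ≤ A) (hW : 0 ≤ W)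
    (hc : ContinuousOn (fun z => ((X z t, V z t) : Phase)) K)
    (hm : μ.map (fun z => ((X z t, V z t) : Phase)) ≤ ENNReal.ofReal A • volume)
    (hV : ∀ z ∈ K, ‖V z t‖ ≤ W) (x : Space) :
    ∫⁻ z, ENNReal.ofReal ((‖x - X z t‖ ^ 2)⁻¹) ∂μ ≤
    ENNReal.ofReal (A * (3 * ballVolume) * (ballVolume * W ^ 3) + 1) := by
  have hv := ballVolume_nonneg
  calc _ ≤ ∫⁻ z, ({z | ‖x - X z t‖ < 1}.indicator
        (fun z => ENNReal.ofReal ((‖x - X z t‖ ^ 2)⁻¹)) z + 1) ∂μ := by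
        refine lintegral_mono fun z => ?_
        by_cases h : ‖x - X z t‖ < 1
        · simp [indicator, h]
        · have : ENNReal.ofReal ((‖x - X z t‖ ^ 2)⁻¹) ≤ ENNReal.ofReal 1 :=
            ENNReal.ofReal_le_ofReal (inv_le_one_of_one_le₀ (one_le_pow₀ (not_lt.1 h)))
          simpa [indicator, h] using this
    _ ≤ _ := by
        rw [lintegral_add_right _ measurable_const, ENNReal.ofReal_add (by positivity) zero_le_one]
        refine add_le_add ?_ (by simp)
        simpa using lintegral_near_bounded_le hK hs hA hW hc hm hV x 1

namespace IsLagrangian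

variable {N : ℕ} {T δ : ℝ} {ξ η : Fin N → ℝ → Space}

theorem ae_mem (h : IsLagrangian T A W δ K μ ξ η X V) : ∀ᵐ z ∂μ, z ∈ K := mem_ae_iff.2 h.supp

theorem continuousOn_pos (h : IsLagrangian T A W δ K μ ξ η X V) (ht : t ∈ Icc 0 T) :
    ContinuousOn (fun z => X z t) K := continuous_fst.comp_continuousOn (h.cont t ht)

theorem continuousOn_vel (h : IsLagrangian T A W δ K μ ξ η X V) (ht : t ∈ Icc 0 T) :
    ContinuousOn (fun z => V z t) K := continuous_snd.comp_continuousOn (h.cont t ht)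

theorem aemeasurable_pos (h : IsLagrangian T A W δ K μ ξ η X V) (ht : t ∈ Icc 0 T) :
    AEMeasurable (fun z => X z t) μ :=
  aemeasurable_of_continuousOn_supp h.compact h.supp (h.continuousOn_pos ht)

theorem aemeasurable_vel (h : IsLagrangian T A W δ K μ ξ η X V) (ht : t ∈ Icc 0 T) :
    AEMeasurable (fun z => V z t) μ :=
  aemeasurable_of_continuousOn_supp h.compact h.supp (h.continuousOn_vel ht)

theorem lintegral_enorm_coulomb_le (h : IsLagrangian T A W δ K μ ξ η X V) (ht : t ∈ Icc 0 T)
    (x : Space) : ∫⁻ z, ‖coulomb (x - X z t)‖ₑ ∂μ ≤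
      ENNReal.ofReal (A * (3 * ballVolume) * (ballVolume * W ^ 3) + 1) := by
  have := h.prob
  simp_rw [← ofReal_norm, norm_coulomb]
  exact lintegral_inv_sq_le h.compact h.supp h.density_nonneg h.speed_nonneg (h.cont t ht)
    (h.map_le t ht) (fun z hz => h.speed_le z hz t ht) x

theorem aestronglyMeasurable_coulomb (h : IsLagrangian T A W δ K μ ξ η X V) (ht : t ∈ Icc 0 T)
    (x : Space) : AEStronglyMeasurable (fun z => coulomb (x - X z t)) μ :=
  (measurable_coulomb.comp_aemeasurable
    ((h.aemeasurable_pos ht).const_sub x)).aestronglyMeasurable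

theorem integrable_coulomb (h : IsLagrangian T A W δ K μ ξ η X V) (ht : t ∈ Icc 0 T)
    (x : Space) : Integrable (fun z => coulomb (x - X z t)) μ :=
  ⟨h.aestronglyMeasurable_coulomb ht x,
    (h.lintegral_enorm_coulomb_le ht x).trans_lt ENNReal.ofReal_lt_top⟩

theorem norm_field_le (h : IsLagrangian T A W δ K μ ξ η X V) (ht : t ∈ Icc 0 T) (x : Space) :
    ‖lagrangianField μ X t x‖ ≤ A * (3 * ballVolume) * (ballVolume * W ^ 3) + 1 := by
  have hv := ballVolume_nonneg
  have := h.density_nonneg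
  have := h.speed_nonneg
  exact norm_integral_le_of_lintegral (by positivity) (h.lintegral_enorm_coulomb_le ht x)

theorem integrable_coulombReg (h : IsLagrangian T A W δ K μ ξ η X V) (ht : t ∈ Icc 0 T)
    {ε : ℝ} (hε : 0 < ε) (x : Space) : Integrable (fun z => coulombReg ε (x - X z t)) μ := by
  have := h.prob
  exact integrable_of_continuousOn_supp h.compact h.supp
    ((continuous_coulombReg hε).comp_continuousOn
      (continuousOn_const.sub (h.continuousOn_pos ht)))

theorem norm_field_sub_reg_le (h : IsLagrangian T A W δ K μ ξ η X V) (ht : t ∈ Icc 0 T)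
    {ε : ℝ} (hε : 0 < ε) (x : Space) :
    ‖lagrangianField μ X t x - ∫ z, coulombReg ε (x - X z t) ∂μ‖ ≤
      A * (3 * ballVolume * ε) * (ballVolume * W ^ 3) := by
  have hv := ballVolume_nonneg
  have := h.density_nonneg
  have := h.speed_nonneg
  rw [lagrangianField, ← integral_sub (h.integrable_coulomb ht x) (h.integrable_coulombReg ht hε x)]
  refine norm_integral_le_of_lintegral (by positivity) ?_
  refine le_trans (lintegral_mono fun z => ?_) (lintegral_near_bounded_le h.compact h.supp
    h.density_nonneg h.speed_nonneg (h.cont t ht)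
    (h.map_le t ht) (fun z hz => h.speed_le z hz t ht) x ε)
  rw [← ofReal_norm]
  refine (ENNReal.ofReal_le_ofReal (norm_coulomb_sub_coulombReg_le hε _)).trans (le_of_eq ?_)
  by_cases h2 : ‖x - X z t‖ < ε <;> simp [indicator, h2]

/-- The fields of the truncated kernels are continuous by dominated convergence, and they converge
uniformly since the error is linear in the truncation radius. -/
theorem continuous_field (h : IsLagrangian T A W δ K μ ξ η X V) (ht : t ∈ Icc 0 T) :
    Continuous (lagrangianField μ X t) := by
  have := h.prob
  have hv := ballVolume_nonneg
  have hA := h.density_nonneg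
  have hW := h.speed_nonneg
  refine continuous_of_uniform_approx_of_continuous fun u hu => ?_
  obtain ⟨r, hr, hu⟩ := Metric.mem_uniformity_dist.1 hu
  set D := A * (3 * ballVolume) * (ballVolume * W ^ 3) with hD
  have hD0 : 0 ≤ D := by positivity
  set ε := r / (2 * (D + 1)) with hε
  have hε0 : 0 < ε := by positivity
  refine ⟨fun x => ∫ z, coulombReg ε (x - X z t) ∂μ, ?_, fun x => hu ?_⟩
  · refine continuous_of_dominated (bound := fun _ => (ε ^ 2)⁻¹)
      (fun x => (h.integrable_coulombReg ht hε0 x).aestronglyMeasurable)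
      (fun x => Eventually.of_forall fun z => norm_coulombReg_le hε0 _) (integrable_const _)
      (Eventually.of_forall fun z => (continuous_coulombReg hε0).comp (by fun_prop))
  · rw [dist_eq_norm]
    refine (h.norm_field_sub_reg_le ht hε0 x).trans_lt ?_
    calc A * (3 * ballVolume * ε) * (ballVolume * W ^ 3) = D * ε := by rw [hD]; ring
      _ ≤ (D + 1) * ε := by gcongr; linarith
      _ = r / 2 := by rw [hε]; field_simp
      _ < r := half_lt_self hr

end IsLagrangian

end PlasmaCharge

/-! ### The force field of a solution. -/

namespace PlasmaCharge

open MeasureTheory Set Filter Topology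
open scoped ENNReal NNReal Interval

/-- A closed subset of K is compact, so its image is closed. This gives the continuity of the
backward flow on the support, needed to pull measurability back to the initial time. -/
theorem continuousOn_leftInverse_of_isCompact {α β : Type*} [TopologicalSpace α]
    [TopologicalSpace β] [T2Space β] {K : Set α} (hK : IsCompact K) {f : α → β} {g : β → α}
    (hf : ContinuousOn f K) (hg : ∀ x ∈ K, g (f x) = x) : ContinuousOn g (f '' K) := by
  rw [continuousOn_iff_isClosed]
  intro C hC
  refine ⟨f '' (K ∩ C), ((hK.inter_right hC).image_of_continuousOn
    (hf.mono inter_subset_left)).isClosed, ?_⟩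
  ext y
  constructor
  · rintro ⟨hy, x, hx, rfl⟩
    refine ⟨⟨x, ⟨hx, ?_⟩, rfl⟩, x, hx, rfl⟩
    simpa [hg x hx] using hy
  · rintro ⟨⟨x, hx, rfl⟩, -⟩
    refine ⟨?_, x, hx.1, rfl⟩
    simpa [hg x hx.1] using hx.2

namespace IsSolution

variable {N : ℕ} {T : ℝ} {f₀ : Phase → ℝ} {ξ₀ η₀ : Fin N → Space} {ξ η : Fin N → ℝ → Space}
  {f : ℝ → Phase → ℝ} {Φ : ℝ → ℝ → Phase → Phase} {t : ℝ}

theorem tsupport_subset_freePhase (hS : IsSolution T f₀ ξ₀ η₀ ξ η f Φ) (ht : t ∈ Icc 0 T) :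
    tsupport (f t) ⊆ freePhase ξ t := by
  obtain ⟨δ, hδ, h⟩ := hS.away
  intro z hz α hα
  have := h t ht t ht z hz α
  rw [hS.plasma_initial t ht z hz, hα, sub_self, norm_zero] at this
  exact absurd this (not_le.2 hδ)

theorem tsupport_initial_subset_freePhase (h0 : IsInitialDatum f₀ ξ₀)
    (hS : IsSolution T f₀ ξ₀ η₀ ξ η f Φ) : tsupport f₀ ⊆ freePhase ξ 0 := by
  obtain ⟨δ, hδ, h⟩ := h0.away
  intro z hz α hα
  have := h z hz α
  rw [← (hS.charge_initial α).1, hα, sub_self, norm_zero] at this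
  exact absurd this (not_le.2 hδ)

theorem density_zero (h0 : IsInitialDatum f₀ ξ₀) (hS : IsSolution T f₀ ξ₀ η₀ ξ η f Φ)
    (hT : 0 ≤ T) : f 0 = f₀ := by
  have h00 : (0 : ℝ) ∈ Icc 0 T := ⟨le_rfl, hT⟩
  ext z
  by_cases hz : z ∈ freePhase ξ 0
  · have := hS.transport 0 h00 z hz
    rwa [hS.flow_self 0 h00 z hz] at this
  · rw [image_eq_zero_of_notMem_tsupport fun h => hz (hS.tsupport_subset_freePhase h00 h),
      image_eq_zero_of_notMem_tsupport fun h =>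
        hz (tsupport_initial_subset_freePhase h0 hS h)]

/-- The transport of values along an invertible flow moves the open support; closures are treated
later, once the flow is known to be continuous on the compact support. -/
theorem support_eq (h0 : IsInitialDatum f₀ ξ₀) (hS : IsSolution T f₀ ξ₀ η₀ ξ η f Φ)
    (hT : 0 ≤ T) (ht : t ∈ Icc 0 T) :
    Function.support (f t) = Φ 0 t '' Function.support f₀ := by
  have h00 : (0 : ℝ) ∈ Icc 0 T := ⟨le_rfl, hT⟩
  ext w
  constructor
  · intro hw
    have hfree := hS.tsupport_subset_freePhase ht (subset_tsupport _ hw)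
    have hz := hS.flow_mapsTo t ht 0 h00 hfree
    have hcomp : Φ 0 t (Φ t 0 w) = w := by
      rw [hS.flow_comp t ht 0 h00 t ht w hfree, hS.flow_self t ht w hfree]
    refine ⟨Φ t 0 w, ?_, hcomp⟩
    have := hS.transport t ht _ hz
    rw [hcomp] at this
    rw [Function.mem_support, ← this]
    exact hw
  · rintro ⟨z, hz, rfl⟩
    rw [Function.mem_support, hS.transport t ht z
      (tsupport_initial_subset_freePhase h0 hS (subset_tsupport _ hz))]
    exact hz

theorem ae_density_bounds (hS : IsSolution T f₀ ξ₀ η₀ ξ η f Φ) :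
    ∃ M : ℝ, 0 ≤ M ∧ ∀ᵐ r ∂(volume.restrict (Icc 0 T)),
      AEStronglyMeasurable (spatialDensity (f r)) volume ∧
      (∀ᵐ y, ‖spatialDensity (f r) y‖ ≤ M) ∧
      ∫⁻ y, ‖spatialDensity (f r) y‖ₑ ≤ ENNReal.ofReal M := by
  obtain ⟨M₁, h₁⟩ := hS.plasma_bounded
  obtain ⟨M₂, h₂⟩ := hS.density_bounded
  refine ⟨max M₁ M₂, by positivity, ?_⟩
  filter_upwards [h₁, h₂, hS.plasma_measurable.prodMk_left] with r hr₁ hr₂ hr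
  have hr' : AEStronglyMeasurable (f r) ((volume : Measure Space).prod volume) := hr
  refine ⟨hr'.integral_prod_right', ?_, ?_⟩
  · filter_upwards [enorm_ae_le_eLpNormEssSup (spatialDensity (f r)) volume] with y hy
    rw [← eLpNorm_exponent_top] at hy
    have := hy.trans hr₂
    rw [← ofReal_norm, ← ENNReal.ofReal_coe_nnreal] at this
    exact ((ENNReal.ofReal_le_ofReal_iff M₂.2).1 this).trans (le_max_right _ _)
  · calc ∫⁻ y, ‖spatialDensity (f r) y‖ₑ ≤ ∫⁻ y, ∫⁻ v, ‖f r (y, v)‖ₑ :=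
          lintegral_mono fun y => enorm_integral_le_lintegral_enorm _
      _ = ∫⁻ w, ‖f r w‖ₑ := by
          rw [Measure.volume_eq_prod, lintegral_prod _ hr'.enorm]
      _ ≤ M₁ := by
          rw [eLpNorm_one_eq_lintegral_enorm] at hr₁
          exact hr₁.1
      _ ≤ _ := by
          rw [← ENNReal.ofReal_coe_nnreal]
          exact ENNReal.ofReal_le_ofReal (le_max_left _ _)

theorem aestronglyMeasurable_electricField (hS : IsSolution T f₀ ξ₀ η₀ ξ η f Φ) (x : Space) :
    AEStronglyMeasurable (fun r => electricField (f r) x) (volume.restrict (Icc 0 T)) := by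
  have h1 : AEStronglyMeasurable (fun p : (ℝ × Space) × Space => f p.1.1 (p.1.2, p.2))
      (((volume.restrict (Icc 0 T)).prod (volume : Measure Space)).prod volume) :=
    hS.plasma_measurable.comp_measurePreserving
      (measurePreserving_prodAssoc (volume.restrict (Icc 0 T)) (volume : Measure Space)
        (volume : Measure Space))
  have h2 : AEStronglyMeasurable (fun p : ℝ × Space => spatialDensity (f p.1) p.2)
      ((volume.restrict (Icc 0 T)).prod (volume : Measure Space)) := h1.integral_prod_right'
  have h3 : AEStronglyMeasurable
      (fun p : ℝ × Space => spatialDensity (f p.1) p.2 • coulomb (x - p.2))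
      ((volume.restrict (Icc 0 T)).prod (volume : Measure Space)) :=
    h2.smul (measurable_coulomb.comp (by fun_prop)).aestronglyMeasurable
  exact h3.integral_prod_right'

/-- The force field of a solution, truncated near the charges. -/
noncomputable def regularForce (ξ : Fin N → ℝ → Space) (f : ℝ → Phase → ℝ) (δ : ℝ) (r : ℝ)
    (x : Space) : Space := electricField (f r) x + ∑ α, coulombReg δ (x - ξ α r)

/-- The density part is log-Lipschitz at almost every time, and the charges truncated at δ give a
Lipschitz field. The truncation is not felt by the plasma, which stays at distance at least δ from
the charges for a suitable δ. -/
theorem isLogLipschitzField (hS : IsSolution T f₀ ξ₀ η₀ ξ η f Φ) (hT : 0 ≤ T) {δ : ℝ}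
    (hδ : 0 < δ) : ∃ C, IsLogLipschitzField (regularForce ξ f δ) C 0 T := by
  obtain ⟨M, hM, hae⟩ := hS.ae_density_bounds
  have hv := ballVolume_nonneg
  have hsub : Ι 0 T ⊆ Icc 0 T := by rw [uIoc_of_le hT]; exact Ioc_subset_Icc_self
  have hle := Measure.restrict_mono_set (volume : Measure ℝ) hsub
  have hae := ae_mono hle hae
  set C := 1 + M * (24 * ballVolume + 8) + N * (δ ^ 2)⁻¹ + N * (8 * (δ ^ 3)⁻¹) with hC
  have hp1 : 0 ≤ M * (24 * ballVolume + 8) := by positivity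
  have hp2 : 0 ≤ N * (δ ^ 2)⁻¹ := by positivity
  have hp3 : 0 ≤ N * (8 * (δ ^ 3)⁻¹) := by positivity
  refine ⟨C, by linarith, fun x => ?_, ?_, ?_⟩
  · refine AEStronglyMeasurable.add
      ((hS.aestronglyMeasurable_electricField x).mono_measure hle) ?_
    refine Finset.aestronglyMeasurable_fun_sum _ fun α _ => ?_
    refine AEStronglyMeasurable.mono_measure ?_ hle
    refine ContinuousOn.aestronglyMeasurable ?_ measurableSet_Icc
    exact (continuous_coulombReg hδ).comp_continuousOn
      (continuousOn_const.sub (hS.charge_contDiffOn α).continuousOn)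
  · filter_upwards [hae] with r ⟨_, hb, hi⟩ x
    have h1 := norm_density_field_le hM hb hi x
    have h2 : ‖∑ α, coulombReg δ (x - ξ α r)‖ ≤ N * (δ ^ 2)⁻¹ := by
      refine (norm_sum_le _ _).trans
        ((Finset.sum_le_sum fun α _ => norm_coulombReg_le hδ _).trans ?_)
      simp
    refine (norm_add_le _ _).trans ((add_le_add h1 h2).trans ?_)
    have : 0 ≤ M * ballVolume := by positivity
    rw [hC]; nlinarith
  · filter_upwards [hae] with r ⟨hm, hb, hi⟩ x y l hl
    have h1 := norm_density_field_sub_le hM hm hb hi x y hl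
    have h2 : ‖∑ α, coulombReg δ (x - ξ α r) - ∑ α, coulombReg δ (y - ξ α r)‖ ≤
        N * (8 * (δ ^ 3)⁻¹) * ‖x - y‖ := by
      rw [← Finset.sum_sub_distrib]
      refine (norm_sum_le _ _).trans
        ((Finset.sum_le_sum fun α _ => lipschitz_coulombReg hδ _ _).trans ?_)
      simp [mul_assoc]
    have e : regularForce ξ f δ r x - regularForce ξ f δ r y =
        (electricField (f r) x - electricField (f r) y) +
        (∑ α, coulombReg δ (x - ξ α r) - ∑ α, coulombReg δ (y - ξ α r)) := by
      simp only [regularForce]; abel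
    rw [e]
    refine (norm_add_le _ _).trans ((add_le_add h1 h2).trans ?_)
    have q1 : 0 ≤ ‖x - y‖ := norm_nonneg _
    have q2 : ‖x - y‖ ≤ (1 + l) * ‖x - y‖ + Real.exp (-l) := by
      have := Real.exp_pos (-l); nlinarith [mul_nonneg hl q1]
    have q3 : 0 ≤ (1 + l) * ‖x - y‖ + Real.exp (-l) := q1.trans q2
    have := mul_le_mul_of_nonneg_left q2 hp3
    rw [hC]
    nlinarith [mul_nonneg hp2 q3]

/-- The plasma particles follow the truncated force field. -/
theorem exists_isTrajectory (h0 : IsInitialDatum f₀ ξ₀) (hS : IsSolution T f₀ ξ₀ η₀ ξ η f Φ)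
    (hT : 0 ≤ T) : ∃ δ C W : ℝ, 0 < δ ∧ 0 ≤ W ∧
      IsLogLipschitzField (regularForce ξ f δ) C 0 T ∧
      (∀ z ∈ tsupport f₀, ∀ t ∈ Icc 0 T, ∀ α, δ ≤ ‖(Φ 0 t z).1 - ξ α t‖) ∧
      ∀ z ∈ tsupport f₀, IsTrajectory (regularForce ξ f δ) W 0 T (fun t => (Φ 0 t z).1)
        (fun t => (Φ 0 t z).2) := by
  have h00 : (0 : ℝ) ∈ Icc 0 T := ⟨le_rfl, hT⟩
  obtain ⟨δ, hδ, haway⟩ := hS.away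
  obtain ⟨C, hC⟩ := hS.isLogLipschitzField hT hδ
  have hf0 := density_zero h0 hS hT
  have hvel : ∀ z ∈ tsupport f₀, ∀ r ∈ uIcc 0 T, HasDerivWithinAt (fun t => (Φ 0 t z).2)
      (regularForce ξ f δ r (Φ 0 r z).1) (uIcc 0 T) r := by
    intro z hz r hr
    rw [uIcc_of_le hT] at hr ⊢
    rw [← hf0] at hz
    have := hS.plasma_velocity 0 h00 z hz r hr
    convert this using 1
    simp only [regularForce]
    congr 1
    exact Finset.sum_congr rfl fun α _ => coulombReg_eq (haway 0 h00 r hr z hz α)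
  obtain ⟨B, hB⟩ := h0.hasCompactSupport.isCompact.isBounded.exists_norm_le
  have hB0 : 0 ≤ max B 0 := le_max_right _ _
  have hC0 : 0 ≤ C := zero_le_one.trans hC.one_le
  -- The speed bound is the largest initial speed plus the acceleration bound times T.
  refine ⟨δ, C, max B 0 + C * T, hδ, by positivity, hC, fun z hz t ht α => ?_, fun z hz =>
    ⟨fun r hr => ?_, hvel z hz, fun r hr => ?_⟩⟩
  · rw [← hf0] at hz
    exact haway 0 h00 t ht z hz α
  · rw [uIcc_of_le hT] at hr ⊢
    rw [← hf0] at hz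
    exact hS.plasma_position 0 h00 z hz r hr
  · have hsub := uIcc_subset_uIcc_left hr
    have hCr := hC.mono left_mem_uIcc hr
    obtain ⟨-, hi⟩ := intervalIntegrable_and_integral_eq_sub
      (V := fun t => (Φ 0 t z).2) (C := C) (fun r' hr' => (hvel z hz r' (hsub hr')).mono hsub)
      (by filter_upwards [hCr.bound] with r' hr' using hr' _)
    have hn := norm_intervalIntegral_le_of_ae_restrict (C := C)
      (f := fun r' => regularForce ξ f δ r' (Φ 0 r' z).1) (s := 0) (t := r)
      (by filter_upwards [hCr.bound] with r' hr' using hr' _)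
    rw [uIcc_of_le hT] at hr
    rw [hi, sub_zero, abs_of_nonneg hr.1,
      hS.flow_self 0 h00 z (tsupport_initial_subset_freePhase h0 hS hz)] at hn
    have hz2 : ‖z.2‖ ≤ max B 0 := (norm_snd_le z).trans ((hB z hz).trans (le_max_left _ _))
    have : ‖(Φ 0 r z).2‖ ≤ ‖(Φ 0 r z).2 - z.2‖ + ‖z.2‖ := by
      simpa using norm_add_le ((Φ 0 r z).2 - z.2) z.2
    have : C * r ≤ C * T := by gcongr; exact hr.2
    linarith

end IsSolution

end PlasmaCharge

/-! ### Transport of the initial distribution and the field in Lagrangian form. -/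

namespace PlasmaCharge

open MeasureTheory Set Filter Topology
open scoped ENNReal NNReal Interval

/-- The distribution of the plasma at the initial time. -/
noncomputable def initialMeasure (f₀ : Phase → ℝ) : Measure Phase :=
  volume.withDensity fun z => ENNReal.ofReal (f₀ z)

namespace IsInitialDatum

variable {N : ℕ} {f₀ : Phase → ℝ} {ξ₀ : Fin N → Space}

theorem aemeasurable_ofReal (h0 : IsInitialDatum f₀ ξ₀) :
    AEMeasurable (fun z => ENNReal.ofReal (f₀ z)) volume :=
  h0.integrable.aestronglyMeasurable.aemeasurable.ennreal_ofReal

theorem isProbabilityMeasure (h0 : IsInitialDatum f₀ ξ₀) :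
    IsProbabilityMeasure (initialMeasure f₀) := by
  constructor
  rw [initialMeasure, withDensity_apply _ MeasurableSet.univ, Measure.restrict_univ,
    ← ofReal_integral_eq_lintegral_ofReal h0.integrable (Eventually.of_forall h0.nonneg),
    h0.integral_eq_one, ENNReal.ofReal_one]

theorem initialMeasure_compl (f₀ : Phase → ℝ) : initialMeasure f₀ (tsupport f₀)ᶜ = 0 := by
  rw [initialMeasure, withDensity_apply _ (isClosed_tsupport f₀).measurableSet.compl]
  rw [setLIntegral_congr_fun (g := 0) (isClosed_tsupport f₀).measurableSet.compl]
  · simp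
  · intro z hz
    simp [image_eq_zero_of_notMem_tsupport hz]

theorem ae_le (h0 : IsInitialDatum f₀ ξ₀) : ∀ᵐ z, f₀ z ≤ (eLpNorm f₀ ∞ volume).toReal := by
  filter_upwards [enorm_ae_le_eLpNormEssSup f₀ volume] with z hz
  rw [← eLpNorm_exponent_top] at hz
  have := ENNReal.toReal_mono h0.memLp_top.2.ne hz
  rw [toReal_enorm, Real.norm_of_nonneg (h0.nonneg z)] at this
  exact this

theorem initialMeasure_le (h0 : IsInitialDatum f₀ ξ₀) :
    initialMeasure f₀ ≤
      ENNReal.ofReal (eLpNorm f₀ ∞ volume).toReal • volume.restrict (tsupport f₀) := by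
  have hK := (isClosed_tsupport f₀).measurableSet
  refine Measure.le_iff.2 fun s hs => ?_
  rw [initialMeasure, withDensity_apply _ hs, Measure.smul_apply, smul_eq_mul,
    Measure.restrict_apply hs, inter_comm]
  calc ∫⁻ z in s, ENNReal.ofReal (f₀ z)
      ≤ ∫⁻ z in s, (tsupport f₀).indicator
        (fun _ => ENNReal.ofReal (eLpNorm f₀ ∞ volume).toReal) z := by
        refine lintegral_mono_ae (ae_restrict_of_ae ?_)
        filter_upwards [h0.ae_le] with z hz
        by_cases h : z ∈ tsupport f₀
        · simp only [h, indicator_of_mem]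
          exact ENNReal.ofReal_le_ofReal hz
        · simp [h, image_eq_zero_of_notMem_tsupport h]
    _ = _ := by
        rw [lintegral_indicator hK, setLIntegral_const, Measure.restrict_apply hK]

theorem integral_initialMeasure {E : Type*} [NormedAddCommGroup E] [NormedSpace ℝ E]
    (h0 : IsInitialDatum f₀ ξ₀) (g : Phase → E) :
    ∫ z, g z ∂(initialMeasure f₀) = ∫ z, f₀ z • g z := by
  rw [initialMeasure, integral_withDensity_eq_integral_toReal_smul₀ h0.aemeasurable_ofReal
    (Eventually.of_forall fun z => ENNReal.ofReal_lt_top)]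
  simp_rw [ENNReal.toReal_ofReal (h0.nonneg _)]

theorem integrable_initialMeasure {E : Type*} [NormedAddCommGroup E] [NormedSpace ℝ E]
    (h0 : IsInitialDatum f₀ ξ₀) (g : Phase → E) :
    Integrable g (initialMeasure f₀) ↔ Integrable (fun z => f₀ z • g z) := by
  rw [initialMeasure, integrable_withDensity_iff_integrable_smul₀' h0.aemeasurable_ofReal
    (Eventually.of_forall fun z => ENNReal.ofReal_lt_top)]
  simp_rw [ENNReal.toReal_ofReal (h0.nonneg _)]

end IsInitialDatum

/-- The electric field of a plasma as an integral over phase space. -/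
theorem integral_spatialDensity_smul {E : Type*} [NormedAddCommGroup E] [NormedSpace ℝ E]
    [CompleteSpace E] {g : Phase → ℝ} {k : Space → E}
    (h : Integrable (fun w : Phase => g w • k w.1)) :
    ∫ y, spatialDensity g y • k y = ∫ w : Phase, g w • k w.1 := by
  rw [Measure.volume_eq_prod] at h ⊢
  rw [integral_prod _ h]
  refine integral_congr_ae (Eventually.of_forall fun y => ?_)
  simp only [spatialDensity, integral_smul_const]

namespace IsSolution

variable {N : ℕ} {T : ℝ} {f₀ : Phase → ℝ} {ξ₀ η₀ : Fin N → Space} {ξ η : Fin N → ℝ → Space}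
  {f : ℝ → Phase → ℝ} {Φ : ℝ → ℝ → Phase → Phase} {t : ℝ}

theorem continuousOn_flow (h0 : IsInitialDatum f₀ ξ₀) (hS : IsSolution T f₀ ξ₀ η₀ ξ η f Φ)
    (hT : 0 ≤ T) (ht : t ∈ Icc 0 T) : ContinuousOn (Φ 0 t) (tsupport f₀) ∧
      (volume.restrict (tsupport f₀)).map (Φ 0 t) = volume.restrict (Φ 0 t '' tsupport f₀) := by
  obtain ⟨δ, C, W, -, hW, hF, -, hX⟩ := exists_isTrajectory h0 hS hT
  have ht' : t ∈ uIcc 0 T := by rwa [uIcc_of_le hT]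
  have h00 : (0 : ℝ) ∈ Icc 0 T := ⟨le_rfl, hT⟩
  have hs : ∀ z ∈ tsupport f₀, Φ 0 0 z = z := fun z hz =>
    hS.flow_self 0 h00 z (tsupport_initial_subset_freePhase h0 hS hz)
  have hF' := hF.mono left_mem_uIcc ht'
  have hX' := fun z hz => (hX z hz).mono left_mem_uIcc ht'
  exact ⟨PlasmaCharge.continuousOn_flow hF' hW hX' (continuousOn_id.congr fun z hz => hs z hz),
    map_flow_restrict hF' hW hX' h0.hasCompactSupport.isCompact fun z hz => hs z hz⟩

theorem tsupport_eq (h0 : IsInitialDatum f₀ ξ₀) (hS : IsSolution T f₀ ξ₀ η₀ ξ η f Φ)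
    (hT : 0 ≤ T) (ht : t ∈ Icc 0 T) : tsupport (f t) = Φ 0 t '' tsupport f₀ := by
  have hc := (continuousOn_flow h0 hS hT ht).1
  refine subset_antisymm (closure_minimal ?_
    (h0.hasCompactSupport.isCompact.image_of_continuousOn hc).isClosed) ?_
  · rw [support_eq h0 hS hT ht]
    exact image_mono (subset_tsupport _)
  · rw [tsupport, tsupport, support_eq h0 hS hT ht]
    exact hc.image_closure

/-- The initial distribution is at most ‖f₀‖_∞ times the volume on its support, and the flow carries
that volume to the volume on the image. This upper bound is all the later estimates use of the
transport. -/
theorem map_initialMeasure_le (h0 : IsInitialDatum f₀ ξ₀) (hS : IsSolution T f₀ ξ₀ η₀ ξ η f Φ)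
    (hT : 0 ≤ T) (ht : t ∈ Icc 0 T) : (initialMeasure f₀).map (Φ 0 t) ≤
      ENNReal.ofReal (eLpNorm f₀ ∞ volume).toReal • volume := by
  obtain ⟨hc, hm⟩ := continuousOn_flow h0 hS hT ht
  have hae : AEMeasurable (Φ 0 t) (volume.restrict (tsupport f₀)) :=
    hc.aemeasurable (isClosed_tsupport f₀).measurableSet
  have hle := h0.initialMeasure_le
  have hae' : AEMeasurable (Φ 0 t)
      (ENNReal.ofReal (eLpNorm f₀ ∞ volume).toReal • volume.restrict (tsupport f₀)) :=
    hae.smul_measure _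
  refine Measure.le_iff.2 fun s hs => ?_
  rw [Measure.map_apply_of_aemeasurable (hae'.mono_measure hle) hs]
  refine (hle _).trans ?_
  rw [Measure.smul_apply, Measure.smul_apply, ← Measure.map_apply_of_aemeasurable hae hs, hm]
  exact mul_le_mul' le_rfl (Measure.restrict_apply_le _ _)

/-- A change of variables along the flow, by Liouville's theorem. At an individual time the
measurability of `f t` has to be recovered from f₀ composed with the backward flow on the image of
the support, since joint measurability only yields almost every time. -/
theorem electricField_eq (h0 : IsInitialDatum f₀ ξ₀) (hS : IsSolution T f₀ ξ₀ η₀ ξ η f Φ)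
    (hT : 0 ≤ T) (ht : t ∈ Icc 0 T) (x : Space) :
    electricField (f t) x =
      lagrangianField (initialMeasure f₀) (fun z t => (Φ 0 t z).1) t x := by
  obtain ⟨δ, C, W, -, hW, hF, -, hX⟩ := exists_isTrajectory h0 hS hT
  obtain ⟨hc, hm⟩ := continuousOn_flow h0 hS hT ht
  have h00 : (0 : ℝ) ∈ Icc 0 T := ⟨le_rfl, hT⟩
  have hprob := h0.isProbabilityMeasure
  have hKc := h0.hasCompactSupport.isCompact
  have hK := hKc.measurableSet
  have hIc := hKc.image_of_continuousOn hc
  have hI := hIc.measurableSet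
  have hae : AEMeasurable (Φ 0 t) (volume.restrict (tsupport f₀)) := hc.aemeasurable hK
  have hfree := tsupport_initial_subset_freePhase h0 hS
  have hinv : ∀ z ∈ tsupport f₀, Φ t 0 (Φ 0 t z) = z := fun z hz => by
    rw [hS.flow_comp 0 h00 t ht 0 h00 z (hfree hz), hS.flow_self 0 h00 z (hfree hz)]
  have hci : ContinuousOn (Φ t 0) (Φ 0 t '' tsupport f₀) :=
    continuousOn_leftInverse_of_isCompact hKc hc hinv
  have haei : AEMeasurable (Φ t 0) (volume.restrict (Φ 0 t '' tsupport f₀)) :=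
    hci.aemeasurable hI
  have hmi : (volume.restrict (Φ 0 t '' tsupport f₀)).map (Φ t 0) =
      volume.restrict (tsupport f₀) := by
    rw [← hm] at haei
    rw [← hm, AEMeasurable.map_map_of_aemeasurable haei hae]
    conv_rhs => rw [← Measure.map_id (μ := volume.restrict (tsupport f₀))]
    refine Measure.map_congr ?_
    filter_upwards [ae_restrict_mem hK] with z hz
    exact hinv z hz
  have hfm : AEStronglyMeasurable (f t) (volume.restrict (Φ 0 t '' tsupport f₀)) := by
    have h1 : AEStronglyMeasurable f₀ ((volume.restrict (Φ 0 t '' tsupport f₀)).map (Φ t 0)) := by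
      rw [hmi]
      exact h0.integrable.aestronglyMeasurable.restrict
    refine (h1.comp_aemeasurable haei).congr ?_
    filter_upwards [ae_restrict_mem hI] with w hw
    obtain ⟨z, hz, rfl⟩ := hw
    rw [Function.comp_apply, hinv z hz, hS.transport t ht z (hfree hz)]
  set G : Phase → Space := fun w => f t w • coulomb (x - w.1) with hG
  have hGm : AEStronglyMeasurable G (volume.restrict (Φ 0 t '' tsupport f₀)) :=
    hfm.smul (measurable_coulomb.comp (by fun_prop)).aestronglyMeasurable
  have hG0 : ∀ w, w ∉ Φ 0 t '' tsupport f₀ → G w = 0 := by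
    intro w hw
    rw [← tsupport_eq h0 hS hT ht] at hw
    simp [hG, image_eq_zero_of_notMem_tsupport hw]
  have hGΦ : ∀ z ∈ tsupport f₀, G (Φ 0 t z) = f₀ z • coulomb (x - (Φ 0 t z).1) := by
    intro z hz
    simp only [hG, hS.transport t ht z (hfree hz)]
  have hV : ∀ z ∈ tsupport f₀, ‖(Φ 0 t z).2‖ ≤ W := fun z hz =>
    (hX z hz).le t (by rwa [uIcc_of_le hT])
  have hint : Integrable (fun z => coulomb (x - (Φ 0 t z).1)) (initialMeasure f₀) := by
    refine ⟨?_, ?_⟩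
    · exact (measurable_coulomb.comp_aemeasurable (aemeasurable_of_continuousOn_supp hKc
        (IsInitialDatum.initialMeasure_compl f₀)
        (continuousOn_const.sub (continuous_fst.comp_continuousOn hc)))).aestronglyMeasurable
    · rw [hasFiniteIntegral_iff_enorm]
      simp_rw [← ofReal_norm, norm_coulomb]
      exact (lintegral_inv_sq_le (X := fun z t => (Φ 0 t z).1) (V := fun z t => (Φ 0 t z).2) hKc
        (IsInitialDatum.initialMeasure_compl f₀) ENNReal.toReal_nonneg hW hc
        (map_initialMeasure_le h0 hS hT ht) hV x).trans_lt ENNReal.ofReal_lt_top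
  have hsupp0 : ∀ z, z ∉ tsupport f₀ → f₀ z • coulomb (x - (Φ 0 t z).1) = 0 := fun z hz => by
    simp [image_eq_zero_of_notMem_tsupport hz]
  have hintf := (h0.integrable_initialMeasure _).1 hint
  have hGint : IntegrableOn G (Φ 0 t '' tsupport f₀) := by
    rw [IntegrableOn, ← hm, integrable_map_measure (by rwa [hm]) hae]
    refine hintf.integrableOn.congr ?_
    filter_upwards [ae_restrict_mem hK] with z hz using (hGΦ z hz).symm
  have hGint' : Integrable G := by
    rw [integrableOn_iff_integrable_of_support_subset] at hGint
    · exact hGint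
    · intro w hw
      by_contra h
      exact hw (hG0 w h)
  calc electricField (f t) x = ∫ w, G w := integral_spatialDensity_smul hGint'
    _ = ∫ w in Φ 0 t '' tsupport f₀, G w :=
        (setIntegral_eq_integral_of_forall_compl_eq_zero fun w hw => hG0 w hw).symm
    _ = ∫ z in tsupport f₀, G (Φ 0 t z) := by
        rw [← hm, integral_map hae (by rwa [hm])]
    _ = ∫ z in tsupport f₀, f₀ z • coulomb (x - (Φ 0 t z).1) :=
        setIntegral_congr_fun hK hGΦ
    _ = ∫ z, f₀ z • coulomb (x - (Φ 0 t z).1) :=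
        setIntegral_eq_integral_of_forall_compl_eq_zero hsupp0
    _ = _ := (h0.integral_initialMeasure _).symm

/-- The Lagrangian description of a solution. -/
theorem exists_isLagrangian (h0 : IsInitialDatum f₀ ξ₀) (hS : IsSolution T f₀ ξ₀ η₀ ξ η f Φ)
    (hT : 0 ≤ T) : ∃ W δ, IsLagrangian T (eLpNorm f₀ ∞ volume).toReal W δ (tsupport f₀)
      (initialMeasure f₀) ξ η (fun z t => (Φ 0 t z).1) (fun z t => (Φ 0 t z).2) := by
  obtain ⟨δ, C, W, hδ, hW, hF, haway, hX⟩ := exists_isTrajectory h0 hS hT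
  have h00 : (0 : ℝ) ∈ Icc 0 T := ⟨le_rfl, hT⟩
  refine ⟨W, δ, h0.isProbabilityMeasure, h0.hasCompactSupport.isCompact,
    IsInitialDatum.initialMeasure_compl f₀, ENNReal.toReal_nonneg, hW, hδ,
    fun t ht => (continuousOn_flow h0 hS hT ht).1,
    fun t ht => map_initialMeasure_le h0 hS hT ht, fun z hz t ht => (hX z hz).le t ?_, haway,
    hS.charge_ne, hS.charge_position, fun α t ht => ?_, fun z hz t ht => ?_, fun z hz t ht => ?_⟩
  · rwa [uIcc_of_le hT]
  · rw [← electricField_eq h0 hS hT ht]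
    exact hS.charge_velocity α t ht
  · rw [← density_zero h0 hS hT] at hz
    exact hS.plasma_position 0 h00 z hz t ht
  · rw [← density_zero h0 hS hT] at hz
    rw [← electricField_eq h0 hS hT ht]
    exact hS.plasma_velocity 0 h00 z hz t ht

end IsSolution

end PlasmaCharge

/-! ### Softened potentials and differentiation under the integral. -/

namespace PlasmaCharge

open MeasureTheory Set Filter Topology
open scoped ENNReal NNReal Interval RealInnerProductSpace

/-- The Coulomb potential softened at the scale `ε`. -/
noncomputable def softInv (ε : ℝ) (z : Space) : ℝ := (√(‖z‖ ^ 2 + ε ^ 2))⁻¹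

/-- The force that derives from the potential `softInv ε`. -/
noncomputable def softForce (ε : ℝ) (z : Space) : Space := ((√(‖z‖ ^ 2 + ε ^ 2)) ^ 3)⁻¹ • z

theorem softInv_zero (z : Space) : softInv 0 z = ‖z‖⁻¹ := by
  simp [softInv]

theorem softForce_zero (z : Space) : softForce 0 z = coulomb z := by
  simp [softForce, coulomb]

theorem softForce_neg (ε : ℝ) (z : Space) : softForce ε (-z) = -softForce ε z := by
  simp [softForce]

theorem measurable_softInv (ε : ℝ) : Measurable (softInv ε) := by
  unfold softInv; fun_prop

theorem measurable_softForce (ε : ℝ) : Measurable (softForce ε) := by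
  unfold softForce; fun_prop

theorem hasDerivWithinAt_softInv {ε : ℝ} {Z : ℝ → Space} {Z' : Space} {s : Set ℝ} {t : ℝ}
    (h : HasDerivWithinAt Z Z' s t) (hpos : 0 < ‖Z t‖ ^ 2 + ε ^ 2) :
    HasDerivWithinAt (fun t => softInv ε (Z t)) (-⟪softForce ε (Z t), Z'⟫) s t := by
  have h1 : HasDerivWithinAt (fun t => ‖Z t‖ ^ 2 + ε ^ 2) (2 * ⟪Z t, Z'⟫) s t :=
    h.norm_sq.add_const _
  have h2 := (h1.sqrt hpos.ne').fun_inv (Real.sqrt_pos.2 hpos).ne'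
  refine h2.congr_deriv ?_
  have h3 : 0 < √(‖Z t‖ ^ 2 + ε ^ 2) := Real.sqrt_pos.2 hpos
  rw [softForce, real_inner_smul_left]
  field_simp

theorem softInv_nonneg (ε : ℝ) (z : Space) : 0 ≤ softInv ε z := by
  unfold softInv; positivity

theorem softInv_le {ε : ℝ} (hε : 0 < ε) (z : Space) : softInv ε z ≤ ε⁻¹ := by
  unfold softInv
  gcongr
  exact Real.le_sqrt_of_sq_le (by nlinarith [sq_nonneg ‖z‖])

theorem softInv_le_inv_norm {ε : ℝ} {z : Space} (hz : z ≠ 0) : softInv ε z ≤ ‖z‖⁻¹ := by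
  have : 0 < ‖z‖ := norm_pos_iff.2 hz
  unfold softInv
  gcongr
  exact Real.le_sqrt_of_sq_le (by nlinarith [sq_nonneg ε])

theorem norm_softForce_le {ε : ℝ} (hε : 0 < ε) (z : Space) : ‖softForce ε z‖ ≤ (ε ^ 2)⁻¹ := by
  have h0 : 0 < ‖z‖ ^ 2 + ε ^ 2 := by positivity
  have h1 : ‖z‖ ≤ √(‖z‖ ^ 2 + ε ^ 2) := Real.le_sqrt_of_sq_le (by nlinarith [sq_nonneg ε])
  have h2 : ε ≤ √(‖z‖ ^ 2 + ε ^ 2) := Real.le_sqrt_of_sq_le (by nlinarith [sq_nonneg ‖z‖])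
  set s := √(‖z‖ ^ 2 + ε ^ 2) with hs
  have hs0 : 0 < s := hε.trans_le h2
  rw [softForce, ← hs, norm_smul, norm_inv, norm_pow, Real.norm_of_nonneg hs0.le]
  calc (s ^ 3)⁻¹ * ‖z‖ ≤ (s ^ 3)⁻¹ * s := by gcongr
    _ = (s ^ 2)⁻¹ := by field_simp
    _ ≤ _ := by gcongr

/-- The softened force is parallel to the Coulomb force and weaker, which settles the ball of radius
δ. Outside, with s = √(r² + ε²), the bound (s - r) r ≤ ε² gives an error of order ε²/δ⁴. -/
theorem norm_coulomb_sub_softForce_le {ε δ : ℝ} (hε : 0 < ε) (hδ : 0 < δ) (z : Space) :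
    ‖coulomb z - softForce ε z‖ ≤
      (Iio δ).indicator (fun r => (r ^ 2)⁻¹) ‖z‖ + 3 * ε ^ 2 * (δ ^ 4)⁻¹ := by
  rcases eq_or_ne z 0 with rfl | hz
  · simp only [coulomb, softForce, smul_zero, sub_self, norm_zero]
    exact add_nonneg (indicator_nonneg (fun r _ => by positivity) _) (by positivity)
  have hr0 : 0 < ‖z‖ := norm_pos_iff.2 hz
  have h1 : ‖z‖ ≤ √(‖z‖ ^ 2 + ε ^ 2) := Real.le_sqrt_of_sq_le (by nlinarith [sq_nonneg ε])
  have hsq : √(‖z‖ ^ 2 + ε ^ 2) ^ 2 = ‖z‖ ^ 2 + ε ^ 2 := Real.sq_sqrt (by positivity)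
  have e : ‖coulomb z - softForce ε z‖ = ((‖z‖ ^ 3)⁻¹ - ((√(‖z‖ ^ 2 + ε ^ 2)) ^ 3)⁻¹) * ‖z‖ := by
    rw [coulomb, softForce, ← sub_smul, norm_smul, Real.norm_of_nonneg]
    rw [sub_nonneg]
    gcongr
  rw [e]
  set r := ‖z‖ with hr
  set s := √(r ^ 2 + ε ^ 2) with hs
  have hs0 : 0 < s := hr0.trans_le h1
  by_cases hlt : r < δ
  · simp only [indicator, mem_Iio, hlt, if_true]
    have h2 : ((r ^ 3)⁻¹ - (s ^ 3)⁻¹) * r ≤ (r ^ 2)⁻¹ := by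
      have : 0 ≤ (s ^ 3)⁻¹ * r := by positivity
      have h3 : (r ^ 3)⁻¹ * r = (r ^ 2)⁻¹ := by field_simp
      rw [sub_mul, h3]; linarith
    have : 0 ≤ 3 * ε ^ 2 * (δ ^ 4)⁻¹ := by positivity
    linarith
  · have hge := not_lt.1 hlt
    simp only [indicator, mem_Iio, hlt, if_false, zero_add]
    have h2 : (s - r) * r ≤ ε ^ 2 := by nlinarith
    have h3 : ((r ^ 3)⁻¹ - (s ^ 3)⁻¹) * r = ((s - r) * r) * ((s ^ 2 + s * r + r ^ 2) / s ^ 2) *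
        (s⁻¹ * (r ^ 3)⁻¹) := by field_simp; ring
    have h4 : (s ^ 2 + s * r + r ^ 2) / s ^ 2 ≤ 3 := by
      rw [div_le_iff₀ (by positivity)]; nlinarith
    have h5 : s⁻¹ * (r ^ 3)⁻¹ ≤ (δ ^ 4)⁻¹ := by
      rw [← mul_inv]
      gcongr
      calc δ ^ 4 = δ * δ ^ 3 := by ring
        _ ≤ s * r ^ 3 := by gcongr; exact hge.trans h1
    have h6 : 0 ≤ (s - r) * r := mul_nonneg (by linarith) hr0.le
    rw [h3]
    calc ((s - r) * r) * ((s ^ 2 + s * r + r ^ 2) / s ^ 2) * (s⁻¹ * (r ^ 3)⁻¹)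
        ≤ ε ^ 2 * 3 * (δ ^ 4)⁻¹ := by gcongr
      _ = _ := by ring

/-- Differentiation of the integral of a family of functions with bounded derivatives. -/
theorem hasDerivAt_integral_of_bounded {α : Type*} [MeasurableSpace α] {ν : Measure α}
    [IsFiniteMeasure ν] {S : Set α} (hS : ∀ᵐ a ∂ν, a ∈ S) {g g' : α → ℝ → ℝ} {T B : ℝ}
    (hd : ∀ a ∈ S, ∀ t ∈ Icc 0 T, HasDerivWithinAt (g a) (g' a t) (Icc 0 T) t)
    (hB : ∀ a ∈ S, ∀ t ∈ Icc 0 T, |g a t| ≤ B) (hB' : ∀ a ∈ S, ∀ t ∈ Icc 0 T, |g' a t| ≤ B)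
    (hm : ∀ t ∈ Icc 0 T, AEStronglyMeasurable (fun a => g a t) ν)
    (hm' : ∀ t ∈ Icc 0 T, AEStronglyMeasurable (fun a => g' a t) ν) :
    ContinuousOn (fun t => ∫ a, g a t ∂ν) (Icc 0 T) ∧
      ∀ t ∈ Ioo 0 T, HasDerivAt (fun t => ∫ a, g a t ∂ν) (∫ a, g' a t ∂ν) t := by
  constructor
  · refine continuousOn_of_dominated (bound := fun _ => B) hm (fun t ht => ?_) (integrable_const _) ?_
    · filter_upwards [hS] with a ha using hB a ha t ht
    · filter_upwards [hS] with a ha t ht using (hd a ha t ht).continuousWithinAt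
  · intro t ht
    have hsub : Ioo 0 T ⊆ Icc 0 T := Ioo_subset_Icc_self
    refine (hasDerivAt_integral_of_dominated_loc_of_deriv_le (bound := fun _ => B)
      (F := fun t a => g a t) (F' := fun t a => g' a t)
      (Ioo_mem_nhds ht.1 ht.2) ?_ ?_ (hm' t (hsub ht)) ?_ (integrable_const _) ?_).2
    · filter_upwards [Ioo_mem_nhds ht.1 ht.2] with s hs using hm s (hsub hs)
    · exact Integrable.of_bound (hm t (hsub ht)) B
        (by filter_upwards [hS] with a ha using hB a ha t (hsub ht))
    · filter_upwards [hS] with a ha s hs using hB' a ha s (hsub hs)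
    · filter_upwards [hS] with a ha s hs
      exact (hd a ha s (hsub hs)).hasDerivAt (Icc_mem_nhds hs.1 hs.2)

end PlasmaCharge

/-! ### Time derivatives of the terms of the energy. -/

namespace PlasmaCharge

open MeasureTheory Set Filter Topology
open scoped ENNReal NNReal Interval RealInnerProductSpace

/-- The energy of a plasma interacting with charges, without the self-interaction of the plasma. -/
noncomputable def externalEnergy {N : ℕ} (μ : Measure Phase) (ξ η : Fin N → ℝ → Space)
    (X V : Phase → ℝ → Space) (t : ℝ) : ℝ :=
  (1 / 2) * (∫ z, ‖V z t‖ ^ 2 ∂μ) + (1 / 2) * (∑ α, ‖η α t‖ ^ 2)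
    + (∑ α, ∫ z, softInv 0 (X z t - ξ α t) ∂μ)
    + (1 / 2) * (∑ α, ∑ β, softInv 0 (ξ α t - ξ β t))

theorem continuousAt_coulomb {z : Space} (hz : z ≠ 0) : ContinuousAt coulomb z := by
  unfold coulomb
  have : ‖z‖ ^ 3 ≠ 0 := pow_ne_zero _ (norm_ne_zero_iff.2 hz)
  exact ContinuousAt.smul (ContinuousAt.inv₀ (f := fun z : Space => ‖z‖ ^ 3) (by fun_prop) this)
    continuousAt_id

namespace IsLagrangian

variable {K : Set Phase} {μ : Measure Phase} {X V : Phase → ℝ → Space} {A W t P R : ℝ}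
variable {N : ℕ} {T δ : ℝ} {ξ η : Fin N → ℝ → Space}

theorem sub_ne_zero (h : IsLagrangian T A W δ K μ ξ η X V) {z : Phase} (hz : z ∈ K)
    (ht : t ∈ Icc 0 T) (α : Fin N) : X z t - ξ α t ≠ 0 := by
  have := h.away z hz t ht α
  rw [← norm_pos_iff]
  exact h.dist_pos.trans_le this

theorem continuousOn_charge_force (h : IsLagrangian T A W δ K μ ξ η X V) (ht : t ∈ Icc 0 T)
    (α : Fin N) : ContinuousOn (fun z => coulomb (X z t - ξ α t)) K := fun z hz =>
  (continuousAt_coulomb (h.sub_ne_zero hz ht α)).comp_continuousWithinAt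
    (f := fun z => X z t - ξ α t)
    ((h.continuousOn_pos ht z hz).sub continuousWithinAt_const)

theorem norm_charge_force_le (h : IsLagrangian T A W δ K μ ξ η X V) {z : Phase} (hz : z ∈ K)
    (ht : t ∈ Icc 0 T) (α : Fin N) : ‖coulomb (X z t - ξ α t)‖ ≤ (δ ^ 2)⁻¹ := by
  have := h.away z hz t ht α
  have := h.dist_pos
  rw [norm_coulomb]
  gcongr

theorem exists_charge_speed_le (h : IsLagrangian T A W δ K μ ξ η X V) :
    ∃ b, 0 ≤ b ∧ ∀ α, ∀ t ∈ Icc 0 T, ‖η α t‖ ≤ b := by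
  have : ∀ α, ∃ b, ∀ t ∈ Icc 0 T, ‖η α t‖ ≤ b := fun α =>
    isCompact_Icc.exists_bound_of_continuousOn
      fun t ht => (h.charge_vel α t ht).continuousWithinAt
  choose b hb using this
  refine ⟨∑ α, |b α|, by positivity, fun α t ht => (hb α t ht).trans ((le_abs_self _).trans ?_)⟩
  exact Finset.single_le_sum (f := fun α => |b α|) (fun _ _ => abs_nonneg _) (Finset.mem_univ α)

theorem hasDerivAt_kinetic (h : IsLagrangian T A W δ K μ ξ η X V) :
    ContinuousOn (fun t => ∫ z, ‖V z t‖ ^ 2 ∂μ) (Icc 0 T) ∧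
      ∀ t ∈ Ioo 0 T, HasDerivAt (fun t => ∫ z, ‖V z t‖ ^ 2 ∂μ)
        (∫ z, 2 * ⟪V z t, lagrangianField μ X t (X z t) + ∑ α, coulomb (X z t - ξ α t)⟫ ∂μ) t := by
  have := h.prob
  have hv := ballVolume_nonneg
  have hA := h.density_nonneg
  have hW := h.speed_nonneg
  have hδ := h.dist_pos
  set a := A * (3 * ballVolume) * (ballVolume * W ^ 3) + 1 + N * (δ ^ 2)⁻¹ with ha
  have ha0 : 0 ≤ a := by positivity
  refine hasDerivAt_integral_of_bounded (B := W ^ 2 + 2 * (W * a)) h.ae_mem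
    (fun z hz t ht => (h.vel z hz t ht).norm_sq) (fun z hz t ht => ?_) (fun z hz t ht => ?_)
    (fun t ht => ?_) (fun t ht => ?_)
  · have := h.speed_le z hz t ht
    rw [abs_of_nonneg (by positivity)]
    have : ‖V z t‖ ^ 2 ≤ W ^ 2 := by gcongr
    have : 0 ≤ 2 * (W * a) := by positivity
    linarith
  · have h1 := h.speed_le z hz t ht
    have h2 : ‖lagrangianField μ X t (X z t) + ∑ α, coulomb (X z t - ξ α t)‖ ≤ a := by
      refine (norm_add_le _ _).trans (add_le_add (h.norm_field_le ht _) ?_)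
      refine (norm_sum_le _ _).trans
        ((Finset.sum_le_sum fun α _ => h.norm_charge_force_le hz ht α).trans ?_)
      simp
    have h3 := abs_real_inner_le_norm (V z t)
      (lagrangianField μ X t (X z t) + ∑ α, coulomb (X z t - ξ α t))
    have h4 := mul_le_mul h1 h2 (norm_nonneg _) hW
    rw [abs_mul, abs_two]
    nlinarith [sq_nonneg W]
  · exact (aestronglyMeasurable_of_continuousOn_supp h.compact h.supp
      ((h.continuousOn_vel ht).norm.pow 2))
  · refine (aestronglyMeasurable_of_continuousOn_supp h.compact h.supp
      (continuousOn_const.mul ((h.continuousOn_vel ht).inner ?_)))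
    exact ((h.continuous_field ht).comp_continuousOn (h.continuousOn_pos ht)).add
      (continuousOn_finsetSum _ fun α _ => h.continuousOn_charge_force ht α)

theorem hasDerivAt_chargePotential (h : IsLagrangian T A W δ K μ ξ η X V) (α : Fin N) :
    ContinuousOn (fun t => ∫ z, softInv 0 (X z t - ξ α t) ∂μ) (Icc 0 T) ∧
      ∀ t ∈ Ioo 0 T, HasDerivAt (fun t => ∫ z, softInv 0 (X z t - ξ α t) ∂μ)
        (∫ z, -⟪coulomb (X z t - ξ α t), V z t - η α t⟫ ∂μ) t := by
  have := h.prob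
  have hW := h.speed_nonneg
  have hδ := h.dist_pos
  obtain ⟨b, hb0, hb⟩ := h.exists_charge_speed_le
  refine hasDerivAt_integral_of_bounded (B := δ⁻¹ + (δ ^ 2)⁻¹ * (W + b)) h.ae_mem
    (fun z hz t ht => ?_) (fun z hz t ht => ?_) (fun z hz t ht => ?_)
    (fun t ht => ?_) (fun t ht => ?_)
  · have := hasDerivWithinAt_softInv (ε := 0) (Z := fun t => X z t - ξ α t)
      ((h.pos z hz t ht).sub (h.charge_pos α t ht)) (by
        have := norm_pos_iff.2 (h.sub_ne_zero hz ht α)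
        positivity)
    simpa only [softForce_zero] using this
  · rw [abs_of_nonneg (softInv_nonneg _ _), softInv_zero]
    have h1 : ‖X z t - ξ α t‖⁻¹ ≤ δ⁻¹ := by
      gcongr
      exact h.away z hz t ht α
    have : 0 ≤ (δ ^ 2)⁻¹ * (W + b) := by positivity
    linarith
  · rw [abs_neg]
    have h1 := abs_real_inner_le_norm (coulomb (X z t - ξ α t)) (V z t - η α t)
    have h2 := h.norm_charge_force_le hz ht α
    have h3 : ‖V z t - η α t‖ ≤ W + b :=
      (norm_sub_le _ _).trans (add_le_add (h.speed_le z hz t ht) (hb α t ht))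
    have h4 := mul_le_mul h2 h3 (norm_nonneg _) (by positivity)
    have : 0 ≤ δ⁻¹ := by positivity
    linarith
  · exact ((measurable_softInv 0).comp_aemeasurable
      ((h.aemeasurable_pos ht).sub_const _)).aestronglyMeasurable
  · exact (aestronglyMeasurable_of_continuousOn_supp h.compact h.supp
      ((h.continuousOn_charge_force ht α).inner
        ((h.continuousOn_vel ht).sub continuousOn_const)).neg)

/-- Two plasma particles may be arbitrarily close, so the derivative of their Coulomb potential has
no uniform bound. The softening supplies one; the interaction with charges needs none because of the
distance δ. -/
theorem hasDerivAt_selfPotential (h : IsLagrangian T A W δ K μ ξ η X V) {ε : ℝ} (hε : 0 < ε) :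
    ContinuousOn (fun t => ∫ p : Phase × Phase, softInv ε (X p.1 t - X p.2 t) ∂(μ.prod μ))
        (Icc 0 T) ∧
      ∀ t ∈ Ioo 0 T, HasDerivAt
        (fun t => ∫ p : Phase × Phase, softInv ε (X p.1 t - X p.2 t) ∂(μ.prod μ))
        (∫ p : Phase × Phase, -⟪softForce ε (X p.1 t - X p.2 t), V p.1 t - V p.2 t⟫ ∂(μ.prod μ))
        t := by
  have := h.prob
  have hW := h.speed_nonneg
  have hS : ∀ᵐ p ∂(μ.prod μ), p ∈ K ×ˢ K := by
    have h1 : ∀ᵐ p ∂(μ.prod μ), p.1 ∈ K :=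
      Measure.quasiMeasurePreserving_fst.ae h.ae_mem
    have h2 : ∀ᵐ p ∂(μ.prod μ), p.2 ∈ K :=
      Measure.quasiMeasurePreserving_snd.ae h.ae_mem
    filter_upwards [h1, h2] with p hp1 hp2 using ⟨hp1, hp2⟩
  have hmX : ∀ t ∈ Icc 0 T, AEMeasurable (fun p : Phase × Phase => X p.1 t - X p.2 t)
      (μ.prod μ) := fun t ht =>
    ((h.aemeasurable_pos ht).comp_quasiMeasurePreserving Measure.quasiMeasurePreserving_fst).sub
      ((h.aemeasurable_pos ht).comp_quasiMeasurePreserving Measure.quasiMeasurePreserving_snd)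
  have hmV : ∀ t ∈ Icc 0 T, AEMeasurable (fun p : Phase × Phase => V p.1 t - V p.2 t)
      (μ.prod μ) := fun t ht =>
    ((h.aemeasurable_vel ht).comp_quasiMeasurePreserving Measure.quasiMeasurePreserving_fst).sub
      ((h.aemeasurable_vel ht).comp_quasiMeasurePreserving Measure.quasiMeasurePreserving_snd)
  refine hasDerivAt_integral_of_bounded (B := ε⁻¹ + (ε ^ 2)⁻¹ * (W + W)) hS
    (g := fun p t => softInv ε (X p.1 t - X p.2 t))
    (fun p hp t ht => hasDerivWithinAt_softInv ((h.pos p.1 hp.1 t ht).sub (h.pos p.2 hp.2 t ht))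
      (by positivity))
    (fun p hp t ht => ?_) (fun p hp t ht => ?_)
    (fun t ht => ?_) (fun t ht => ?_)
  · rw [abs_of_nonneg (softInv_nonneg _ _)]
    have h1 := softInv_le hε (X p.1 t - X p.2 t)
    have : 0 ≤ (ε ^ 2)⁻¹ * (W + W) := by positivity
    linarith
  · rw [abs_neg]
    have h1 := abs_real_inner_le_norm (softForce ε (X p.1 t - X p.2 t)) (V p.1 t - V p.2 t)
    have h2 := norm_softForce_le hε (X p.1 t - X p.2 t)
    have h3 : ‖V p.1 t - V p.2 t‖ ≤ W + W :=
      (norm_sub_le _ _).trans (add_le_add (h.speed_le _ hp.1 t ht) (h.speed_le _ hp.2 t ht))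
    have h4 := mul_le_mul h2 h3 (norm_nonneg _) (by positivity)
    have : 0 ≤ ε⁻¹ := by positivity
    linarith
  · exact ((measurable_softInv ε).comp_aemeasurable (hmX t ht)).aestronglyMeasurable
  · exact ((((measurable_softForce ε).comp_aemeasurable (hmX t ht)).inner
      (hmV t ht)).neg).aestronglyMeasurable

end IsLagrangian

end PlasmaCharge

/-! ### Cancellations in the derivative of the energy. -/

namespace PlasmaCharge

open MeasureTheory Set Filter Topology
open scoped ENNReal NNReal Interval RealInnerProductSpace

theorem sum_erase_coulomb {N : ℕ} (p : Fin N → Space) (α : Fin N) :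
    ∑ β ∈ Finset.univ.erase α, coulomb (p α - p β) = ∑ β, coulomb (p α - p β) :=
  Finset.sum_erase _ (by simp [coulomb])

/-- Exchanging the two indices and using that the kernel is odd, each pair appears twice: the power
of the mutual forces is minus the derivative of the mutual potential energy. -/
theorem sum_sum_inner_coulomb {N : ℕ} (p w : Fin N → Space) :
    (1 / 2) * ∑ α, ∑ β, ⟪coulomb (p α - p β), w α - w β⟫ =
      ∑ α, ⟪w α, ∑ β, coulomb (p α - p β)⟫ := by
  have h1 : ∑ α, ∑ β, ⟪coulomb (p α - p β), w β⟫ = -∑ α, ∑ β, ⟪coulomb (p α - p β), w α⟫ := by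
    rw [Finset.sum_comm, ← Finset.sum_neg_distrib]
    refine Finset.sum_congr rfl fun α _ => ?_
    rw [← Finset.sum_neg_distrib]
    refine Finset.sum_congr rfl fun β _ => ?_
    rw [← neg_sub (p α), coulomb_neg, inner_neg_left]
  simp_rw [inner_sub_right, Finset.sum_sub_distrib, h1, inner_sum, real_inner_comm (w _)]
  ring

namespace IsLagrangian

variable {K : Set Phase} {μ : Measure Phase} {X V : Phase → ℝ → Space} {A W t P R : ℝ}
variable {N : ℕ} {T δ : ℝ} {ξ η : Fin N → ℝ → Space}

theorem integrable_of_continuousOn (h : IsLagrangian T A W δ K μ ξ η X V) {E : Type*}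
    [NormedAddCommGroup E] {Z : Phase → E} (hZ : ContinuousOn Z K) : Integrable Z μ := by
  have := h.prob
  exact integrable_of_continuousOn_supp h.compact h.supp hZ

theorem integral_charge_force (μ : Measure Phase) (X : Phase → ℝ → Space) (t : ℝ) (x : Space) :
    ∫ z, coulomb (X z t - x) ∂μ = -lagrangianField μ X t x := by
  rw [lagrangianField, ← integral_neg]
  simp_rw [← coulomb_neg, neg_sub]

theorem continuous_softForce {ε : ℝ} (hε : 0 < ε) : Continuous (softForce ε) := by
  unfold softForce
  refine Continuous.smul (Continuous.inv₀ (f := fun z : Space => √(‖z‖ ^ 2 + ε ^ 2) ^ 3)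
    (by fun_prop) fun z => ?_) continuous_id
  positivity

theorem integrable_softForce_sub (h : IsLagrangian T A W δ K μ ξ η X V) (ht : t ∈ Icc 0 T) {ε : ℝ}
    (hε : 0 < ε) (x : Space) : Integrable (fun z => softForce ε (x - X z t)) μ :=
  h.integrable_of_continuousOn ((continuous_softForce hε).comp_continuousOn
    (continuousOn_const.sub (h.continuousOn_pos ht)))

/-- The continuous analogue of the identity for the charges: the exchange of the two labels and the
oddness of the softened force. -/
theorem integral_self_force (h : IsLagrangian T A W δ K μ ξ η X V) (ht : t ∈ Icc 0 T) {ε : ℝ}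
    (hε : 0 < ε) :
    ∫ p : Phase × Phase, ⟪softForce ε (X p.1 t - X p.2 t), V p.1 t - V p.2 t⟫ ∂(μ.prod μ) =
      2 * ∫ z, ⟪V z t, ∫ z', softForce ε (X z t - X z' t) ∂μ⟫ ∂μ := by
  have := h.prob
  have hW := h.speed_nonneg
  have hmX : AEMeasurable (fun p : Phase × Phase => X p.1 t - X p.2 t) (μ.prod μ) :=
    ((h.aemeasurable_pos ht).comp_quasiMeasurePreserving Measure.quasiMeasurePreserving_fst).sub
      ((h.aemeasurable_pos ht).comp_quasiMeasurePreserving Measure.quasiMeasurePreserving_snd)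
  have hmV : AEMeasurable (fun p : Phase × Phase => V p.1 t) (μ.prod μ) :=
    (h.aemeasurable_vel ht).comp_quasiMeasurePreserving Measure.quasiMeasurePreserving_fst
  have hi1 : Integrable (fun p : Phase × Phase => ⟪softForce ε (X p.1 t - X p.2 t), V p.1 t⟫)
      (μ.prod μ) := by
    refine Integrable.of_bound (((measurable_softForce ε).comp_aemeasurable hmX).inner
      hmV).aestronglyMeasurable ((ε ^ 2)⁻¹ * W) ?_
    filter_upwards [Measure.quasiMeasurePreserving_fst.ae h.ae_mem] with p hp
    exact (abs_real_inner_le_norm _ _).trans (mul_le_mul (norm_softForce_le hε _)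
      (h.speed_le _ hp t ht) (norm_nonneg _) (by positivity))
  have hneg : ∀ p : Phase × Phase, ⟪softForce ε (X p.1 t - X p.2 t), V p.2 t⟫ =
      -(fun q : Phase × Phase => ⟪softForce ε (X q.1 t - X q.2 t), V q.1 t⟫) p.swap := by
    intro p
    simp only [Prod.fst_swap, Prod.snd_swap]
    rw [← neg_sub (X p.1 t), softForce_neg, inner_neg_left, neg_neg]
  have hi2 : Integrable (fun p : Phase × Phase => ⟪softForce ε (X p.1 t - X p.2 t), V p.2 t⟫)
      (μ.prod μ) := by
    simp_rw [hneg]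
    exact hi1.swap.neg
  simp_rw [inner_sub_right]
  rw [integral_sub hi1 hi2]
  simp_rw [hneg]
  rw [integral_neg, integral_prod_swap (μ := μ) (ν := μ)
    (fun q : Phase × Phase => ⟪softForce ε (X q.1 t - X q.2 t), V q.1 t⟫), integral_prod _ hi1]
  have : ∀ z, ∫ z', ⟪softForce ε (X z t - X z' t), V z t⟫ ∂μ =
      ⟪V z t, ∫ z', softForce ε (X z t - X z' t) ∂μ⟫ := by
    intro z
    rw [← integral_inner (h.integrable_softForce_sub ht hε _)]
    simp_rw [real_inner_comm]
  simp_rw [this]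
  ring

theorem norm_field_sub_soft_le (h : IsLagrangian T A W δ K μ ξ η X V) (ht : t ∈ Icc 0 T)
    {ε r : ℝ} (hε : 0 < ε) (hr : 0 < r) (x : Space) :
    ‖lagrangianField μ X t x - ∫ z, softForce ε (x - X z t) ∂μ‖ ≤
      A * (3 * ballVolume * r) * (ballVolume * W ^ 3) + 3 * ε ^ 2 * (r ^ 4)⁻¹ := by
  have hv := ballVolume_nonneg
  have := h.density_nonneg
  have := h.speed_nonneg
  have := h.prob
  rw [lagrangianField, ← integral_sub (h.integrable_coulomb ht x)
    (h.integrable_softForce_sub ht hε x)]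
  refine norm_integral_le_of_lintegral (by positivity) ?_
  rw [ENNReal.ofReal_add (by positivity) (by positivity)]
  calc ∫⁻ z, ‖coulomb (x - X z t) - softForce ε (x - X z t)‖ₑ ∂μ
      ≤ ∫⁻ z, ({z | ‖x - X z t‖ < r}.indicator
        (fun z => ENNReal.ofReal ((‖x - X z t‖ ^ 2)⁻¹)) z +
          ENNReal.ofReal (3 * ε ^ 2 * (r ^ 4)⁻¹)) ∂μ := by
        refine lintegral_mono fun z => ?_
        rw [← ofReal_norm]
        refine (ENNReal.ofReal_le_ofReal (norm_coulomb_sub_softForce_le hε hr _)).trans ?_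
        refine ENNReal.ofReal_add_le.trans (add_le_add (le_of_eq ?_) le_rfl)
        by_cases h2 : ‖x - X z t‖ < r <;> simp [indicator, h2]
    _ ≤ _ := by
        rw [lintegral_add_right _ measurable_const]
        refine add_le_add (lintegral_near_bounded_le h.compact h.supp
          h.density_nonneg h.speed_nonneg (h.cont t ht)
          (h.map_le t ht) (fun z hz => h.speed_le z hz t ht) x r) (by simp)

/-- The energy identity for the softened self-interaction. -/
theorem energy_deriv_eq (h : IsLagrangian T A W δ K μ ξ η X V) (ht : t ∈ Icc 0 T) {ε : ℝ}
    (hε : 0 < ε) :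
    (1 / 2) * (∫ z, 2 * ⟪V z t, lagrangianField μ X t (X z t) +
        ∑ α, coulomb (X z t - ξ α t)⟫ ∂μ) +
      (1 / 2) * (∑ α, 2 * ⟪η α t, lagrangianField μ X t (ξ α t) +
        ∑ β ∈ Finset.univ.erase α, coulomb (ξ α t - ξ β t)⟫) +
      (∑ α, ∫ z, -⟪coulomb (X z t - ξ α t), V z t - η α t⟫ ∂μ) +
      (1 / 2) * (∑ α, ∑ β, -⟪coulomb (ξ α t - ξ β t), η α t - η β t⟫) +
      (1 / 2) * (∫ p : Phase × Phase,
        -⟪softForce ε (X p.1 t - X p.2 t), V p.1 t - V p.2 t⟫ ∂(μ.prod μ)) =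
    ∫ z, ⟪V z t, lagrangianField μ X t (X z t) - ∫ z', softForce ε (X z t - X z' t) ∂μ⟫ ∂μ := by
  have hcf : ∀ α, ContinuousOn (fun z => coulomb (X z t - ξ α t)) K := fun α =>
    h.continuousOn_charge_force ht α
  have hV := h.continuousOn_vel ht
  have hE : ContinuousOn (fun z => lagrangianField μ X t (X z t)) K :=
    (h.continuous_field ht).comp_continuousOn (h.continuousOn_pos ht)
  have hiE : Integrable (fun z => ⟪V z t, lagrangianField μ X t (X z t)⟫) μ :=
    h.integrable_of_continuousOn (hV.inner hE)
  have hiC : ∀ α, Integrable (fun z => ⟪V z t, coulomb (X z t - ξ α t)⟫) μ := fun α =>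
    h.integrable_of_continuousOn (hV.inner (hcf α))
  have hiη : ∀ α, Integrable (fun z => ⟪η α t, coulomb (X z t - ξ α t)⟫) μ := fun α =>
    h.integrable_of_continuousOn (continuousOn_const.inner (hcf α))
  have hprob := h.prob
  have hS : Integrable (fun z => ⟪V z t, ∫ z', softForce ε (X z t - X z' t) ∂μ⟫) μ := by
    have hc : Continuous fun x => ∫ z', softForce ε (x - X z' t) ∂μ :=
      continuous_of_dominated (bound := fun _ => (ε ^ 2)⁻¹)
        (fun x => (h.integrable_softForce_sub ht hε x).aestronglyMeasurable)
        (fun x => Eventually.of_forall fun z => norm_softForce_le hε _) (integrable_const _)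
        (Eventually.of_forall fun z => (continuous_softForce hε).comp (by fun_prop))
    exact h.integrable_of_continuousOn (hV.inner (hc.comp_continuousOn (h.continuousOn_pos ht)))
  have e1 : ∫ z, 2 * ⟪V z t, lagrangianField μ X t (X z t) + ∑ α, coulomb (X z t - ξ α t)⟫ ∂μ =
      2 * (∫ z, ⟪V z t, lagrangianField μ X t (X z t)⟫ ∂μ +
        ∑ α, ∫ z, ⟪V z t, coulomb (X z t - ξ α t)⟫ ∂μ) := by
    rw [integral_const_mul]
    congr 1
    simp_rw [inner_add_right, inner_sum]
    rw [integral_add hiE (integrable_finsetSum _ fun α _ => hiC α),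
      integral_finsetSum _ fun α _ => hiC α]
  have e2 : ∀ α, ∫ z, -⟪coulomb (X z t - ξ α t), V z t - η α t⟫ ∂μ =
      -(∫ z, ⟪V z t, coulomb (X z t - ξ α t)⟫ ∂μ) - ⟪η α t, lagrangianField μ X t (ξ α t)⟫ := by
    intro α
    simp_rw [inner_sub_right, real_inner_comm (V _ t), real_inner_comm (η α t)]
    rw [integral_neg, integral_sub (hiC α) (hiη α), integral_inner
      (h.integrable_of_continuousOn (hcf α)), integral_charge_force, inner_neg_right]
    ring
  have e3 := sum_sum_inner_coulomb (fun α => ξ α t) (fun α => η α t)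
  -- The powers exchanged between plasma and charges and among the charges cancel. What survives is
  -- the work of the difference between the true self-field and the softened one.
  simp_rw [sum_erase_coulomb (fun α => ξ α t), e2, Finset.sum_neg_distrib, integral_neg,
    h.integral_self_force ht hε, inner_sub_right (V _ t), e1, inner_add_right,
    Finset.sum_sub_distrib, Finset.sum_neg_distrib, ← Finset.mul_sum, Finset.sum_add_distrib]
  rw [integral_sub hiE hS, ← e3]
  ring

end IsLagrangian

end PlasmaCharge

/-! ### The energy inequality. -/

namespace PlasmaCharge

open MeasureTheory Set Filter Topology
open scoped ENNReal NNReal Interval RealInnerProductSpace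

namespace IsLagrangian

variable {K : Set Phase} {μ : Measure Phase} {X V : Phase → ℝ → Space} {A W t P R : ℝ}
variable {N : ℕ} {T δ : ℝ} {ξ η : Fin N → ℝ → Space}

theorem hasDerivWithinAt_chargeInteraction (h : IsLagrangian T A W δ K μ ξ η X V)
    (ht : t ∈ Icc 0 T) (α β : Fin N) : HasDerivWithinAt (fun t => softInv 0 (ξ α t - ξ β t))
      (-⟪coulomb (ξ α t - ξ β t), η α t - η β t⟫) (Icc 0 T) t := by
  by_cases hab : α = β
  · subst hab
    simp only [sub_self, inner_zero_right, neg_zero]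
    exact hasDerivWithinAt_const _ _ _
  · have := hasDerivWithinAt_softInv (ε := 0) (Z := fun t => ξ α t - ξ β t)
      ((h.charge_pos α t ht).sub (h.charge_pos β t ht)) (by
        have := norm_pos_iff.2 (_root_.sub_ne_zero.2 (h.charge_ne t ht α β hab))
        positivity)
    simpa only [softForce_zero] using this

/-- By the mean value theorem the energy with softened self-interaction increases by at most T times
W times the uniform distance between the true and softened self-fields. -/
theorem externalEnergy_add_soft_le (h : IsLagrangian T A W δ K μ ξ η X V) (ht : t ∈ Icc 0 T)
    {ε r : ℝ} (hε : 0 < ε) (hr : 0 < r) :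
    externalEnergy μ ξ η X V t +
      (1 / 2) * (∫ p : Phase × Phase, softInv ε (X p.1 t - X p.2 t) ∂(μ.prod μ)) ≤
    externalEnergy μ ξ η X V 0 +
      (1 / 2) * (∫ p : Phase × Phase, softInv ε (X p.1 0 - X p.2 0) ∂(μ.prod μ)) +
      T * (W * (A * (3 * ballVolume * r) * (ballVolume * W ^ 3) + 3 * ε ^ 2 * (r ^ 4)⁻¹)) := by
  have hprob := h.prob
  have hv := ballVolume_nonneg
  have hA := h.density_nonneg
  have hW := h.speed_nonneg
  set B := A * (3 * ballVolume * r) * (ballVolume * W ^ 3) + 3 * ε ^ 2 * (r ^ 4)⁻¹ with hB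
  have hB0 : 0 ≤ B := by positivity
  rcases ht.1.eq_or_lt with rfl | ht0
  · have : 0 ≤ T * (W * B) := mul_nonneg ht.2 (by positivity)
    linarith
  obtain ⟨k1, k2⟩ := h.hasDerivAt_kinetic
  have p1 := fun α => (h.hasDerivAt_chargePotential α).1
  have p2 := fun α => (h.hasDerivAt_chargePotential α).2
  obtain ⟨s1, s2⟩ := h.hasDerivAt_selfPotential hε
  set G : ℝ → ℝ := fun t => externalEnergy μ ξ η X V t +
      (1 / 2) * (∫ p : Phase × Phase, softInv ε (X p.1 t - X p.2 t) ∂(μ.prod μ)) with hG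
  have hsub : Icc 0 t ⊆ Icc 0 T := Icc_subset_Icc_right ht.2
  have hcont : ContinuousOn G (Icc 0 T) := by
    refine ContinuousOn.add (ContinuousOn.add (ContinuousOn.add (ContinuousOn.add
      (k1.const_mul _) (ContinuousOn.const_mul (continuousOn_finsetSum _ fun α _ =>
        ContinuousOn.pow (ContinuousOn.norm fun s hs => (h.charge_vel α s hs).continuousWithinAt) 2)
        _)) (continuousOn_finsetSum _ fun α _ => p1 α)) (ContinuousOn.const_mul
      (continuousOn_finsetSum _ fun α _ => continuousOn_finsetSum _ fun β _ => fun s hs =>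
        (h.hasDerivWithinAt_chargeInteraction hs α β).continuousWithinAt) _)) (s1.const_mul _)
  have hderiv : ∀ s ∈ Ioo 0 t, HasDerivAt G (∫ z, ⟪V z s,
      lagrangianField μ X s (X z s) - ∫ z', softForce ε (X z s - X z' s) ∂μ⟫ ∂μ) s := by
    intro s hs
    have hs' : s ∈ Ioo 0 T := ⟨hs.1, hs.2.trans_le ht.2⟩
    have hsc := Ioo_subset_Icc_self hs'
    have hnhds := Icc_mem_nhds hs'.1 hs'.2
    rw [← h.energy_deriv_eq hsc hε]
    refine HasDerivAt.add (HasDerivAt.add (HasDerivAt.add (HasDerivAt.add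
      ((k2 s hs').const_mul _) (HasDerivAt.const_mul _ (HasDerivAt.fun_sum fun α _ =>
        ((h.charge_vel α s hsc).hasDerivAt hnhds).norm_sq))) (HasDerivAt.fun_sum fun α _ =>
      p2 α s hs')) (HasDerivAt.const_mul _ (HasDerivAt.fun_sum fun α _ => HasDerivAt.fun_sum
        fun β _ => (h.hasDerivWithinAt_chargeInteraction hsc α β).hasDerivAt hnhds)))
      ((s2 s hs').const_mul _)
  obtain ⟨c, hc, hslope⟩ := exists_hasDerivAt_eq_slope G _ ht0 (hcont.mono hsub) hderiv
  have hcT : c ∈ Icc 0 T := ⟨hc.1.le, hc.2.le.trans ht.2⟩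
  have hbound : ∫ z, ⟪V z c,
      lagrangianField μ X c (X z c) - ∫ z', softForce ε (X z c - X z' c) ∂μ⟫ ∂μ ≤ W * B := by
    refine (le_abs_self _).trans ?_
    have := norm_integral_le_of_norm_le_const (μ := μ) (C := W * B) (f := fun z => ⟪V z c,
      lagrangianField μ X c (X z c) - ∫ z', softForce ε (X z c - X z' c) ∂μ⟫) (by
        filter_upwards [h.ae_mem] with z hz
        exact (abs_real_inner_le_norm _ _).trans (mul_le_mul (h.speed_le z hz c hcT)
          (h.norm_field_sub_soft_le hcT hε hr _) (norm_nonneg _) hW))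
    simpa using this
  rw [hslope, div_le_iff₀ (by linarith), sub_zero] at hbound
  have : W * B * t ≤ T * (W * B) := by
    rw [mul_comm]
    have := ht.2
    gcongr
  change G t ≤ G 0 + _
  linarith

theorem ae_pos_ne (h : IsLagrangian T A W δ K μ ξ η X V) (ht : t ∈ Icc 0 T) (x : Space) :
    ∀ᵐ z ∂μ, X z t ≠ x := by
  have hm : AEMeasurable (fun z => ((X z t, V z t) : Phase)) μ :=
    aemeasurable_of_continuousOn_supp h.compact h.supp (h.cont t ht)
  have h0 : μ.map (fun z => ((X z t, V z t) : Phase)) ({x} ×ˢ univ) = 0 := by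
    refine le_antisymm ((h.map_le t ht _).trans ?_) zero_le
    rw [Measure.smul_apply, Measure.volume_eq_prod, Measure.prod_prod]
    simp
  rw [Measure.map_apply_of_aemeasurable hm
    ((measurableSet_singleton x).prod MeasurableSet.univ)] at h0
  rw [ae_iff]
  refine measure_mono_null (fun z hz => ?_) h0
  simpa using hz

theorem integrable_inv_norm (h : IsLagrangian T A W δ K μ ξ η X V) (ht : t ∈ Icc 0 T) (x : Space) :
    Integrable (fun z => ‖x - X z t‖⁻¹) μ := by
  have := h.prob
  refine Integrable.mono' ((integrable_const (1 : ℝ)).add (h.integrable_coulomb ht x).norm)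
    (((h.aemeasurable_pos ht).const_sub x).norm.inv).aestronglyMeasurable
    (Eventually.of_forall fun z => ?_)
  rw [Pi.add_apply, norm_coulomb, norm_inv, norm_norm, ← inv_pow]
  nlinarith [sq_nonneg (‖x - X z t‖⁻¹ - 1), norm_nonneg (x - X z t),
    inv_nonneg.2 (norm_nonneg (x - X z t))]

theorem integral_inv_norm_le (h : IsLagrangian T A W δ K μ ξ η X V) (ht : t ∈ Icc 0 T) (x : Space) :
    ∫ z, ‖x - X z t‖⁻¹ ∂μ ≤ 1 + (A * (3 * ballVolume) * (ballVolume * W ^ 3) + 1) := by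
  have := h.prob
  have hv := ballVolume_nonneg
  have hA := h.density_nonneg
  have hW := h.speed_nonneg
  calc ∫ z, ‖x - X z t‖⁻¹ ∂μ ≤ ∫ z, (1 + ‖coulomb (x - X z t)‖) ∂μ := by
        refine integral_mono (h.integrable_inv_norm ht x)
          ((integrable_const (1 : ℝ)).add (h.integrable_coulomb ht x).norm) fun z => ?_
        simp only [norm_coulomb, ← inv_pow]
        nlinarith [sq_nonneg (‖x - X z t‖⁻¹ - 1), inv_nonneg.2 (norm_nonneg (x - X z t))]
    _ = 1 + ∫ z, ‖coulomb (x - X z t)‖ ∂μ := by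
        rw [integral_add (integrable_const _) (h.integrable_coulomb ht x).norm]
        simp
    _ ≤ _ := by
        gcongr
        rw [integral_norm_eq_lintegral_enorm (h.aestronglyMeasurable_coulomb ht x)]
        refine ENNReal.toReal_le_of_le_ofReal (by positivity) (h.lintegral_enorm_coulomb_le ht x)

theorem integrable_integral_inv_norm (h : IsLagrangian T A W δ K μ ξ η X V) (ht : t ∈ Icc 0 T) :
    Integrable (fun z => ∫ z', ‖X z t - X z' t‖⁻¹ ∂μ) μ := by
  have hprob := h.prob
  have hm : AEStronglyMeasurable (fun p : Phase × Phase => ‖X p.1 t - X p.2 t‖⁻¹) (μ.prod μ) :=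
    (((h.aemeasurable_pos ht).comp_quasiMeasurePreserving
      Measure.quasiMeasurePreserving_fst).sub ((h.aemeasurable_pos ht).comp_quasiMeasurePreserving
      Measure.quasiMeasurePreserving_snd)).norm.inv.aestronglyMeasurable
  refine Integrable.of_bound hm.integral_prod_right'
    (1 + (A * (3 * ballVolume) * (ballVolume * W ^ 3) + 1)) (Eventually.of_forall fun z => ?_)
  rw [Real.norm_of_nonneg (integral_nonneg fun z' => by positivity)]
  exact h.integral_inv_norm_le ht _

theorem soft_le_coulomb (h : IsLagrangian T A W δ K μ ξ η X V) (ht : t ∈ Icc 0 T) {ε : ℝ}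
    (hε : 0 < ε) : ∫ p : Phase × Phase, softInv ε (X p.1 t - X p.2 t) ∂(μ.prod μ) ≤
      ∫ z, ∫ z', ‖X z t - X z' t‖⁻¹ ∂μ ∂μ := by
  have hprob := h.prob
  have hmX : AEMeasurable (fun p : Phase × Phase => X p.1 t - X p.2 t) (μ.prod μ) :=
    ((h.aemeasurable_pos ht).comp_quasiMeasurePreserving Measure.quasiMeasurePreserving_fst).sub
      ((h.aemeasurable_pos ht).comp_quasiMeasurePreserving Measure.quasiMeasurePreserving_snd)
  have hi : Integrable (fun p : Phase × Phase => softInv ε (X p.1 t - X p.2 t)) (μ.prod μ) := by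
    refine Integrable.of_bound ((measurable_softInv ε).comp_aemeasurable hmX).aestronglyMeasurable
      (ε⁻¹) (Eventually.of_forall fun p => ?_)
    rw [Real.norm_of_nonneg (softInv_nonneg _ _)]
    exact softInv_le hε _
  rw [integral_prod _ hi]
  refine integral_mono hi.integral_prod_left (h.integrable_integral_inv_norm ht) fun z => ?_
  · have hmz : AEMeasurable (fun z' => X z t - X z' t) μ := (h.aemeasurable_pos ht).const_sub _
    refine integral_mono_ae ?_ (h.integrable_inv_norm ht _) ?_
    · refine Integrable.of_bound
        ((measurable_softInv ε).comp_aemeasurable hmz).aestronglyMeasurable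
        (ε⁻¹) (Eventually.of_forall fun p => ?_)
      rw [Real.norm_of_nonneg (softInv_nonneg _ _)]
      exact softInv_le hε _
    · filter_upwards [h.ae_pos_ne ht (X z t)] with z' hz'
      exact softInv_le_inv_norm (_root_.sub_ne_zero.2 hz'.symm)

/-- The energy inequality. -/
theorem externalEnergy_le (h : IsLagrangian T A W δ K μ ξ η X V) (ht : t ∈ Icc 0 T) :
    externalEnergy μ ξ η X V t ≤ externalEnergy μ ξ η X V 0 +
      (1 / 2) * ∫ z, ∫ z', ‖X z 0 - X z' 0‖⁻¹ ∂μ ∂μ := by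
  have hv := ballVolume_nonneg
  have hA := h.density_nonneg
  have hW := h.speed_nonneg
  have hT : 0 ≤ T := ht.1.trans ht.2
  refine le_of_forall_pos_le_add fun e he => ?_
  set D := T * (W * (A * (3 * ballVolume) * (ballVolume * W ^ 3) + 3)) with hD
  have hD0 : 0 ≤ D := by positivity
  set r := min 1 (e / (D + 1)) with hr
  have hr0 : 0 < r := by positivity
  have hr1 : r ≤ 1 := min_le_left _ _
  have hDr : D * r ≤ e := by
    calc D * r ≤ (D + 1) * (e / (D + 1)) := by
          gcongr
          · linarith
          · exact min_le_right _ _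
      _ = e := by field_simp
  -- With ε = r³ the softening error ε²/r⁴ is r², so the whole error is O(r).
  have h1 := h.externalEnergy_add_soft_le ht (ε := r ^ 3) (by positivity) hr0
  have h2 := h.soft_le_coulomb (t := 0) ⟨le_rfl, hT⟩ (ε := r ^ 3) (by positivity)
  -- The self-energy at time t is dropped by positivity; hence only an inequality, which suffices.
  have h3 : 0 ≤ ∫ p : Phase × Phase, softInv (r ^ 3) (X p.1 t - X p.2 t) ∂(μ.prod μ) :=
    integral_nonneg fun p => softInv_nonneg _ _
  have h4 : T * (W * (A * (3 * ballVolume * r) * (ballVolume * W ^ 3) +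
      3 * (r ^ 3) ^ 2 * (r ^ 4)⁻¹)) ≤ D * r := by
    have : 3 * (r ^ 3) ^ 2 * (r ^ 4)⁻¹ = 3 * r * r := by field_simp
    rw [this]
    have h5 : 3 * r * r ≤ 3 * r := by nlinarith
    calc T * (W * (A * (3 * ballVolume * r) * (ballVolume * W ^ 3) + 3 * r * r))
        ≤ T * (W * (A * (3 * ballVolume * r) * (ballVolume * W ^ 3) + 3 * r)) := by gcongr
      _ = D * r := by rw [hD]; ring
  linarith

end IsLagrangian

end PlasmaCharge

/-! ### Bounds at all times from the initial energy. -/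

namespace PlasmaCharge

open MeasureTheory Set Filter Topology
open scoped ENNReal NNReal Interval RealInnerProductSpace

/-- The bounds at all times that follow from the conservation of the energy. -/
structure HasEnergyBound {N : ℕ} (H T : ℝ) (μ : Measure Phase) (ξ η : Fin N → ℝ → Space)
    (X V : Phase → ℝ → Space) : Prop where
  nonneg : 0 ≤ H
  charge_speed : ∀ t ∈ Icc 0 T, ∀ α, ‖η α t‖ ^ 2 ≤ 2 * H
  charge_dist : ∀ t ∈ Icc 0 T, ∀ α, ∑ β, ‖ξ α t - ξ β t‖⁻¹ ≤ H
  plasma : ∀ t ∈ Icc 0 T,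
    ∫⁻ z, ENNReal.ofReal (‖V z t‖ ^ 2 / 2 + ∑ α, ‖X z t - ξ α t‖⁻¹) ∂μ ≤ ENNReal.ofReal H

/-- The pairs containing α occur twice in the double sum, in the row and in the column of α. This
absorbs the factor 1/2 of the interaction energy. -/
theorem sum_le_half_sum_sum {N : ℕ} (s : Fin N → Fin N → ℝ) (hs : ∀ α β, 0 ≤ s α β)
    (hsymm : ∀ α β, s α β = s β α) (hdiag : ∀ α, s α α = 0) (α : Fin N) :
    ∑ β, s α β ≤ (1 / 2) * ∑ γ, ∑ β, s γ β := by
  have h1 : ∑ γ, ∑ β, s γ β = ∑ β, s α β + ∑ γ ∈ Finset.univ.erase α, ∑ β, s γ β := by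
    exact (Finset.add_sum_erase _ (fun γ => ∑ β, s γ β) (Finset.mem_univ α)).symm
  have h2 : ∑ γ ∈ Finset.univ.erase α, s γ α ≤ ∑ γ ∈ Finset.univ.erase α, ∑ β, s γ β :=
    Finset.sum_le_sum fun γ _ => Finset.single_le_sum (fun β _ => hs γ β) (Finset.mem_univ α)
  have h3 : ∑ γ ∈ Finset.univ.erase α, s γ α = ∑ β, s α β := by
    rw [Finset.sum_erase (f := fun γ => s γ α) _ (hdiag α)]
    exact Finset.sum_congr rfl fun β _ => hsymm _ _
  linarith

namespace IsLagrangian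

variable {K : Set Phase} {μ : Measure Phase} {X V : Phase → ℝ → Space} {A W t P R : ℝ}
variable {N : ℕ} {T δ : ℝ} {ξ η : Fin N → ℝ → Space}

theorem integrable_chargePotential (h : IsLagrangian T A W δ K μ ξ η X V) (ht : t ∈ Icc 0 T)
    (α : Fin N) : Integrable (fun z => softInv 0 (X z t - ξ α t)) μ := by
  simp_rw [softInv_zero, norm_sub_rev (X _ t)]
  exact h.integrable_inv_norm ht _

/-- The interaction is repulsive, so all terms of the energy are nonnegative and each is bounded by
H separately. -/
theorem hasEnergyBound (h : IsLagrangian T A W δ K μ ξ η X V) {H : ℝ}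
    (hT : 0 ≤ T) (hH : externalEnergy μ ξ η X V 0 +
      (1 / 2) * (∫ z, ∫ z', ‖X z 0 - X z' 0‖⁻¹ ∂μ ∂μ) ≤ H) : HasEnergyBound H T μ ξ η X V := by
  have hE : ∀ t ∈ Icc 0 T, externalEnergy μ ξ η X V t ≤ H := fun t ht =>
    (h.externalEnergy_le ht).trans hH
  have q1 : ∀ t, 0 ≤ ∫ z, ‖V z t‖ ^ 2 ∂μ := fun t => integral_nonneg fun z => by positivity
  have q2 : ∀ t, 0 ≤ ∑ α, ‖η α t‖ ^ 2 := fun t => by positivity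
  have q3 : ∀ t, 0 ≤ ∑ α, ∫ z, softInv 0 (X z t - ξ α t) ∂μ := fun t =>
    Finset.sum_nonneg fun α _ => integral_nonneg fun z => softInv_nonneg _ _
  have q4 : ∀ t, 0 ≤ ∑ α, ∑ β, softInv 0 (ξ α t - ξ β t) := fun t =>
    Finset.sum_nonneg fun α _ => Finset.sum_nonneg fun β _ => softInv_nonneg _ _
  simp only [externalEnergy] at hE
  refine ⟨?_, fun t ht α => ?_, fun t ht α => ?_, fun t ht => ?_⟩
  · have := hE 0 ⟨le_rfl, hT⟩
    linarith [q1 0, q2 0, q3 0, q4 0]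
  · have h1 : ‖η α t‖ ^ 2 ≤ ∑ α, ‖η α t‖ ^ 2 :=
      Finset.single_le_sum (f := fun α => ‖η α t‖ ^ 2) (fun _ _ => by positivity)
        (Finset.mem_univ α)
    linarith [q1 t, q2 t, q3 t, q4 t, hE t ht]
  · have h1 := sum_le_half_sum_sum (fun α β => softInv 0 (ξ α t - ξ β t))
      (fun _ _ => softInv_nonneg _ _)
      (fun α β => by rw [softInv_zero, softInv_zero, norm_sub_rev])
      (fun α => by simp [softInv_zero]) α
    simp only [softInv_zero] at h1
    have := hE t ht
    simp only [softInv_zero] at this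
    have q3' := q3 t
    simp only [softInv_zero] at q3'
    linarith [q1 t, q2 t]
  · have hiV : Integrable (fun z => ‖V z t‖ ^ 2) μ :=
      h.integrable_of_continuousOn ((h.continuousOn_vel ht).norm.pow 2)
    have hip := integrable_finsetSum Finset.univ fun α _ => h.integrable_chargePotential ht α
    simp_rw [← softInv_zero]
    rw [← ofReal_integral_eq_lintegral_ofReal ((hiV.div_const 2).fun_add hip)
      (Eventually.of_forall fun z => add_nonneg (by positivity)
        (Finset.sum_nonneg fun α _ => softInv_nonneg _ _))]
    apply ENNReal.ofReal_le_ofReal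
    rw [integral_add (hiV.div_const 2) hip, integral_div,
      integral_finsetSum _ fun α _ => h.integrable_chargePotential ht α]
    linarith [q1 t, q2 t, q3 t, q4 t, hE t ht]

end IsLagrangian

namespace IsSolution

variable {N : ℕ} {T : ℝ} {f₀ : Phase → ℝ} {ξ₀ η₀ : Fin N → Space} {ξ η : Fin N → ℝ → Space}
  {f : ℝ → Phase → ℝ} {Φ : ℝ → ℝ → Phase → Phase} {t : ℝ}

theorem flow_zero_zero (h0 : IsInitialDatum f₀ ξ₀) (hS : IsSolution T f₀ ξ₀ η₀ ξ η f Φ)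
    (hT : 0 ≤ T) {z : Phase} (hz : z ∈ tsupport f₀) : Φ 0 0 z = z :=
  hS.flow_self 0 ⟨le_rfl, hT⟩ z (tsupport_initial_subset_freePhase h0 hS hz)

theorem integral_spatialDensity_eq {k : Space → ℝ} (h0 : IsInitialDatum f₀ ξ₀)
    (hS : IsSolution T f₀ ξ₀ η₀ ξ η f Φ) (hT : 0 ≤ T)
    (hi : Integrable (fun z => k (Φ 0 0 z).1) (initialMeasure f₀)) :
    ∫ z, k (Φ 0 0 z).1 ∂(initialMeasure f₀) = ∫ x, spatialDensity f₀ x * k x := by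
  have e : ∀ z, f₀ z • k (Φ 0 0 z).1 = f₀ z • k z.1 := fun z => by
    by_cases hz : z ∈ tsupport f₀
    · rw [flow_zero_zero h0 hS hT hz]
    · simp [image_eq_zero_of_notMem_tsupport hz]
  have hi' := (h0.integrable_initialMeasure _).1 hi
  simp_rw [e] at hi'
  rw [h0.integral_initialMeasure]
  simp_rw [e]
  rw [← integral_spatialDensity_smul hi']
  rfl

theorem hasEnergyBound (h0 : IsInitialDatum f₀ ξ₀) (hS : IsSolution T f₀ ξ₀ η₀ ξ η f Φ)
    (hT : 0 ≤ T) : HasEnergyBound (totalEnergy f₀ ξ₀ η₀) T (initialMeasure f₀) ξ η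
      (fun z t => (Φ 0 t z).1) (fun z t => (Φ 0 t z).2) := by
  obtain ⟨W, δ, h⟩ := exists_isLagrangian h0 hS hT
  have h00 : (0 : ℝ) ∈ Icc 0 T := ⟨le_rfl, hT⟩
  refine h.hasEnergyBound hT (le_of_eq ?_)
  have e1 : ∫ z, ‖(Φ 0 0 z).2‖ ^ 2 ∂(initialMeasure f₀) = ∫ z : Phase, ‖z.2‖ ^ 2 * f₀ z := by
    rw [h0.integral_initialMeasure]
    refine integral_congr_ae (Eventually.of_forall fun z => ?_)
    by_cases hz : z ∈ tsupport f₀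
    · simp only [flow_zero_zero h0 hS hT hz, smul_eq_mul, mul_comm]
    · simp [image_eq_zero_of_notMem_tsupport hz]
  have e2 : ∀ α, ∫ z, softInv 0 ((Φ 0 0 z).1 - ξ α 0) ∂(initialMeasure f₀) =
      ∫ x, spatialDensity f₀ x / ‖x - ξ₀ α‖ := by
    intro α
    have := integral_spatialDensity_eq (k := fun x => softInv 0 (x - ξ α 0)) h0 hS hT
      (h.integrable_chargePotential h00 α)
    rw [this]
    simp only [softInv_zero, (hS.charge_initial α).1, div_eq_mul_inv]
  have e3 : ∑ α, ∑ β, softInv 0 (ξ α 0 - ξ β 0) =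
      ∑ α, ∑ β ∈ Finset.univ.erase α, 1 / ‖ξ₀ α - ξ₀ β‖ := by
    refine Finset.sum_congr rfl fun α _ => ?_
    rw [Finset.sum_erase _ (by simp)]
    refine Finset.sum_congr rfl fun β _ => ?_
    rw [softInv_zero, (hS.charge_initial α).1, (hS.charge_initial β).1, one_div]
  have e4 : ∫ z, ∫ z', ‖(Φ 0 0 z).1 - (Φ 0 0 z').1‖⁻¹ ∂(initialMeasure f₀) ∂(initialMeasure f₀) =
      ∫ x, ∫ y, spatialDensity f₀ x * spatialDensity f₀ y / ‖x - y‖ := by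
    rw [integral_spatialDensity_eq
      (k := fun x => ∫ z', ‖x - (Φ 0 0 z').1‖⁻¹ ∂(initialMeasure f₀)) h0 hS hT
      (h.integrable_integral_inv_norm h00)]
    refine integral_congr_ae (Eventually.of_forall fun x => ?_)
    simp only
    rw [integral_spatialDensity_eq (k := fun y => ‖x - y‖⁻¹) h0 hS hT (h.integrable_inv_norm h00 x),
      ← integral_const_mul]
    simp only [div_eq_mul_inv, mul_assoc]
  simp only [externalEnergy, totalEnergy, e1, e2, e3, e4, fun α => (hS.charge_initial α).2]
  ring

end IsSolution

end PlasmaCharge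

/-! ### The pointwise field bound of order P^(4/3). -/

namespace PlasmaCharge

open MeasureTheory Set Filter Topology
open scoped ENNReal NNReal Interval RealInnerProductSpace

variable {K : Set Phase} {μ : Measure Phase} {X V : Phase → ℝ → Space} {A W δ t T H : ℝ}

/-- The mass of distant particles which are slow with respect to their distance, weighted by the
inverse square distance. -/
theorem lintegral_far_slow_le {Z : Phase → Phase} (hZ : AEMeasurable Z μ)
    (h : μ.map Z ≤ ENNReal.ofReal A • volume) (hA : 0 ≤ A) (x : Space) {R l : ℝ} (hR : 0 < R)
    (hl : 0 ≤ l) :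
    ∫⁻ z, {w : Phase | ‖x - w.1‖ * ‖w.2‖ ≤ l ∧ R ≤ ‖x - w.1‖}.indicator
      (fun w => ENNReal.ofReal ((‖x - w.1‖ ^ 2)⁻¹)) (Z z) ∂μ ≤
    ENNReal.ofReal (A * (ballVolume * l ^ 3) * (3 * ballVolume * (R ^ 2)⁻¹)) := by
  have hv := ballVolume_nonneg
  have hms : MeasurableSet {w : Phase | ‖x - w.1‖ * ‖w.2‖ ≤ l ∧ R ≤ ‖x - w.1‖} :=
    (measurableSet_le (f := fun w : Phase => ‖x - w.1‖ * ‖w.2‖) (g := fun _ => l) (by fun_prop)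
      (by fun_prop)).inter (measurableSet_le (f := fun _ => R) (g := fun w : Phase => ‖x - w.1‖)
      (by fun_prop) (by fun_prop))
  have hG : Measurable ({w : Phase | ‖x - w.1‖ * ‖w.2‖ ≤ l ∧ R ≤ ‖x - w.1‖}.indicator
      (fun w => ENNReal.ofReal ((‖x - w.1‖ ^ 2)⁻¹))) := Measurable.indicator (by fun_prop) hms
  refine (lintegral_comp_le hZ h hG).trans ?_
  rw [Measure.volume_eq_prod, lintegral_prod _ hG.aemeasurable]
  have key : ∀ y : Space, ∫⁻ v : Space, {w : Phase | ‖x - w.1‖ * ‖w.2‖ ≤ l ∧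
      R ≤ ‖x - w.1‖}.indicator (fun w => ENNReal.ofReal ((‖x - w.1‖ ^ 2)⁻¹)) (y, v) ≤
      ENNReal.ofReal (ballVolume * l ^ 3) *
        (Metric.ball x R)ᶜ.indicator (fun y => ENNReal.ofReal ((‖x - y‖ ^ 5)⁻¹)) y := by
    intro y
    by_cases hy : R ≤ ‖x - y‖
    · have hr : 0 < ‖x - y‖ := hR.trans_le hy
      have hym : y ∈ (Metric.ball x R)ᶜ := by
        simpa [dist_eq_norm, norm_sub_rev y x] using hy
      have e : ∀ v : Space, {w : Phase | ‖x - w.1‖ * ‖w.2‖ ≤ l ∧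
          R ≤ ‖x - w.1‖}.indicator (fun w => ENNReal.ofReal ((‖x - w.1‖ ^ 2)⁻¹)) (y, v) =
          (Metric.closedBall (0 : Space) (l / ‖x - y‖)).indicator
            (fun _ => ENNReal.ofReal ((‖x - y‖ ^ 2)⁻¹)) v := by
        intro v
        have : ‖x - y‖ * ‖v‖ ≤ l ↔ ‖v‖ ≤ l / ‖x - y‖ := by
          rw [le_div_iff₀ hr, mul_comm]
        simp [indicator, hy, this]
      simp_rw [e]
      rw [lintegral_indicator measurableSet_closedBall, setLIntegral_const,
        volume_closedBall_space _ (by positivity), indicator_of_mem hym,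
        ← ENNReal.ofReal_mul (by positivity), ← ENNReal.ofReal_mul (by positivity)]
      apply ENNReal.ofReal_le_ofReal
      apply le_of_eq
      field_simp
    · simp [indicator, hy]
  refine (mul_le_mul_right (lintegral_mono key) _).trans ?_
  rw [lintegral_const_mul _ (Measurable.indicator (by fun_prop) measurableSet_ball.compl),
    lintegral_indicator measurableSet_ball.compl, mul_assoc A, ENNReal.ofReal_mul hA,
    ENNReal.ofReal_mul (p := ballVolume * l ^ 3) (by positivity)]
  gcongr
  exact lintegral_inv_pow_five_compl_ball x hR

/-- The constant in the bounds for the field in terms of the speed. -/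
noncomputable def fieldConst (A H : ℝ) : ℝ := 6 * A * ballVolume ^ 2 + 2 * H

theorem fieldConst_nonneg (hA : 0 ≤ A) (hH : 0 ≤ H) : 0 ≤ fieldConst A H := by
  unfold fieldConst; positivity

/-- The field of the particles whose velocities lie in a ball of radius `P = p³` is of the order of
`P^(4/3)`. -/
theorem lintegral_velocity_ball_le {Z : Phase → Phase} (hZ : AEMeasurable Z μ)
    (h : μ.map Z ≤ ENNReal.ofReal A • volume) (hA : 0 ≤ A) (hH : 0 ≤ H)
    (hE : ∫⁻ z, ENNReal.ofReal (‖(Z z).2‖ ^ 2) ∂μ ≤ ENNReal.ofReal (2 * H))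
    (x b : Space) {p : ℝ} (hp : 0 < p) :
    ∫⁻ z, {w : Phase | ‖w.2 - b‖ ≤ p ^ 3}.indicator
      (fun w => ENNReal.ofReal ((‖x - w.1‖ ^ 2)⁻¹)) (Z z) ∂μ ≤
    ENNReal.ofReal (fieldConst A H * p ^ 4) := by
  have hv := ballVolume_nonneg
  -- The cut-offs equalise three contributions at p⁴: near particles give R (p³)³, far particles
  -- with |x - y||v| ≤ l give l³/R², and for the remaining ones 1/|x - y|² < |v|²/l² is paid by the
  -- kinetic energy.
  set R : ℝ := (p ^ 5)⁻¹ with hR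
  set l : ℝ := (p ^ 2)⁻¹ with hl
  have hR0 : 0 < R := by positivity
  have hl0 : 0 < l := by positivity
  set f1 : Phase → ℝ≥0∞ := {w : Phase | ‖w.2 - b‖ ≤ p ^ 3 ∧ ‖x - w.1‖ < R}.indicator
      (fun w => ENNReal.ofReal ((‖x - w.1‖ ^ 2)⁻¹))
  set f2 : Phase → ℝ≥0∞ := {w : Phase | ‖x - w.1‖ * ‖w.2‖ ≤ l ∧ R ≤ ‖x - w.1‖}.indicator
      (fun w => ENNReal.ofReal ((‖x - w.1‖ ^ 2)⁻¹))
  have hm1 : Measurable f1 := Measurable.indicator (by fun_prop)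
    ((measurableSet_le (f := fun w : Phase => ‖w.2 - b‖) (g := fun _ => p ^ 3) (by fun_prop)
      (by fun_prop)).inter (measurableSet_lt (f := fun w : Phase => ‖x - w.1‖) (g := fun _ => R)
      (by fun_prop) (by fun_prop)))
  have hm2 : Measurable f2 := Measurable.indicator (by fun_prop)
    ((measurableSet_le (f := fun w : Phase => ‖x - w.1‖ * ‖w.2‖) (g := fun _ => l) (by fun_prop)
      (by fun_prop)).inter (measurableSet_le (f := fun _ => R) (g := fun w : Phase => ‖x - w.1‖)
      (by fun_prop) (by fun_prop)))
  have key : ∀ w : Phase, {w : Phase | ‖w.2 - b‖ ≤ p ^ 3}.indicator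
      (fun w => ENNReal.ofReal ((‖x - w.1‖ ^ 2)⁻¹)) w ≤
      f1 w + (f2 w + ENNReal.ofReal (p ^ 4) * ENNReal.ofReal (‖w.2‖ ^ 2)) := by
    intro w
    by_cases h1 : ‖w.2 - b‖ ≤ p ^ 3
    swap
    · simp [indicator, h1]
    rw [indicator_of_mem (show w ∈ {w : Phase | ‖w.2 - b‖ ≤ p ^ 3} from h1)]
    rcases lt_or_ge ‖x - w.1‖ R with h2 | h2
    · have : f1 w = ENNReal.ofReal ((‖x - w.1‖ ^ 2)⁻¹) := by
        simp [f1, h1, h2]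
      rw [this]
      exact le_self_add
    · refine le_trans ?_ le_add_self
      rcases le_or_gt (‖x - w.1‖ * ‖w.2‖) l with h3 | h3
      · have : f2 w = ENNReal.ofReal ((‖x - w.1‖ ^ 2)⁻¹) := by
          simp [f2, h3, h2]
        rw [this]
        exact le_self_add
      · refine le_trans ?_ le_add_self
        rw [← ENNReal.ofReal_mul (by positivity)]
        apply ENNReal.ofReal_le_ofReal
        have hr : 0 < ‖x - w.1‖ := hR0.trans_le h2
        rw [inv_le_iff_one_le_mul₀ (by positivity)]
        have : 1 ≤ p ^ 2 * (‖x - w.1‖ * ‖w.2‖) := by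
          rw [hl, inv_lt_iff_one_lt_mul₀ (by positivity)] at h3
          linarith
        calc (1 : ℝ) ≤ (p ^ 2 * (‖x - w.1‖ * ‖w.2‖)) ^ 2 := one_le_pow₀ this
          _ = _ := by ring
  calc _ ≤ ∫⁻ z, f1 (Z z) + (f2 (Z z) + ENNReal.ofReal (p ^ 4) * ENNReal.ofReal (‖(Z z).2‖ ^ 2)) ∂μ :=
        lintegral_mono fun z => key (Z z)
    _ = ∫⁻ z, f1 (Z z) ∂μ + (∫⁻ z, f2 (Z z) ∂μ +
        ENNReal.ofReal (p ^ 4) * ∫⁻ z, ENNReal.ofReal (‖(Z z).2‖ ^ 2) ∂μ) := by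
        rw [lintegral_add_left' (f := fun z => f1 (Z z)) (hm1.comp_aemeasurable hZ),
          lintegral_add_left' (f := fun z => f2 (Z z)) (hm2.comp_aemeasurable hZ), lintegral_const_mul' _ _ (by simp)]
    _ ≤ ENNReal.ofReal (A * (3 * ballVolume * R) * (ballVolume * (p ^ 3) ^ 3)) +
        (ENNReal.ofReal (A * (ballVolume * l ^ 3) * (3 * ballVolume * (R ^ 2)⁻¹)) +
        ENNReal.ofReal (p ^ 4) * ENNReal.ofReal (2 * H)) := by
        gcongr
        · exact lintegral_near_le hZ hA h x b (by positivity) R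
        · exact lintegral_far_slow_le hZ h hA x hR0 hl0.le
    _ = _ := by
        rw [← ENNReal.ofReal_mul (by positivity), ← ENNReal.ofReal_add (by positivity)
          (by positivity), ← ENNReal.ofReal_add (by positivity) (by positivity)]
        congr 1
        rw [hR, hl, fieldConst]
        field_simp
        ring

/-- The field of the particles with the positions `X z t` at `x`, without cancellations. -/
noncomputable def fieldMajorant (μ : Measure Phase) (X : Phase → ℝ → Space) (t : ℝ) (x : Space) :
    ℝ≥0∞ := ∫⁻ z, ENNReal.ofReal ((‖x - X z t‖ ^ 2)⁻¹) ∂μ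

namespace HasEnergyBound

variable {N : ℕ} {ξ η : Fin N → ℝ → Space}

theorem lintegral_speed_sq_le (h : HasEnergyBound H T μ ξ η X V) (ht : t ∈ Icc 0 T) :
    ∫⁻ z, ENNReal.ofReal (‖V z t‖ ^ 2) ∂μ ≤ ENNReal.ofReal (2 * H) := by
  have := h.plasma t ht
  rw [ENNReal.ofReal_mul zero_le_two]
  refine le_trans ?_ (mul_le_mul_right this _)
  rw [← lintegral_const_mul' _ _ (by simp)]
  refine lintegral_mono fun z => ?_
  rw [← ENNReal.ofReal_mul zero_le_two]
  apply ENNReal.ofReal_le_ofReal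
  have : 0 ≤ ∑ α, ‖X z t - ξ α t‖⁻¹ := by positivity
  linarith

end HasEnergyBound

namespace IsLagrangian

variable {N : ℕ} {ξ η : Fin N → ℝ → Space}

theorem aemeasurable_phase (h : IsLagrangian T A W δ K μ ξ η X V) (ht : t ∈ Icc 0 T) :
    AEMeasurable (fun z => ((X z t, V z t) : Phase)) μ :=
  aemeasurable_of_continuousOn_supp h.compact h.supp (h.cont t ht)

theorem lintegral_velocity_ball_le (h : IsLagrangian T A W δ K μ ξ η X V)
    (hE : HasEnergyBound H T μ ξ η X V) (ht : t ∈ Icc 0 T) (x b : Space) {p : ℝ} (hp : 0 < p) :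
    ∫⁻ z, {w : Phase | ‖w.2 - b‖ ≤ p ^ 3}.indicator
      (fun w => ENNReal.ofReal ((‖x - w.1‖ ^ 2)⁻¹)) (X z t, V z t) ∂μ ≤
    ENNReal.ofReal (fieldConst A H * p ^ 4) :=
  PlasmaCharge.lintegral_velocity_ball_le (h.aemeasurable_phase ht) (h.map_le t ht) h.density_nonneg
    hE.nonneg (hE.lintegral_speed_sq_le ht) x b hp

theorem fieldMajorant_le (h : IsLagrangian T A W δ K μ ξ η X V)
    (hE : HasEnergyBound H T μ ξ η X V) (ht : t ∈ Icc 0 T) (x : Space) {p : ℝ} (hp : 0 < p)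
    (hV : ∀ z ∈ K, ‖V z t‖ ≤ p ^ 3) :
    fieldMajorant μ X t x ≤ ENNReal.ofReal (fieldConst A H * p ^ 4) := by
  refine le_trans (lintegral_mono_ae ?_) (h.lintegral_velocity_ball_le hE ht x 0 hp)
  filter_upwards [h.ae_mem] with z hz
  rw [indicator_of_mem (by simpa using hV z hz)]

theorem enorm_field_le (x : Space) :
    ‖lagrangianField μ X t x‖ₑ ≤ fieldMajorant μ X t x := by
  refine (enorm_integral_le_lintegral_enorm _).trans (lintegral_mono fun z => ?_)
  rw [← ofReal_norm, norm_coulomb]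

end IsLagrangian

end PlasmaCharge

/-! ### Estimates on curves and convex functions of time. -/

namespace PlasmaCharge

open MeasureTheory Set Filter Topology
open scoped ENNReal NNReal Interval RealInnerProductSpace

/-- The square of a maximum is at least half the sum of the squares, so the integrand is dominated
by a rescaled 2/(1 + s²), whose integral is 2π/(cε). -/
theorem lintegral_inv_max_sq_le {ε c : ℝ} (hε : 0 < ε) (hc : 0 < c) (t : ℝ) :
    ∫⁻ s : ℝ, ENNReal.ofReal (((max ε (c * |s - t|)) ^ 2)⁻¹) ≤ ENNReal.ofReal (8 / (c * ε)) := by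
  have hk : c / ε ≠ 0 := by positivity
  set g : ℝ → ℝ := fun s => 2 * (ε ^ 2)⁻¹ * (1 + ((c / ε) * (s - t)) ^ 2)⁻¹ with hg
  have hi : Integrable g := by
    have h1 := (integrable_inv_one_add_sq.comp_mul_left' hk).comp_sub_right t
    exact h1.const_mul _
  have hI : ∫ s, g s = 2 * (ε ^ 2)⁻¹ * (ε / c * Real.pi) := by
    rw [hg, integral_const_mul,
      integral_sub_right_eq_self (fun s => (1 + ((c / ε) * s) ^ 2)⁻¹) t,
      Measure.integral_comp_mul_left (fun s : ℝ => (1 + s ^ 2)⁻¹), integral_univ_inv_one_add_sq,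
      inv_div, abs_of_pos (by positivity), smul_eq_mul]
  have hle : ∀ s, ((max ε (c * |s - t|)) ^ 2)⁻¹ ≤ g s := by
    intro s
    have h1 : ε ≤ max ε (c * |s - t|) := le_max_left _ _
    have h2 : c * |s - t| ≤ max ε (c * |s - t|) := le_max_right _ _
    have h3 : ε ^ 2 ≤ (max ε (c * |s - t|)) ^ 2 := by gcongr
    have h4 : (c * |s - t|) ^ 2 ≤ (max ε (c * |s - t|)) ^ 2 := by gcongr
    have e : g s = (((ε ^ 2 + (c * |s - t|) ^ 2)) / 2)⁻¹ := by
      simp only [hg]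
      rw [mul_pow, mul_pow, sq_abs]
      field_simp
    rw [e]
    gcongr
    linarith
  calc _ ≤ ∫⁻ s, ENNReal.ofReal (g s) := lintegral_mono fun s => ENNReal.ofReal_le_ofReal (hle s)
    _ = ENNReal.ofReal (∫ s, g s) := (ofReal_integral_eq_lintegral_ofReal hi
        (ae_of_all _ fun s => by simp only [hg, Pi.zero_apply]; positivity)).symm
    _ ≤ _ := by
      apply ENNReal.ofReal_le_ofReal
      rw [hI, le_div_iff₀ (by positivity)]
      have := Real.pi_le_four
      field_simp
      linarith

/-- A curve whose increments on a set are at least `c` times those of time leaves its point closest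
to the origin at the speed `c / 3`. -/
theorem exists_le_max_norm {Z : ℝ → Space} {S : Set ℝ} {ε c : ℝ} (hε : 0 < ε)
    (h : ∀ s ∈ S, ∀ s' ∈ S, s ≤ s' → c * (s' - s) ≤ ‖Z s' - Z s‖) :
    ∃ t, ∀ s ∈ S, max ε (c / 3 * |s - t|) ≤ max ε ‖Z s‖ := by
  rcases S.eq_empty_or_nonempty with rfl | hne
  · exact ⟨0, by simp⟩
  have hne' : ((fun s => ‖Z s‖) '' S).Nonempty := hne.image _
  -- The infimum of ‖Z‖ on S need not be attained, so t is a minimiser up to ε. Then c|s - t| ≤ ‖Z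
  -- s‖ + ‖Z t‖ ≤ 2‖Z s‖ + ε, which is where the factor 3 comes from.
  obtain ⟨_, ⟨t, ht, rfl⟩, htε⟩ := Real.lt_sInf_add_pos hne' hε
  refine ⟨t, fun s hs => ?_⟩
  have h1 : sInf ((fun s => ‖Z s‖) '' S) ≤ ‖Z s‖ :=
    csInf_le ⟨0, by rintro _ ⟨r, -, rfl⟩; positivity⟩ ⟨s, hs, rfl⟩
  have h2 : c * |s - t| ≤ ‖Z s - Z t‖ := by
    rcases le_total s t with h2 | h2
    · rw [abs_sub_comm, norm_sub_rev, abs_of_nonneg (by linarith)]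
      exact h s hs t ht h2
    · rw [abs_of_nonneg (by linarith)]
      exact h t ht s hs h2
  have h3 := norm_sub_le (Z s) (Z t)
  have h4 : ε ≤ max ε ‖Z s‖ := le_max_left _ _
  have h5 : ‖Z s‖ ≤ max ε ‖Z s‖ := le_max_right _ _
  simp only at htε
  exact max_le h4 (by linarith)

/-- The constant C only guarantees integrability and may be arbitrarily bad; the conclusion depends
on the integral bound B alone. -/
theorem norm_sub_le_of_lintegral_deriv {E : Type*} [NormedAddCommGroup E] [NormedSpace ℝ E]
    [CompleteSpace E] {f f' : ℝ → E} {a b B C : ℝ} (hab : a ≤ b) (hB : 0 ≤ B)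
    (hf : ∀ r ∈ Icc a b, HasDerivWithinAt f (f' r) (Icc a b) r) (hC : ∀ r ∈ Icc a b, ‖f' r‖ ≤ C)
    (h : ∫⁻ r in Icc a b, ‖f' r‖ₑ ≤ ENNReal.ofReal B) : ‖f b - f a‖ ≤ B := by
  have h1 := (intervalIntegrable_and_integral_eq_sub (V := f) (V' := f') (s := a) (t := b) (C := C)
    (by rwa [uIcc_of_le hab]) (by
      rw [uIoc_of_le hab]
      filter_upwards [ae_restrict_mem measurableSet_Ioc] with r hr
      exact hC r (Ioc_subset_Icc_self hr))).2
  rw [← h1, intervalIntegral.integral_of_le hab, ← integral_Icc_eq_integral_Ioc]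
  exact norm_integral_le_of_lintegral hB h

/-- A strongly convex function decreases, then increases, and grows quadratically. -/
theorem exists_antitoneOn_monotoneOn {φ ψ ψ' : ℝ → ℝ} {a b e : ℝ} (hab : a ≤ b) (he0 : 0 ≤ e)
    (hφ : ∀ s ∈ Icc a b, HasDerivWithinAt φ (ψ s) (Icc a b) s)
    (hψ : ∀ s ∈ Icc a b, HasDerivWithinAt ψ (ψ' s) (Icc a b) s) (he : ∀ s ∈ Icc a b, e ≤ ψ' s) :
    ∃ t ∈ Icc a b, AntitoneOn φ (Icc a t) ∧ MonotoneOn φ (Icc t b) ∧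
      ∀ s ∈ Icc a b, e / 2 * (s - t) ^ 2 ≤ φ s - φ t := by
  have hψc : ContinuousOn ψ (Icc a b) := fun s hs => (hψ s hs).continuousWithinAt
  have hφc : ContinuousOn φ (Icc a b) := fun s hs => (hφ s hs).continuousWithinAt
  have hmono : MonotoneOn (fun s => ψ s - e * s) (Icc a b) := by
    refine monotoneOn_of_hasDerivWithinAt_nonneg (f' := fun s => ψ' s - e) (convex_Icc a b)
      (hψc.sub (by fun_prop)) (fun s hs => ?_) (fun s hs => ?_)
    · have := ((hψ s (interior_subset hs)).sub ((hasDerivWithinAt_id s _).const_mul e)).mono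
        interior_subset
      exact this.congr_deriv (by ring)
    · have := he s (interior_subset hs)
      linarith
  -- The minimiser is a zero of the derivative or an endpoint; the implications cover the two
  -- endpoint cases.
  have hex : ∃ t ∈ Icc a b, (a < t → ψ t ≤ 0) ∧ (t < b → 0 ≤ ψ t) := by
    rcases le_or_gt 0 (ψ a) with h1 | h1
    · exact ⟨a, left_mem_Icc.2 hab, fun h => absurd h (lt_irrefl _), fun _ => h1⟩
    rcases le_or_gt (ψ b) 0 with h2 | h2
    · exact ⟨b, right_mem_Icc.2 hab, fun _ => h2, fun h => absurd h (lt_irrefl _)⟩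
    obtain ⟨t, ht, h0⟩ := intermediate_value_Icc hab hψc ⟨h1.le, h2.le⟩
    exact ⟨t, ht, fun _ => h0.le, fun _ => h0.ge⟩
  obtain ⟨t, ht, hta, htb⟩ := hex
  have hd : ∀ s ∈ Icc a b, HasDerivWithinAt (fun s => φ s - e / 2 * (s - t) ^ 2)
      (ψ s - e * (s - t)) (Icc a b) s := by
    intro s hs
    have h1 : HasDerivWithinAt (fun s : ℝ => e / 2 * (s - t) ^ 2) (e * (s - t)) (Icc a b) s := by
      have := ((((hasDerivAt_id s).sub_const t).pow 2).const_mul (e / 2)).hasDerivWithinAt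
        (s := Icc a b)
      refine this.congr_deriv ?_
      simp only [id]
      ring
    exact (hφ s hs).sub h1
  have hgc : ContinuousOn (fun s => φ s - e / 2 * (s - t) ^ 2) (Icc a b) :=
    fun s hs => (hd s hs).continuousWithinAt
  have hl : Icc a t ⊆ Icc a b := Icc_subset_Icc_right ht.2
  have hr : Icc t b ⊆ Icc a b := Icc_subset_Icc_left ht.1
  -- After subtraction of the parabola e/2 (s - t)² the function is still monotone on each side of
  -- t. This gives the quadratic growth and, adding the parabola back, the monotonicity of φ.
  have hanti : AntitoneOn (fun s => φ s - e / 2 * (s - t) ^ 2) (Icc a t) := by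
    refine antitoneOn_of_hasDerivWithinAt_nonpos (convex_Icc a t) (hgc.mono hl)
      (fun s hs => (hd s (hl (interior_subset hs))).mono (interior_subset.trans hl))
      (fun s hs => ?_)
    rw [interior_Icc] at hs
    have h1 := hmono (hl (Ioo_subset_Icc_self hs)) ht hs.2.le
    have h2 := hta (hs.1.trans hs.2)
    simp only at h1
    linarith
  have hmon : MonotoneOn (fun s => φ s - e / 2 * (s - t) ^ 2) (Icc t b) := by
    refine monotoneOn_of_hasDerivWithinAt_nonneg (convex_Icc t b) (hgc.mono hr)
      (fun s hs => (hd s (hr (interior_subset hs))).mono (interior_subset.trans hr))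
      (fun s hs => ?_)
    rw [interior_Icc] at hs
    have h1 := hmono ht (hr (Ioo_subset_Icc_self hs)) hs.1.le
    have h2 := htb (hs.1.trans hs.2)
    simp only at h1
    linarith
  refine ⟨t, ht, fun s hs r hr hsr => ?_, fun s hs r hr hsr => ?_, fun s hs => ?_⟩
  · have h1 := hanti hs hr hsr
    have h2 : (r - t) ^ 2 ≤ (s - t) ^ 2 := by nlinarith [hs.2, hr.2]
    have h3 : e / 2 * (r - t) ^ 2 ≤ e / 2 * (s - t) ^ 2 := by gcongr
    simp only at h1
    linarith
  · have h1 := hmon hs hr hsr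
    have h2 : (s - t) ^ 2 ≤ (r - t) ^ 2 := by nlinarith [hs.1, hr.1]
    have h3 : e / 2 * (s - t) ^ 2 ≤ e / 2 * (r - t) ^ 2 := by gcongr
    simp only at h1
    linarith
  · rcases le_total s t with h | h
    · have h1 := hanti ⟨hs.1, h⟩ (right_mem_Icc.2 ht.1) h
      simp only at h1
      nlinarith
    · have h1 := hmon (left_mem_Icc.2 ht.2) ⟨h, hs.2⟩ h
      simp only at h1
      nlinarith

end PlasmaCharge

/-! ### Motion of a particle relative to one charge. -/

namespace PlasmaCharge

open MeasureTheory Set Filter Topology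
open scoped ENNReal NNReal Interval RealInnerProductSpace

/-- The motion, on the time interval `[a, b]`, of a particle relative to a charge that repels it:
`Z` is the relative position, `U` the relative velocity, and `G` the perturbing acceleration. -/
structure IsRelativeMotion (a b : ℝ) (Z U G : ℝ → Space) : Prop where
  le : a ≤ b
  ne_zero : ∀ s ∈ Icc a b, Z s ≠ 0
  pos : ∀ s ∈ Icc a b, HasDerivWithinAt Z (U s) (Icc a b) s
  vel : ∀ s ∈ Icc a b, HasDerivWithinAt U (coulomb (Z s) + G s) (Icc a b) s

namespace IsRelativeMotion

variable {a b k q : ℝ} {Z U G : ℝ → Space}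

theorem energy_pos (h : IsRelativeMotion a b Z U G) (hk : 0 ≤ k) {s : ℝ} (hs : s ∈ Icc a b) :
    0 < ‖U s‖ ^ 2 / 2 + 1 / ‖Z s‖ + k := by
  have := norm_pos_iff.2 (h.ne_zero s hs)
  positivity

/-- The derivative of 1/‖Z‖ is the opposite of the power of the Coulomb force, so the singular
repulsion disappears and only the power of the perturbation G is left. -/
theorem hasDerivWithinAt_sqrt_energy (h : IsRelativeMotion a b Z U G) (hk : 0 ≤ k) {s : ℝ}
    (hs : s ∈ Icc a b) :
    HasDerivWithinAt (fun s => √(‖U s‖ ^ 2 / 2 + 1 / ‖Z s‖ + k))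
      (⟪U s, G s⟫ / (2 * √(‖U s‖ ^ 2 / 2 + 1 / ‖Z s‖ + k))) (Icc a b) s := by
  have hZ := norm_pos_iff.2 (h.ne_zero s hs)
  have h1 := hasDerivWithinAt_softInv (ε := 0) (h.pos s hs) (by positivity)
  simp only [softInv_zero, softForce_zero] at h1
  have h2 := (((h.vel s hs).norm_sq.div_const 2).add h1).add_const k
  refine HasDerivWithinAt.sqrt ?_ (h.energy_pos hk hs).ne'
  simp only [one_div]
  refine h2.congr_deriv ?_
  rw [inner_add_right, real_inner_comm (coulomb (Z s))]
  ring

/-- The square root is what makes the growth linear: ‖U‖ is at most twice the square root of the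
energy, so the speed drops out of the quotient. -/
theorem abs_deriv_sqrt_energy_le (h : IsRelativeMotion a b Z U G) (hk : 0 ≤ k) {s : ℝ}
    (hs : s ∈ Icc a b) :
    |⟪U s, G s⟫ / (2 * √(‖U s‖ ^ 2 / 2 + 1 / ‖Z s‖ + k))| ≤ ‖G s‖ := by
  have h1 := Real.sqrt_pos.2 (h.energy_pos hk hs)
  have h2 := Real.sq_sqrt (h.energy_pos hk hs).le
  have hZ := norm_pos_iff.2 (h.ne_zero s hs)
  have h3 : 0 < 1 / ‖Z s‖ := by positivity
  rw [abs_div, abs_of_pos (show 0 < 2 * √(‖U s‖ ^ 2 / 2 + 1 / ‖Z s‖ + k) by positivity),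
    div_le_iff₀ (by positivity)]
  have h4 : ‖U s‖ ≤ 2 * √(‖U s‖ ^ 2 / 2 + 1 / ‖Z s‖ + k) :=
    abs_le_of_sq_le_sq' (by nlinarith [norm_nonneg (U s)]) (by positivity) |>.2
  calc |⟪U s, G s⟫| ≤ ‖U s‖ * ‖G s‖ := abs_real_inner_le_norm _ _
    _ ≤ _ := by rw [mul_comm]; gcongr

theorem abs_sqrt_energy_sub_le (h : IsRelativeMotion a b Z U G) (hk : 0 ≤ k) {M : ℝ}
    (hG : ∀ s ∈ Icc a b, ‖G s‖ ≤ M) {s : ℝ} (hs : s ∈ Icc a b) :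
    |√(‖U s‖ ^ 2 / 2 + 1 / ‖Z s‖ + k) - √(‖U a‖ ^ 2 / 2 + 1 / ‖Z a‖ + k)| ≤ M * (b - a) := by
  have h1 := Convex.norm_image_sub_le_of_norm_hasDerivWithin_le (C := M)
    (fun r hr => h.hasDerivWithinAt_sqrt_energy hk hr)
    (fun r hr => (h.abs_deriv_sqrt_energy_le hk hr).trans (hG r hr)) (convex_Icc a b)
    (left_mem_Icc.2 h.le) hs
  refine (Real.norm_eq_abs _ ▸ h1).trans ?_
  have hM : 0 ≤ M := (norm_nonneg _).trans (hG s hs)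
  gcongr
  rw [Real.norm_eq_abs, abs_of_nonneg (by linarith [hs.1])]
  linarith [hs.2]

theorem norm_position_sub_le (h : IsRelativeMotion a b Z U G) {M : ℝ}
    (hU : ∀ s ∈ Icc a b, ‖U s‖ ≤ M) {s s' : ℝ} (hs : s ∈ Icc a b) (hs' : s' ∈ Icc a b) :
    ‖Z s' - Z s‖ ≤ M * (b - a) := by
  have h1 := Convex.norm_image_sub_le_of_norm_hasDerivWithin_le (C := M)
    (fun r hr => h.pos r hr) hU (convex_Icc a b) hs hs'
  refine h1.trans ?_
  have hM : 0 ≤ M := (norm_nonneg _).trans (hU s hs)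
  gcongr
  rw [Real.norm_eq_abs, abs_le]
  constructor <;> linarith [hs.1, hs.2, hs'.1, hs'.2]

/-- The relative velocity varies little while the particle stays away from the charge. -/
theorem norm_velocity_sub_le (h : IsRelativeMotion a b Z U G) {M c d t s s' : ℝ} (hM : 0 ≤ M)
    (hc : 0 < c) (hd : 0 < d) (hG : ∀ s ∈ Icc a b, ‖G s‖ ≤ M) (hs : a ≤ s) (hss : s ≤ s')
    (hs' : s' ≤ b) (hr : ∀ r ∈ Icc s s', max d (c * |r - t|) ≤ ‖Z r‖) :
    ‖U s' - U s‖ ≤ 8 / (c * d) + M * (b - a) := by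
  have hsub : Icc s s' ⊆ Icc a b := Icc_subset_Icc hs hs'
  have hab := h.le
  -- The repulsion is at most the inverse square of a truncated linear function of time, whose
  -- integral over the line is at most 8/(c d).
  have hn : ∀ r ∈ Icc s s', ‖coulomb (Z r) + G r‖ ≤ ((max d (c * |r - t|)) ^ 2)⁻¹ + M := by
    intro r hr'
    refine (norm_add_le _ _).trans (add_le_add ?_ (hG r (hsub hr')))
    rw [norm_coulomb]
    have : 0 < max d (c * |r - t|) := hd.trans_le (le_max_left _ _)
    gcongr
    exact hr r hr'
  refine norm_sub_le_of_lintegral_deriv (C := (d ^ 2)⁻¹ + M) hss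
    (by have : 0 ≤ M * (b - a) := mul_nonneg hM (by linarith)
        positivity)
    (fun r hr' => (h.vel r (hsub hr')).mono hsub) (fun r hr' => (hn r hr').trans ?_) ?_
  · gcongr
    exact le_max_left _ _
  · calc ∫⁻ r in Icc s s', ‖coulomb (Z r) + G r‖ₑ
        ≤ ∫⁻ r in Icc s s', (ENNReal.ofReal (((max d (c * |r - t|)) ^ 2)⁻¹) + ENNReal.ofReal M) := by
          refine setLIntegral_mono' measurableSet_Icc fun r hr' => ?_
          rw [← ofReal_norm, ← ENNReal.ofReal_add (by positivity) hM]
          exact ENNReal.ofReal_le_ofReal (hn r hr')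
      _ = (∫⁻ r in Icc s s', ENNReal.ofReal (((max d (c * |r - t|)) ^ 2)⁻¹)) +
          ENNReal.ofReal M * ENNReal.ofReal (s' - s) := by
          rw [lintegral_add_right _ (by fun_prop), setLIntegral_const, Real.volume_Icc]
      _ ≤ ENNReal.ofReal (8 / (c * d)) + ENNReal.ofReal M * ENNReal.ofReal (b - a) := by
          gcongr
          exact (setLIntegral_le_lintegral _ _).trans (lintegral_inv_max_sq_le hd hc t)
      _ = _ := by
          rw [← ENNReal.ofReal_mul hM, ← ENNReal.ofReal_add (by positivity)
            (mul_nonneg hM (by linarith))]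

/-- The square distance to the charge of an energetic particle is strongly convex. -/
theorem exists_closest (h : IsRelativeMotion a b Z U G) {e : ℝ} (he0 : 0 ≤ e)
    (he : ∀ s ∈ Icc a b, e ≤ ‖U s‖ ^ 2 / 2 + 1 / ‖Z s‖)
    (hZ : ∀ s ∈ Icc a b, 2 * (‖Z s‖ * ‖G s‖) ≤ e) :
    ∃ t ∈ Icc a b, AntitoneOn (fun s => ‖Z s‖) (Icc a t) ∧ MonotoneOn (fun s => ‖Z s‖) (Icc t b) ∧
      ∀ s ∈ Icc a b, e / 2 * (s - t) ^ 2 ≤ ‖Z s‖ ^ 2 := by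
  -- The second derivative of ‖Z‖² is 2‖U‖² + 2/‖Z‖ + 2⟨Z, G⟩. Its first two terms are at least
  -- twice the energy, hence at least 2e, and the perturbation removes at most e.
  have hconv : ∀ s ∈ Icc a b, e ≤ 2 * (⟪Z s, coulomb (Z s) + G s⟫ + ⟪U s, U s⟫) := by
    intro s hs
    have hpos := norm_pos_iff.2 (h.ne_zero s hs)
    have h4 : ⟪Z s, coulomb (Z s)⟫ = 1 / ‖Z s‖ := by
      rw [coulomb, real_inner_smul_right, real_inner_self_eq_norm_sq]
      field_simp
    have h5 := abs_real_inner_le_norm (Z s) (G s)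
    have h6 := neg_abs_le ⟪Z s, G s⟫
    have h7 := he s hs
    have h8 := hZ s hs
    rw [inner_add_right, h4, real_inner_self_eq_norm_sq]
    nlinarith [sq_nonneg ‖U s‖]
  obtain ⟨t, ht, h1, h2, h3⟩ := exists_antitoneOn_monotoneOn (φ := fun s => ‖Z s‖ ^ 2)
    (ψ := fun s => 2 * ⟪Z s, U s⟫)
    (ψ' := fun s => 2 * (⟪Z s, coulomb (Z s) + G s⟫ + ⟪U s, U s⟫)) h.le he0
    (fun s hs => (h.pos s hs).norm_sq)
    (fun s hs => ((h.pos s hs).inner ℝ (h.vel s hs)).const_mul 2) hconv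
  refine ⟨t, ht, fun s hs r hr hsr => ?_, fun s hs r hr hsr => ?_, fun s hs => ?_⟩
  · exact (sq_le_sq₀ (norm_nonneg _) (norm_nonneg _)).1 (h1 hs hr hsr)
  · exact (sq_le_sq₀ (norm_nonneg _) (norm_nonneg _)).1 (h2 hs hr hsr)
  · have := h3 s hs
    nlinarith [norm_nonneg (Z t)]

end IsRelativeMotion

end PlasmaCharge

/-! ### Passages of slow and fast particles near a charge. -/

namespace PlasmaCharge

open MeasureTheory Set Filter Topology
open scoped ENNReal NNReal Interval RealInnerProductSpace

namespace IsRelativeMotion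

variable {a b q : ℝ} {Z U G : ℝ → Space}

/-- The relative velocity varies little before and after the time `t`, except close to the charge,
and either the particle is slow and stays away from the charge, or it is fast and moves away from
its position at the time `t`. -/
def IsPassage (a b q t : ℝ) (Z U : ℝ → Space) : Prop :=
  (∀ s r s', a ≤ s → s ≤ r → r ≤ s' → s' ≤ b → (s' ≤ t ∨ t ≤ s) → (2 * q ^ 34)⁻¹ ≤ ‖Z s‖ →
    (2 * q ^ 34)⁻¹ ≤ ‖Z s'‖ → ‖U r - U s‖ ≤ q ^ 18 / 20) ∧
  ((∀ s ∈ Icc a b, ‖U s‖ ≤ 2 * q ^ 17 ∧ (q ^ 34)⁻¹ ≤ ‖Z s‖) ∨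
    (q ^ 34 / 4 ≤ ‖U a‖ ^ 2 / 2 + 1 / ‖Z a‖ ∧ ∀ s ∈ Icc a b, q ^ 17 / 8 * |s - t| ≤ ‖Z s‖))

theorem exists_isPassage (h : IsRelativeMotion a b Z U G) (hq : 10 ^ 4 ≤ q)
    (hl : 4 * (q ^ 24 * (b - a)) ≤ 1) (hG : ∀ s ∈ Icc a b, ‖G s‖ ≤ q ^ 33)
    (hU : ∀ s ∈ Icc a b, ‖U s‖ ≤ 2 * q ^ 24) : ∃ t ∈ Icc a b, IsPassage a b q t Z U := by
  have hq0 : 0 < q := by linarith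
  have hq1 : 1 ≤ q := by linarith
  have hab := h.le
  have h917 : q ^ 9 ≤ q ^ 17 := pow_le_pow_right₀ hq1 (by norm_num)
  have h18 : 10 ^ 4 * q ^ 17 ≤ q ^ 18 := by
    rw [pow_succ q 17, mul_comm]; gcongr
  have h34 : 10 ^ 4 * q ^ 33 ≤ q ^ 34 := by
    rw [pow_succ q 33, mul_comm]; gcongr
  have h17 : 0 < q ^ 17 := by positivity
  have h17' : 1 ≤ q ^ 17 := one_le_pow₀ hq1
  have hsq : q ^ 34 = q ^ 17 * q ^ 17 := by ring
  -- The square root of the energy varies by at most q^9/4, negligible against q^17, so a particle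
  -- that is slow or fast at time a remains so.
  have hl9 : q ^ 33 * (b - a) ≤ q ^ 9 / 4 := by
    have : q ^ 33 * (b - a) = q ^ 9 * (q ^ 24 * (b - a)) := by ring
    rw [this]
    have : q ^ 9 * (4 * (q ^ 24 * (b - a))) ≤ q ^ 9 * 1 := by gcongr
    linarith
  have hvar : ∀ s ∈ Icc a b,
      |√(‖U s‖ ^ 2 / 2 + 1 / ‖Z s‖ + 0) - √(‖U a‖ ^ 2 / 2 + 1 / ‖Z a‖ + 0)| ≤ q ^ 9 / 4 :=
    fun s hs => (h.abs_sqrt_energy_sub_le le_rfl hG hs).trans hl9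
  simp only [add_zero] at hvar
  have hZpos : ∀ s ∈ Icc a b, 0 < 1 / ‖Z s‖ := fun s hs => by
    have := norm_pos_iff.2 (h.ne_zero s hs)
    positivity
  rcases le_or_gt (√(‖U a‖ ^ 2 / 2 + 1 / ‖Z a‖)) (q ^ 17 / 2) with hslow | hfast
  · have hb : ∀ s ∈ Icc a b, ‖U s‖ ≤ 2 * q ^ 17 ∧ (q ^ 34)⁻¹ ≤ ‖Z s‖ := by
      intro s hs
      have h1 := (abs_le.1 (hvar s hs)).2
      have h2 : √(‖U s‖ ^ 2 / 2 + 1 / ‖Z s‖) ≤ q ^ 17 := by linarith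
      have h3 : ‖U s‖ ^ 2 / 2 + 1 / ‖Z s‖ ≤ (q ^ 17) ^ 2 := (Real.sqrt_le_left (by positivity)).1 h2
      have h4 := hZpos s hs
      refine ⟨abs_le_of_sq_le_sq' (by nlinarith) (by positivity) |>.2, ?_⟩
      have h5 : 1 / ‖Z s‖ ≤ q ^ 34 := by nlinarith [sq_nonneg ‖U s‖]
      rw [one_div] at h5
      exact inv_le_of_inv_le₀ (norm_pos_iff.2 (h.ne_zero s hs)) h5
    refine ⟨a, left_mem_Icc.2 hab, fun s r s' hs hsr hrs hs' _ _ _ => ?_, Or.inl hb⟩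
    have h1 := (hb r ⟨hs.trans hsr, hrs.trans hs'⟩).1
    have h2 := (hb s ⟨hs, hsr.trans (hrs.trans hs')⟩).1
    have h3 := norm_sub_le (U r) (U s)
    linarith
  have he : ∀ s ∈ Icc a b, q ^ 34 / 16 ≤ ‖U s‖ ^ 2 / 2 + 1 / ‖Z s‖ := by
    intro s hs
    have h1 := (abs_le.1 (hvar s hs)).1
    have h2 : q ^ 17 / 4 ≤ √(‖U s‖ ^ 2 / 2 + 1 / ‖Z s‖) := by linarith
    have h3 := (Real.le_sqrt' (by positivity)).1 h2
    nlinarith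
  have hea : q ^ 34 / 4 ≤ ‖U a‖ ^ 2 / 2 + 1 / ‖Z a‖ := by
    have h3 := (Real.le_sqrt' (by positivity)).1 hfast.le
    nlinarith
  have hb24 : 2 * q ^ 24 * (b - a) ≤ 1 / 2 := by linarith
  have hU' : ∀ s ∈ Icc a b, ∀ s' ∈ Icc a b, ‖Z s'‖ ≤ ‖Z s‖ + 1 / 2 := fun s hs s' hs' => by
    have h1 := (h.norm_position_sub_le hU hs hs').trans hb24
    have h2 := norm_sub_norm_le (Z s') (Z s)
    linarith
  -- A fast particle that comes within distance 1 stays within 3/2, since it moves by at most 1/2.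
  -- Then ‖Z‖‖G‖ is small compared with q^34/16 and the squared distance is strongly convex.
  -- Quadratic growth of ‖Z‖² is linear growth of ‖Z‖, at speed at least q^17/8.
  by_cases hclose : ∃ s ∈ Icc a b, ‖Z s‖ ≤ 1
  · obtain ⟨s₀, hs₀, h0⟩ := hclose
    obtain ⟨t, ht, hanti, hmono, hquad⟩ := h.exists_closest (by positivity) he (fun s hs => by
      have h1 := hU' s₀ hs₀ s hs
      have h2 := hG s hs
      have h3 : ‖Z s‖ * ‖G s‖ ≤ 2 * q ^ 33 := by
        gcongr
        linarith
      have h4 : 0 < q ^ 33 := by positivity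
      linarith)
    have hlin : ∀ s ∈ Icc a b, q ^ 17 / 8 * |s - t| ≤ ‖Z s‖ := by
      intro s hs
      refine abs_le_of_sq_le_sq' ?_ (norm_nonneg _) |>.2
      have h1 := hquad s hs
      rw [mul_pow, sq_abs]
      have : 0 ≤ q ^ 34 * (s - t) ^ 2 := by positivity
      nlinarith
    refine ⟨t, ht, fun s r s' hs hsr hrs hs' hside hds hds' => ?_, Or.inr ⟨hea, hlin⟩⟩
    have h1 : ∀ x ∈ Icc s r, max (2 * q ^ 34)⁻¹ (q ^ 17 / 8 * |x - t|) ≤ ‖Z x‖ := by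
      intro x hx
      have hxs' : x ≤ s' := hx.2.trans hrs
      have hxI : x ∈ Icc a b := ⟨hs.trans hx.1, hxs'.trans hs'⟩
      refine max_le ?_ (hlin x hxI)
      -- The distance decreases before t and increases after it. On one side of t the lower bound at
      -- one of the two endpoints therefore holds throughout.
      rcases hside with h2 | h2
      · exact hds'.trans (hanti ⟨hxI.1, hxs'.trans h2⟩ ⟨hxI.1.trans hxs', h2⟩ hxs')
      · exact hds.trans (hmono ⟨h2, hx.1.trans hxI.2⟩ ⟨h2.trans hx.1, hxI.2⟩ hx.1)
    have h2 := h.norm_velocity_sub_le (by positivity) (by positivity) (by positivity) hG hs hsr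
      (hrs.trans hs') h1
    have h3 : 8 / (q ^ 17 / 8 * (2 * q ^ 34)⁻¹) = 128 * q ^ 17 := by
      field_simp
      ring
    rw [h3] at h2
    linarith
  -- A fast particle that stays at distance more than 1 needs no genuine passage time: t = a works,
  -- because the step is so short that q^17/8 |s - a| ≤ 1.
  · push Not at hclose
    have hlin : ∀ s ∈ Icc a b, q ^ 17 / 8 * |s - a| ≤ 1 := by
      intro s hs
      rw [abs_of_nonneg (by linarith [hs.1])]
      have h1 : q ^ 17 ≤ q ^ 24 := pow_le_pow_right₀ hq1 (by norm_num)
      calc q ^ 17 / 8 * (s - a) ≤ q ^ 24 * (b - a) := by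
            have := hs.1
            have := hs.2
            gcongr
            linarith
        _ ≤ 1 := by linarith
    refine ⟨a, left_mem_Icc.2 hab, fun s r s' hs hsr hrs hs' _ _ _ => ?_, Or.inr ⟨hea,
      fun s hs => (hlin s hs).trans (hclose s hs).le⟩⟩
    have h2 := h.norm_velocity_sub_le (c := q ^ 17 / 8) (d := 1) (t := a) (by positivity)
      (by positivity) one_pos hG hs hsr (hrs.trans hs') (fun x hx => by
        have hx' : x ∈ Icc a b := ⟨hs.trans hx.1, hx.2.trans (hrs.trans hs')⟩
        exact max_le (hclose x hx').le ((hlin x hx').trans (hclose x hx').le))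
    have h3 : 8 / (q ^ 17 / 8 * 1) ≤ 64 := by
      rw [div_le_iff₀ (by positivity)]
      linarith
    linarith

end IsRelativeMotion

end PlasmaCharge

/-! ### Short steps: isolation from all charges but one. -/

namespace PlasmaCharge

open MeasureTheory Set Filter Topology
open scoped ENNReal NNReal Interval RealInnerProductSpace

variable {K : Set Phase} {μ : Measure Phase} {X V : Phase → ℝ → Space}
variable {N : ℕ} {ξ η : Fin N → ℝ → Space} {a b A W δ T H Q q s : ℝ} {z : Phase}

/-- A time interval `[a, b]` which is short with respect to the maximal speed `Q`. -/
structure IsShortStep (a b H Q T : ℝ) (K : Set Phase) (ξ η : Fin N → ℝ → Space)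
    (X V : Phase → ℝ → Space) : Prop where
  nonneg : 0 ≤ a
  le : a ≤ b
  le_end : b ≤ T
  one_le : 1 ≤ Q
  short : 12 * (H + 1) * (Q * (b - a)) ≤ 1
  speed : ∀ z ∈ K, ∀ t ∈ Icc a b, ‖V z t‖ ≤ 2 * Q
  rel_speed : ∀ z ∈ K, ∀ t ∈ Icc a b, ∀ α, ‖V z t - η α t‖ ≤ 2 * Q
  charge_speed : ∀ t ∈ Icc a b, ∀ α, ‖η α t‖ ≤ Q

theorem IsShortStep.subset (hs : IsShortStep a b H Q T K ξ η X V) : Icc a b ⊆ Icc 0 T :=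
  Icc_subset_Icc hs.nonneg hs.le_end

/-- The description of the motion of a particle during a short step: the particle stays away from
all the charges other than `α`, its velocity varies little before and after the time `t` except
close to `α`, and either it is slow and stays away from `α`, or it is fast and moves away from its
position at the time `t`. -/
structure IsChargePassage (a b H q : ℝ) (ξ : Fin N → ℝ → Space) (x v : ℝ → Space) (α : Fin N)
    (t : ℝ) : Prop where
  other : ∀ β ≠ α, ∀ s ∈ Icc a b, 1 ≤ 4 * (H + 1) * ‖x s - ξ β s‖
  vel : ∀ s r s', a ≤ s → s ≤ r → r ≤ s' → s' ≤ b → (s' ≤ t ∨ t ≤ s) →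
    (2 * q ^ 34)⁻¹ ≤ ‖x s - ξ α s‖ → (2 * q ^ 34)⁻¹ ≤ ‖x s' - ξ α s'‖ → ‖v r - v s‖ ≤ q ^ 18 / 10
  slow_or_fast : (∀ s ∈ Icc a b, ‖v s‖ ≤ q ^ 18 ∧ (q ^ 34)⁻¹ ≤ ‖x s - ξ α s‖) ∨
    (q ^ 34 / 16 ≤ ‖v a‖ ^ 2 / 2 + ∑ β, ‖x a - ξ β a‖⁻¹ ∧
      ∀ s ∈ Icc a b, q ^ 17 / 8 * |s - t| ≤ ‖x s - ξ α s‖)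

/-- The acceleration of a particle relative to the charge `α`, without the repulsion of `α`. -/
noncomputable def perturbation (μ : Measure Phase) (ξ : Fin N → ℝ → Space) (X : Phase → ℝ → Space)
    (α : Fin N) (z : Phase) (s : ℝ) : Space :=
  lagrangianField μ X s (X z s) - lagrangianField μ X s (ξ α s) +
    ∑ β ∈ Finset.univ.erase α, (coulomb (X z s - ξ β s) - coulomb (ξ α s - ξ β s))

theorem norm_perturbation_le (α : Fin N) (z : Phase) (s : ℝ) :
    ‖perturbation μ ξ X α z s‖ ≤ ‖lagrangianField μ X s (X z s)‖ + ‖lagrangianField μ X s (ξ α s)‖ +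
      (∑ β ∈ Finset.univ.erase α, (‖X z s - ξ β s‖⁻¹) ^ 2 +
        ∑ β ∈ Finset.univ.erase α, (‖ξ α s - ξ β s‖⁻¹) ^ 2) := by
  refine (norm_add_le _ _).trans (add_le_add (norm_sub_le _ _) ?_)
  rw [← Finset.sum_add_distrib]
  refine norm_sum_le_of_le _ fun β _ => (norm_sub_le _ _).trans ?_
  rw [norm_coulomb, norm_coulomb, inv_pow, inv_pow]

theorem sum_sq_le_sq_of_sum_le {ι : Type*} (S : Finset ι) {f : ι → ℝ} {B : ℝ}
    (hf : ∀ i ∈ S, 0 ≤ f i) (h : ∑ i ∈ S, f i ≤ B) : ∑ i ∈ S, f i ^ 2 ≤ B ^ 2 :=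
  (Finset.sum_sq_le_sq_sum_of_nonneg hf).trans (pow_le_pow_left₀ (Finset.sum_nonneg hf) h 2)

namespace HasEnergyBound

theorem sum_inv_dist_erase_le (hE : HasEnergyBound H T μ ξ η X V) (ht : s ∈ Icc 0 T) (α : Fin N) :
    ∑ β ∈ Finset.univ.erase α, ‖ξ α s - ξ β s‖⁻¹ ≤ H := by
  rw [Finset.sum_erase _ (by simp)]
  exact hE.charge_dist s ht α

theorem one_le_charge_dist (hE : HasEnergyBound H T μ ξ η X V) (ht : s ∈ Icc 0 T) {α β : Fin N}
    (hne : ξ α s ≠ ξ β s) : 1 ≤ (H + 1) * ‖ξ α s - ξ β s‖ := by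
  have h1 : 0 < ‖ξ α s - ξ β s‖ := norm_pos_iff.2 (sub_ne_zero.2 hne)
  have h2 : ‖ξ α s - ξ β s‖⁻¹ ≤ H :=
    (Finset.single_le_sum (f := fun β => ‖ξ α s - ξ β s‖⁻¹) (fun β _ => by positivity)
      (Finset.mem_univ β)).trans (hE.charge_dist s ht α)
  rw [inv_le_iff_one_le_mul₀ h1] at h2
  linarith

end HasEnergyBound

namespace IsLagrangian

theorem isRelativeMotion (h : IsLagrangian T A W δ K μ ξ η X V) (hz : z ∈ K) (α : Fin N)
    (ha : 0 ≤ a) (hab : a ≤ b) (hb : b ≤ T) :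
    IsRelativeMotion a b (fun s => X z s - ξ α s) (fun s => V z s - η α s)
      (perturbation μ ξ X α z) where
  le := hab
  ne_zero s hs := h.sub_ne_zero hz (Icc_subset_Icc ha hb hs) α
  pos s hs := ((h.pos z hz s (Icc_subset_Icc ha hb hs)).sub
    (h.charge_pos α s (Icc_subset_Icc ha hb hs))).mono (Icc_subset_Icc ha hb)
  vel s hs := by
    refine (((h.vel z hz s (Icc_subset_Icc ha hb hs)).sub
      (h.charge_vel α s (Icc_subset_Icc ha hb hs))).mono (Icc_subset_Icc ha hb)).congr_deriv ?_
    rw [perturbation, Finset.sum_sub_distrib,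
      ← Finset.add_sum_erase _ (fun α => coulomb (X z s - ξ α s)) (Finset.mem_univ α)]
    abel

/-- During a short step, a particle stays away from all the charges but the one that was closest
initially. -/
theorem exists_nearest (h : IsLagrangian T A W δ K μ ξ η X V) (hE : HasEnergyBound H T μ ξ η X V)
    (hN : 1 ≤ N) (hS : IsShortStep a b H Q T K ξ η X V) (hz : z ∈ K) :
    ∃ α, ∀ β ≠ α, ∀ s ∈ Icc a b, ‖ξ α a - ξ β a‖ / 4 ≤ ‖X z s - ξ β s‖ := by
  have : Nonempty (Fin N) := ⟨⟨0, hN⟩⟩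
  obtain ⟨α, hα⟩ := Finite.exists_min fun α => ‖X z a - ξ α a‖
  refine ⟨α, fun β hβ s hs => ?_⟩
  have haI : a ∈ Icc a b := left_mem_Icc.2 hS.le
  have hH := hE.nonneg
  have h1 := hE.one_le_charge_dist (hS.subset haI) (h.charge_ne a (hS.subset haI) α β hβ.symm)
  have h2 := hα β
  have h3 := norm_sub_le_norm_sub_add_norm_sub (ξ α a) (X z a) (ξ β a)
  rw [norm_sub_rev (ξ α a) (X z a)] at h3
  have hX : ‖X z s - X z a‖ ≤ 2 * Q * ‖s - a‖ :=
    Convex.norm_image_sub_le_of_norm_hasDerivWithin_le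
      (fun r hr => (h.pos z hz r (hS.subset hr)).mono hS.subset) (hS.speed z hz) (convex_Icc a b)
      haI hs
  have hξ : ‖ξ β s - ξ β a‖ ≤ Q * ‖s - a‖ :=
    Convex.norm_image_sub_le_of_norm_hasDerivWithin_le
      (fun r hr => (h.charge_pos β r (hS.subset hr)).mono hS.subset)
      (fun r hr => hS.charge_speed r hr β) (convex_Icc a b) haI hs
  have hsa : Q * ‖s - a‖ ≤ Q * (b - a) := by
    have := hS.one_le
    rw [Real.norm_eq_abs, abs_of_nonneg (by linarith [hs.1])]
    gcongr
    exact hs.2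
  have h4 : ‖X z a - ξ β a‖ ≤ ‖X z s - ξ β s‖ + (‖X z s - X z a‖ + ‖ξ β s - ξ β a‖) := by
    have e : X z a - ξ β a = (X z s - ξ β s) - ((X z s - X z a) - (ξ β s - ξ β a)) := by abel
    rw [e]
    exact (norm_sub_le _ _).trans (add_le_add_right (norm_sub_le _ _) _)
  -- At time a the particle is at distance at least ‖ξ α a - ξ β a‖/2 from β. The particle and β
  -- together move by at most 3Q(b - a), a quarter of the distance between the charges, which is at
  -- least 1/(H + 1) by the energy.
  have h5 : 12 * (H + 1) * (Q * (b - a)) ≤ (H + 1) * ‖ξ α a - ξ β a‖ := hS.short.trans h1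
  have h6 : 12 * (Q * (b - a)) ≤ ‖ξ α a - ξ β a‖ := by
    have : (H + 1) * (12 * (Q * (b - a))) ≤ (H + 1) * ‖ξ α a - ξ β a‖ := by linarith
    exact le_of_mul_le_mul_left this (by linarith)
  linarith

theorem one_le_dist_of_nearest (h : IsLagrangian T A W δ K μ ξ η X V)
    (hE : HasEnergyBound H T μ ξ η X V) (ha : a ∈ Icc 0 T) {α β : Fin N} (hβ : β ≠ α)
    (hd : ‖ξ α a - ξ β a‖ / 4 ≤ ‖X z s - ξ β s‖) : 1 ≤ 4 * (H + 1) * ‖X z s - ξ β s‖ := by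
  have h1 := hE.one_le_charge_dist ha (h.charge_ne a ha α β hβ.symm)
  have hH := hE.nonneg
  have : (H + 1) * (‖ξ α a - ξ β a‖ / 4) ≤ (H + 1) * ‖X z s - ξ β s‖ := by gcongr
  linarith

/-- The distances to the other charges are compared with the distances between charges, whose
inverses have sum at most H for a fixed α. The inverse distances to the particle thus have sum at
most 4H, and sums of squares are at most (4H)² + H² = 17H², with no dependence on N. -/
theorem norm_perturbation_le_of_nearest (h : IsLagrangian T A W δ K μ ξ η X V)
    (hE : HasEnergyBound H T μ ξ η X V) (ha : a ∈ Icc 0 T) (hs : s ∈ Icc 0 T) {α : Fin N}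
    (hd : ∀ β ≠ α, ‖ξ α a - ξ β a‖ / 4 ≤ ‖X z s - ξ β s‖) :
    ‖perturbation μ ξ X α z s‖ ≤ ‖lagrangianField μ X s (X z s)‖ +
      ‖lagrangianField μ X s (ξ α s)‖ + 17 * H ^ 2 := by
  have h1 := sum_sq_le_sq_of_sum_le (Finset.univ.erase α) (f := fun β => ‖ξ α s - ξ β s‖⁻¹)
    (fun β _ => by positivity) (hE.sum_inv_dist_erase_le hs α)
  have h2 : ∑ β ∈ Finset.univ.erase α, ‖X z s - ξ β s‖⁻¹ ≤ 4 * H := by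
    refine le_trans (Finset.sum_le_sum fun β hβ => ?_) (by
      rw [← Finset.mul_sum]
      exact mul_le_mul_of_nonneg_left (hE.sum_inv_dist_erase_le ha α) (by norm_num))
    have hβ' := Finset.ne_of_mem_erase hβ
    have h3 : 0 < ‖ξ α a - ξ β a‖ := norm_pos_iff.2 (_root_.sub_ne_zero.2
      (h.charge_ne a ha α β hβ'.symm))
    refine (inv_anti₀ (by positivity) (hd β hβ')).trans (le_of_eq ?_)
    field_simp
  have h3 := sum_sq_le_sq_of_sum_le (Finset.univ.erase α) (f := fun β => ‖X z s - ξ β s‖⁻¹)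
    (fun β _ => by positivity) h2
  have h4 := norm_perturbation_le (μ := μ) (ξ := ξ) (X := X) α z s
  linarith

/-- The pointwise bound with p = 2q^8, for which p³ = 8q^24 exceeds the speeds and p⁴ = 16q^32. -/
theorem norm_field_le_pow (h : IsLagrangian T A W δ K μ ξ η X V)
    (hE : HasEnergyBound H T μ ξ η X V) (hs : s ∈ Icc 0 T) (hq : 0 < q)
    (hV : ∀ z ∈ K, ‖V z s‖ ≤ 2 * q ^ 24) (x : Space) :
    fieldMajorant μ X s x ≤ ENNReal.ofReal (16 * fieldConst A H * q ^ 32) ∧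
    ‖lagrangianField μ X s x‖ ≤ 16 * fieldConst A H * q ^ 32 := by
  have h1 : fieldMajorant μ X s x ≤ ENNReal.ofReal (16 * fieldConst A H * q ^ 32) := by
    refine (h.fieldMajorant_le hE hs x (p := 2 * q ^ 8) (by positivity)
      fun z hz => (hV z hz).trans ?_).trans (ENNReal.ofReal_le_ofReal (le_of_eq (by ring)))
    have : 0 < q ^ 24 := by positivity
    have e : (2 * q ^ 8) ^ 3 = 8 * q ^ 24 := by ring
    rw [e]
    linarith
  refine ⟨h1, ?_⟩
  have h2 := (enorm_field_le (μ := μ) (X := X) (t := s) x).trans h1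
  rw [← ofReal_norm] at h2
  have := fieldConst_nonneg h.density_nonneg hE.nonneg
  exact (ENNReal.ofReal_le_ofReal_iff (by positivity)).1 h2

/-- The description of the motion of a particle during a short step, when the maximal speed `q ^ 24`
is large. -/
theorem exists_passage (h : IsLagrangian T A W δ K μ ξ η X V) (hE : HasEnergyBound H T μ ξ η X V)
    (hN : 1 ≤ N) (hS : IsShortStep a b H (q ^ 24) T K ξ η X V) (hq : 10 ^ 4 ≤ q)
    (hq' : 32 * fieldConst A H + 17 * H ^ 2 + 4 * (H + 1) ≤ q) (hz : z ∈ K) :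
    ∃ α t, IsChargePassage a b H q ξ (X z) (V z) α t := by
  have hq0 : 0 < q := by linarith
  have hq1 : 1 ≤ q := by linarith
  have haI : a ∈ Icc a b := left_mem_Icc.2 hS.le
  have hH := hE.nonneg
  have hC := fieldConst_nonneg h.density_nonneg hE.nonneg
  -- The energy keeps the speeds of the charges below q, much less than q^17; absolute and relative
  -- velocities are then interchangeable up to the constants.
  have hη : ∀ s ∈ Icc a b, ∀ α, ‖η α s‖ ≤ q := by
    intro s hs α
    have h1 := hE.charge_speed s (hS.subset hs) α
    exact abs_le_of_sq_le_sq' (by nlinarith) hq0.le |>.2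
  obtain ⟨α, hα⟩ := h.exists_nearest hE hN hS hz
  have hM := h.isRelativeMotion hz α hS.nonneg hS.le hS.le_end
  have hG : ∀ s ∈ Icc a b, ‖perturbation μ ξ X α z s‖ ≤ q ^ 33 := by
    intro s hs
    have h1 := h.norm_perturbation_le_of_nearest hE (hS.subset haI) (hS.subset hs)
      (fun β hβ => hα β hβ s hs)
    have hV : ∀ z ∈ K, ‖V z s‖ ≤ 2 * q ^ 24 := fun z hz => hS.speed z hz s hs
    have h2 := (h.norm_field_le_pow hE (hS.subset hs) hq0 hV (X z s)).2
    have h3 := (h.norm_field_le_pow hE (hS.subset hs) hq0 hV (ξ α s)).2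
    have h4 : 1 ≤ q ^ 32 := one_le_pow₀ hq1
    have h5 : (32 * fieldConst A H + 17 * H ^ 2) * q ^ 32 ≤ q * q ^ 32 := by
      gcongr
      linarith
    have h6 : 17 * H ^ 2 * 1 ≤ 17 * H ^ 2 * q ^ 32 := by gcongr
    have e : q ^ 33 = q * q ^ 32 := by ring
    rw [e]
    linarith
  have hl : 4 * (q ^ 24 * (b - a)) ≤ 1 := by
    have h1 := hS.short
    have h2 : 0 ≤ q ^ 24 * (b - a) := mul_nonneg (by positivity) (by linarith [hS.le])
    nlinarith
  obtain ⟨t, -, hvel, hsf⟩ := hM.exists_isPassage hq hl hG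
    (fun s hs => hS.rel_speed z hz s hs α)
  have h217 : 10 ^ 4 * q ≤ q ^ 17 := by
    calc 10 ^ 4 * q ≤ q * q := by gcongr
      _ = q ^ 2 := by ring
      _ ≤ q ^ 17 := pow_le_pow_right₀ hq1 (by norm_num)
  have h18 : 10 ^ 4 * q ^ 17 ≤ q ^ 18 := by
    rw [pow_succ q 17, mul_comm]; gcongr
  refine ⟨α, t, fun β hβ s hs => h.one_le_dist_of_nearest hE (hS.subset haI) hβ (hα β hβ s hs),
    fun s r s' hs hsr hrs hs' hside hd hd' => ?_, ?_⟩
  · have h1 := hvel s r s' hs hsr hrs hs' hside hd hd'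
    have h2 := hη s ⟨hs, hsr.trans (hrs.trans hs')⟩ α
    have h3 := hη r ⟨hs.trans hsr, hrs.trans hs'⟩ α
    have e : V z r - V z s = (V z r - η α r - (V z s - η α s)) + (η α r - η α s) := by abel
    rw [e]
    have h4 := norm_add_le (V z r - η α r - (V z s - η α s)) (η α r - η α s)
    have h5 := norm_sub_le (η α r) (η α s)
    linarith
  · rcases hsf with hsl | ⟨hf, hlin⟩
    · refine Or.inl fun s hs => ⟨?_, (hsl s hs).2⟩
      have h1 := (hsl s hs).1
      have h2 := hη s hs α
      have h3 := norm_sub_norm_le (V z s) (η α s)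
      linarith
    · refine Or.inr ⟨?_, hlin⟩
      have h1 := hη a haI α
      -- The relative energy is traded for the energy in the frame at rest, since the latter has
      -- integral at most H over the plasma.
      have h2 : ‖V z a - η α a‖ ^ 2 ≤ 2 * ‖V z a‖ ^ 2 + 2 * q ^ 2 := by
        have h3 := norm_sub_le (V z a) (η α a)
        calc ‖V z a - η α a‖ ^ 2 ≤ (‖V z a‖ + ‖η α a‖) ^ 2 := by gcongr
          _ ≤ 2 * ‖V z a‖ ^ 2 + 2 * ‖η α a‖ ^ 2 := by nlinarith [sq_nonneg (‖V z a‖ - ‖η α a‖)]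
          _ ≤ _ := by gcongr
      have h3 : ‖X z a - ξ α a‖⁻¹ ≤ ∑ β, ‖X z a - ξ β a‖⁻¹ :=
        Finset.single_le_sum (f := fun β => ‖X z a - ξ β a‖⁻¹) (fun β _ => by positivity)
          (Finset.mem_univ α)
      have h4 : 0 ≤ ‖X z a - ξ α a‖⁻¹ := by positivity
      have h5 : 16 * q ^ 2 ≤ q ^ 34 := by
        calc 16 * q ^ 2 ≤ q * q ^ 2 := by gcongr; linarith
          _ = q ^ 3 := by ring
          _ ≤ q ^ 34 := pow_le_pow_right₀ hq1 (by norm_num)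
      have h6 : 0 < q ^ 34 := by positivity
      simp only [one_div] at hf
      linarith

end IsLagrangian

end PlasmaCharge

/-! ### The field up to fast particles, and the exchange of integrals. -/

namespace PlasmaCharge

open MeasureTheory Set Filter Topology
open scoped ENNReal NNReal Interval RealInnerProductSpace

variable {K : Set Phase} {μ : Measure Phase} {X V : Phase → ℝ → Space}
variable {N : ℕ} {ξ η : Fin N → ℝ → Space} {a b A W δ T H Q q s : ℝ} {z : Phase}

namespace IsLagrangian

/-- For each label the trajectory is Lipschitz in time with constants independent of the label, so
continuity in the label upgrades to joint continuity. The joint measurability that follows is needed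
to exchange the time and label integrals. -/
theorem continuousOn_pos_vel (h : IsLagrangian T A W δ K μ ξ η X V) :
    ContinuousOn (fun p : ℝ × Phase => ((X p.2 p.1, V p.2 p.1) : Phase)) (Icc 0 T ×ˢ K) := by
  have hv := ballVolume_nonneg
  have hA := h.density_nonneg
  have hW := h.speed_nonneg
  have hlip : ∀ {f f' : ℝ → Space} {C : ℝ}, 0 ≤ C →
      (∀ t ∈ Icc 0 T, HasDerivWithinAt f (f' t) (Icc 0 T) t) → (∀ t ∈ Icc 0 T, ‖f' t‖ ≤ C) →
      LipschitzOnWith C.toNNReal f (Icc 0 T) := by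
    intro f f' C hC hf hb
    refine Convex.lipschitzOnWith_of_nnnorm_hasDerivWithin_le (convex_Icc 0 T) hf fun t ht => ?_
    rw [← NNReal.coe_le_coe, coe_nnnorm, Real.coe_toNNReal _ hC]
    exact hb t ht
  refine ContinuousOn.prodMk (continuousOn_prod_of_continuousOn_lipschitzOnWith
      (fun p : ℝ × Phase => X p.2 p.1) W.toNNReal (fun t ht => h.continuousOn_pos ht)
      fun z hz => hlip hW (h.pos z hz) (h.speed_le z hz))
    (continuousOn_prod_of_continuousOn_lipschitzOnWith (fun p : ℝ × Phase => V p.2 p.1)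
      (A * (3 * ballVolume) * (ballVolume * W ^ 3) + 1 + ∑ _α : Fin N, (δ ^ 2)⁻¹).toNNReal
      (fun t ht => h.continuousOn_vel ht) fun z hz => hlip (by positivity) (h.vel z hz)
        fun t ht => (norm_add_le _ _).trans (add_le_add (h.norm_field_le ht _) ?_))
  refine norm_sum_le_of_le _ fun α _ => ?_
  rw [norm_coulomb]
  have := h.dist_pos
  gcongr
  exact h.away z hz t ht α

theorem aemeasurable_pos_vel (h : IsLagrangian T A W δ K μ ξ η X V) (hab : Icc a b ⊆ Icc 0 T) :
    AEMeasurable (fun p : ℝ × Phase => ((X p.2 p.1, V p.2 p.1) : Phase))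
      ((volume.restrict (Icc a b)).prod μ) := by
  have := h.prob
  have e : (volume.restrict (Icc a b)).prod μ =
      ((volume : Measure ℝ).prod μ).restrict (Icc a b ×ˢ K) := by
    rw [← Measure.prod_restrict, Measure.restrict_eq_self_of_ae_mem (s := K) h.ae_mem]
  rw [e]
  exact (h.continuousOn_pos_vel.mono (prod_mono_left hab)).aemeasurable
    (measurableSet_Icc.prod h.compact.measurableSet)

end IsLagrangian

/-- The inverse square distance between a test particle at the position `x` with the velocity `w` and
a particle at `(y, v)`, where it is neither absolutely nor relatively slow. -/
noncomputable def fastPair (q : ℝ) (p : Phase × Phase) : ℝ≥0∞ :=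
  {p : Phase × Phase | q ^ 18 < ‖p.2.2‖ ∧ q ^ 18 < ‖p.2.2 - p.1.2‖}.indicator
    (fun p => ENNReal.ofReal (((max (q ^ 48)⁻¹ ‖p.1.1 - p.2.1‖) ^ 2)⁻¹)) p

theorem measurable_fastPair (q : ℝ) : Measurable (fastPair q) := by
  refine Measurable.indicator (by fun_prop) ?_
  exact (measurableSet_lt (f := fun _ => q ^ 18) (g := fun p : Phase × Phase => ‖p.2.2‖)
    (by fun_prop) (by fun_prop)).inter (measurableSet_lt (f := fun _ => q ^ 18)
    (g := fun p : Phase × Phase => ‖p.2.2 - p.1.2‖) (by fun_prop) (by fun_prop))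

namespace IsLagrangian

/-- The field at a given time, up to the contribution of the fast particles. -/
theorem fieldMajorant_le_add_fastPair (h : IsLagrangian T A W δ K μ ξ η X V)
    (hE : HasEnergyBound H T μ ξ η X V) (hs : s ∈ Icc 0 T) (hq : 0 < q)
    (hV : ∀ z ∈ K, ‖V z s‖ ≤ 2 * q ^ 24) (x w : Space) :
    fieldMajorant μ X s x ≤ ENNReal.ofReal (6 * fieldConst A H * q ^ 24) +
      ∫⁻ z, fastPair q ((x, w), (X z s, V z s)) ∂μ := by
  have hM := fieldConst_nonneg h.density_nonneg hE.nonneg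
  have hZ := h.aemeasurable_phase hs
  have hA := h.density_nonneg
  have hH := hE.nonneg
  -- The function `f1` is used for absolutely slow (b = 0) and relatively slow (b = w) particles:
  -- the velocity ball has radius (q^6)³ = q^18 and its field is of order (q^6)⁴ = q^24. The near
  -- particles `f2` give R P³ = q^(-48) (2q^24)³, again of order q^24.
  set f1 : Space → Phase → ℝ≥0∞ := fun b => {w : Phase | ‖w.2 - b‖ ≤ (q ^ 6) ^ 3}.indicator
      (fun w => ENNReal.ofReal ((‖x - w.1‖ ^ 2)⁻¹)) with hf1
  set f2 : Phase → ℝ≥0∞ := {w : Phase | ‖w.2 - 0‖ ≤ 2 * q ^ 24 ∧ ‖x - w.1‖ < (q ^ 48)⁻¹}.indicator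
      (fun w => ENNReal.ofReal ((‖x - w.1‖ ^ 2)⁻¹)) with hf2
  have hm1 : ∀ b, Measurable (f1 b) := fun b => Measurable.indicator (by fun_prop)
    (measurableSet_le (f := fun w : Phase => ‖w.2 - b‖) (g := fun _ => (q ^ 6) ^ 3) (by fun_prop)
      (by fun_prop))
  have hm2 : Measurable f2 := Measurable.indicator (by fun_prop)
    ((measurableSet_le (f := fun w : Phase => ‖w.2 - 0‖) (g := fun _ => 2 * q ^ 24) (by fun_prop)
      (by fun_prop)).inter (measurableSet_lt (f := fun w : Phase => ‖x - w.1‖)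
      (g := fun _ => (q ^ 48)⁻¹) (by fun_prop) (by fun_prop)))
  have key : ∀ u : Phase, ‖u.2‖ ≤ 2 * q ^ 24 → ENNReal.ofReal ((‖x - u.1‖ ^ 2)⁻¹) ≤
      f1 0 u + (f1 w u + (f2 u + fastPair q ((x, w), u))) := by
    intro u hu
    have e18 : (q ^ 6) ^ 3 = q ^ 18 := by ring
    by_cases h1 : ‖u.2‖ ≤ q ^ 18
    · have : f1 0 u = ENNReal.ofReal ((‖x - u.1‖ ^ 2)⁻¹) := by simp [hf1, e18, h1]
      rw [this]
      exact le_self_add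
    refine le_trans ?_ le_add_self
    by_cases h2 : ‖u.2 - w‖ ≤ q ^ 18
    · have : f1 w u = ENNReal.ofReal ((‖x - u.1‖ ^ 2)⁻¹) := by simp [hf1, e18, h2]
      rw [this]
      exact le_self_add
    refine le_trans ?_ le_add_self
    by_cases h3 : ‖x - u.1‖ < (q ^ 48)⁻¹
    · have : f2 u = ENNReal.ofReal ((‖x - u.1‖ ^ 2)⁻¹) := by simp [hf2, hu, h3]
      rw [this]
      exact le_self_add
    refine le_trans (le_of_eq ?_) le_add_self
    rw [fastPair, indicator_of_mem (by exact ⟨not_le.1 h1, not_le.1 h2⟩), max_eq_right (not_lt.1 h3)]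
  have hi1 : ∀ b, ∫⁻ z, f1 b (X z s, V z s) ∂μ ≤ ENNReal.ofReal (fieldConst A H * q ^ 24) := by
    intro b
    refine (h.lintegral_velocity_ball_le hE hs x b (p := q ^ 6) (by positivity)).trans_eq ?_
    congr 2
    ring
  have hi2 : ∫⁻ z, f2 (X z s, V z s) ∂μ ≤ ENNReal.ofReal (4 * fieldConst A H * q ^ 24) := by
    refine (lintegral_near_le hZ h.density_nonneg (h.map_le s hs) x 0 (by positivity) _).trans
      (ENNReal.ofReal_le_ofReal ?_)
    have e : A * (3 * ballVolume * (q ^ 48)⁻¹) * (ballVolume * (2 * q ^ 24) ^ 3) =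
        24 * A * ballVolume ^ 2 * q ^ 24 := by
      field_simp
      ring
    rw [e, fieldConst]
    refine mul_le_mul_of_nonneg_right ?_ (by positivity)
    linarith
  calc fieldMajorant μ X s x ≤ ∫⁻ z, (f1 0 (X z s, V z s) + (f1 w (X z s, V z s) +
        (f2 (X z s, V z s) + fastPair q ((x, w), (X z s, V z s))))) ∂μ := by
        refine lintegral_mono_ae ?_
        filter_upwards [h.ae_mem] with z hz
        exact key (X z s, V z s) (hV z hz)
    _ = ∫⁻ z, f1 0 (X z s, V z s) ∂μ + (∫⁻ z, f1 w (X z s, V z s) ∂μ +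
        (∫⁻ z, f2 (X z s, V z s) ∂μ + ∫⁻ z, fastPair q ((x, w), (X z s, V z s)) ∂μ)) := by
        rw [lintegral_add_left' (f := fun z => f1 0 (X z s, V z s))
            ((hm1 0).comp_aemeasurable hZ),
          lintegral_add_left' (f := fun z => f1 w (X z s, V z s)) ((hm1 w).comp_aemeasurable hZ),
          lintegral_add_left' (f := fun z => f2 (X z s, V z s)) (hm2.comp_aemeasurable hZ)]
    _ ≤ ENNReal.ofReal (fieldConst A H * q ^ 24) + (ENNReal.ofReal (fieldConst A H * q ^ 24) +
        (ENNReal.ofReal (4 * fieldConst A H * q ^ 24) +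
          ∫⁻ z, fastPair q ((x, w), (X z s, V z s)) ∂μ)) := by
        gcongr
        · exact hi1 0
        · exact hi1 w
    _ = _ := by
        rw [← add_assoc, ← add_assoc, ← ENNReal.ofReal_add (by positivity) (by positivity),
          ← ENNReal.ofReal_add (by positivity) (by positivity)]
        congr 2
        ring

/-- The time integral of the field along a curve, except at the times of a small set. -/
theorem lintegral_fieldMajorant_le (h : IsLagrangian T A W δ K μ ξ η X V)
    (hE : HasEnergyBound H T μ ξ η X V) (hS : IsShortStep a b H (q ^ 24) T K ξ η X V) (hq : 0 < q)
    {x w : ℝ → Space} (hx : ContinuousOn x (Icc a b)) (hw : ContinuousOn w (Icc a b)) {S : Set ℝ}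
    (hSm : MeasurableSet S) {e : ℝ} (he : 0 ≤ e) (hSe : volume S ≤ ENNReal.ofReal e)
    (hfast : ∀ z ∈ K, ∫⁻ s in Icc a b, Sᶜ.indicator
      (fun s => fastPair q ((x s, w s), (X z s, V z s))) s ≤
        ENNReal.ofReal (‖V z a‖ ^ 2 / 2 + ∑ β, ‖X z a - ξ β a‖⁻¹)) :
    ∫⁻ s in Icc a b, fieldMajorant μ X s (x s) ≤
      ENNReal.ofReal (16 * fieldConst A H * q ^ 32 * e + 6 * fieldConst A H + H) := by
  have := h.prob
  have hM := fieldConst_nonneg h.density_nonneg hE.nonneg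
  have hH := hE.nonneg
  have hl : q ^ 24 * (b - a) ≤ 1 := by
    have h1 := hS.short
    have h2 : 0 ≤ q ^ 24 * (b - a) := mul_nonneg (by positivity) (by linarith [hS.le])
    nlinarith
  have hl0 : 0 ≤ b - a := by linarith [hS.le]
  -- Times in S are left to the pointwise bound, so that the fast particles only need control
  -- outside S.
  set F : ℝ × Phase → ℝ≥0∞ := fun p => Sᶜ.indicator
    (fun s => fastPair q ((x s, w s), (X p.2 s, V p.2 s))) p.1 with hF
  have hFm : AEMeasurable F ((volume.restrict (Icc a b)).prod μ) := by
    have e1 : F = (Sᶜ ×ˢ univ).indicator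
        (fun p => fastPair q ((x p.1, w p.1), (X p.2 p.1, V p.2 p.1))) := by
      ext ⟨s, z⟩
      by_cases hs : s ∈ S <;> simp [hF, indicator, hs]
    rw [e1]
    refine AEMeasurable.indicator ?_ (hSm.compl.prod MeasurableSet.univ)
    refine (measurable_fastPair q).comp_aemeasurable (AEMeasurable.prodMk
      (f := fun p : ℝ × Phase => (x p.1, w p.1)) ?_ (h.aemeasurable_pos_vel hS.subset))
    have h1 : AEMeasurable (fun s => (x s, w s)) (volume.restrict (Icc a b)) :=
      (hx.prodMk hw).aemeasurable measurableSet_Icc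
    exact h1.comp_fst
  have hpt : ∀ s ∈ Icc a b, fieldMajorant μ X s (x s) ≤
      S.indicator (fun _ => ENNReal.ofReal (16 * fieldConst A H * q ^ 32)) s +
        (ENNReal.ofReal (6 * fieldConst A H * q ^ 24) + ∫⁻ z, F (s, z) ∂μ) := by
    intro s hs
    have hV : ∀ z ∈ K, ‖V z s‖ ≤ 2 * q ^ 24 := fun z hz => hS.speed z hz s hs
    by_cases h1 : s ∈ S
    · rw [indicator_of_mem h1]
      exact (h.norm_field_le_pow hE (hS.subset hs) hq hV (x s)).1.trans le_self_add
    · refine le_trans ?_ le_add_self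
      simp only [hF, indicator_of_mem (mem_compl h1)]
      exact h.fieldMajorant_le_add_fastPair hE (hS.subset hs) hq hV (x s) (w s)
  -- After the exchange each fast particle pays its time integral with its energy at time a, and the
  -- energies integrate to at most H.
  have hswap : ∫⁻ s in Icc a b, ∫⁻ z, F (s, z) ∂μ ≤ ENNReal.ofReal H := by
    rw [lintegral_lintegral_swap (f := fun s z => F (s, z)) hFm]
    refine le_trans (lintegral_mono_ae ?_) (hE.plasma a (hS.subset (left_mem_Icc.2 hS.le)))
    filter_upwards [h.ae_mem] with z hz
    exact hfast z hz
  calc ∫⁻ s in Icc a b, fieldMajorant μ X s (x s)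
      ≤ ∫⁻ s in Icc a b, (S.indicator (fun _ => ENNReal.ofReal (16 * fieldConst A H * q ^ 32)) s +
        (ENNReal.ofReal (6 * fieldConst A H * q ^ 24) + ∫⁻ z, F (s, z) ∂μ)) :=
        setLIntegral_mono' measurableSet_Icc hpt
    _ = (∫⁻ s in Icc a b, S.indicator (fun _ => ENNReal.ofReal (16 * fieldConst A H * q ^ 32)) s) +
        (ENNReal.ofReal (6 * fieldConst A H * q ^ 24) * ENNReal.ofReal (b - a) +
          ∫⁻ s in Icc a b, ∫⁻ z, F (s, z) ∂μ) := by
        rw [lintegral_add_left (measurable_const.indicator hSm), lintegral_add_left measurable_const,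
          setLIntegral_const, Real.volume_Icc]
    _ ≤ ENNReal.ofReal (16 * fieldConst A H * q ^ 32) * ENNReal.ofReal e +
        (ENNReal.ofReal (6 * fieldConst A H) + ENNReal.ofReal H) := by
        refine add_le_add ?_ (add_le_add ?_ hswap)
        · refine (setLIntegral_le_lintegral _ _).trans ?_
          rw [lintegral_indicator hSm, setLIntegral_const]
          gcongr
        · rw [← ENNReal.ofReal_mul (by positivity)]
          apply ENNReal.ofReal_le_ofReal
          calc 6 * fieldConst A H * q ^ 24 * (b - a) = 6 * fieldConst A H * (q ^ 24 * (b - a)) := by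
                ring
            _ ≤ 6 * fieldConst A H * 1 := by gcongr
            _ = _ := mul_one _
    _ = _ := by
        rw [← ENNReal.ofReal_mul (by positivity), ← ENNReal.ofReal_add (by positivity) hH,
          ← ENNReal.ofReal_add (by positivity) (by positivity), add_assoc]

end IsLagrangian

end PlasmaCharge

/-! ### Time integral of the force of one fast particle. -/

namespace PlasmaCharge

open MeasureTheory Set Filter Topology
open scoped ENNReal NNReal Interval RealInnerProductSpace

variable {K : Set Phase} {μ : Measure Phase} {X V : Phase → ℝ → Space}
variable {N : ℕ} {ξ η : Fin N → ℝ → Space} {a b A W δ T H Q q s : ℝ} {z : Phase}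
variable {x v x' v' : ℝ → Space} {α α' β : Fin N} {t t' : ℝ}

/-- The times before (`true`) or after (`false`) the time `t`. -/
def timeSide (t : ℝ) : Bool → Set ℝ
  | true => Iic t
  | false => Ici t

theorem exists_mem_timeSide (t s : ℝ) : ∃ i, s ∈ timeSide t i := by
  rcases le_total s t with h | h
  · exact ⟨true, h⟩
  · exact ⟨false, h⟩

theorem timeSide_or {i : Bool} {s s' : ℝ} (hs : s ∈ timeSide t i) (hs' : s' ∈ timeSide t i) :
    s' ≤ t ∨ t ≤ s := by
  cases i
  · exact Or.inr hs
  · exact Or.inl hs'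

theorem fastPair_le_of_le {q r : ℝ} {x y : Space} (w v : Space) (hr : 0 < r)
    (h : r ≤ max (q ^ 48)⁻¹ ‖x - y‖) :
    fastPair q ((x, w), (y, v)) ≤ ENNReal.ofReal ((r ^ 2)⁻¹) :=
  (indicator_le_self _ _ ((x, w), (y, v))).trans (ENNReal.ofReal_le_ofReal (by gcongr))

theorem fastPair_eq_zero {q : ℝ} {v : Space} (x w y : Space) (h : ‖v‖ ≤ q ^ 18) :
    fastPair q ((x, w), (y, v)) = 0 :=
  indicator_of_notMem (fun h' => absurd h'.1 (not_lt.2 h)) _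

theorem fastPair_eq_zero_of_sub {q : ℝ} {v w : Space} (x y : Space) (h : ‖v - w‖ ≤ q ^ 18) :
    fastPair q ((x, w), (y, v)) = 0 :=
  indicator_of_notMem (fun h' => absurd h'.2 (not_lt.2 h)) _

namespace IsChargePassage

theorem inv_le_dist_other (h : IsChargePassage a b H q ξ x v α t) (hq : 0 < q)
    (hq' : 4 * (H + 1) ≤ q) (hβ : β ≠ α) (hs : s ∈ Icc a b) : q⁻¹ ≤ ‖x s - ξ β s‖ := by
  rw [inv_le_iff_one_le_mul₀ hq, mul_comm]
  refine (h.other β hβ s hs).trans ?_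
  gcongr

/-- On the charge α of its own passage, a fast particle escapes linearly at speed q^17/8, and the
truncation at q^(-48) gives 64q^31, below q^34/16. From any other charge it stays at distance at
least 1/q. A slow particle contributes nothing. -/
theorem lintegral_fastPair_charge_le (h : IsChargePassage a b H q ξ x v α t) (hq : 10 ^ 4 ≤ q)
    (hq' : 4 * (H + 1) ≤ q) (hab : b - a ≤ 1) (β : Fin N) :
    ∫⁻ s in Icc a b, fastPair q ((ξ β s, η β s), (x s, v s)) ≤
      ENNReal.ofReal (‖v a‖ ^ 2 / 2 + ∑ β, ‖x a - ξ β a‖⁻¹) := by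
  have hq0 : 0 < q := by linarith
  have hq1 : 1 ≤ q := by linarith
  rcases h.slow_or_fast with hsl | ⟨hf, hlin⟩
  · refine le_of_eq_of_le ?_ zero_le
    rw [setLIntegral_congr_fun (g := fun _ => 0) measurableSet_Icc
      (fun s hs => fastPair_eq_zero _ _ _ (hsl s hs).1), lintegral_zero]
  refine le_trans ?_ (ENNReal.ofReal_le_ofReal hf)
  by_cases hβ : β = α
  · subst hβ
    calc _ ≤ ∫⁻ s in Icc a b,
          ENNReal.ofReal (((max (q ^ 48)⁻¹ (q ^ 17 / 8 * |s - t|)) ^ 2)⁻¹) := by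
          refine setLIntegral_mono' measurableSet_Icc fun s hs => ?_
          have h1 : q ^ 17 / 8 * |s - t| ≤ ‖ξ β s - x s‖ := by
            rw [norm_sub_rev]
            exact hlin s hs
          have h2 : 0 < max (q ^ 48)⁻¹ (q ^ 17 / 8 * |s - t|) :=
            lt_max_of_lt_left (by positivity)
          exact fastPair_le_of_le _ _ h2 (max_le_max_left _ h1)
      _ ≤ ENNReal.ofReal (8 / (q ^ 17 / 8 * (q ^ 48)⁻¹)) := (setLIntegral_le_lintegral _ _).trans
          (lintegral_inv_max_sq_le (by positivity) (by positivity) t)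
      _ ≤ _ := by
          apply ENNReal.ofReal_le_ofReal
          have e : 8 / (q ^ 17 / 8 * (q ^ 48)⁻¹) = 64 * q ^ 31 := by
            field_simp
            ring
          have e' : q ^ 34 = q ^ 3 * q ^ 31 := by ring
          have h3 : q * 1 ≤ q * q ^ 2 := by gcongr; exact one_le_pow₀ hq1
          have h4 : 10 ^ 4 * q ^ 31 ≤ q ^ 3 * q ^ 31 := by gcongr; linarith
          have h5 : 0 < q ^ 31 := by positivity
          rw [e, e']
          linarith
  · calc _ ≤ ∫⁻ s in Icc a b, ENNReal.ofReal ((q⁻¹ ^ 2)⁻¹) := by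
          refine setLIntegral_mono' measurableSet_Icc fun s hs => ?_
          have h1 : q⁻¹ ≤ ‖ξ β s - x s‖ := by
            rw [norm_sub_rev]
            exact h.inv_le_dist_other hq0 hq' hβ hs
          have h2 : 0 < q⁻¹ := by positivity
          exact fastPair_le_of_le _ _ h2 (le_max_of_le_right h1)
      _ ≤ _ := by
          rw [setLIntegral_const, Real.volume_Icc, ← ENNReal.ofReal_mul (by positivity)]
          apply ENNReal.ofReal_le_ofReal
          have e : (q⁻¹ ^ 2)⁻¹ = q ^ 2 := by simp
          rw [e]
          have h3 : 10 ^ 4 * q ^ 2 ≤ q ^ 34 := by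
            calc 10 ^ 4 * q ^ 2 ≤ q * q ^ 2 := by gcongr
              _ = q ^ 3 := by ring
              _ ≤ q ^ 34 := pow_le_pow_right₀ hq1 (by norm_num)
          have h4 : q ^ 2 * (b - a) ≤ q ^ 2 * 1 := by gcongr
          have h5 : 0 < q ^ 2 := by positivity
          linarith

/-- On each side of the two passages, two particles with a large relative velocity separate at a
comparable speed. -/
theorem norm_sub_sub_ge (h : IsChargePassage a b H q ξ x v α t)
    (h' : IsChargePassage a b H q ξ x' v' α' t') (hq : 0 < q)
    (hx : ∀ s ∈ Icc a b, HasDerivWithinAt x (v s) (Icc a b) s)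
    (hx' : ∀ s ∈ Icc a b, HasDerivWithinAt x' (v' s) (Icc a b) s) {s₁ s₂ : ℝ} (h1 : a ≤ s₁)
    (h12 : s₁ ≤ s₂) (h2 : s₂ ≤ b) (hside : s₂ ≤ t ∨ t ≤ s₁) (hside' : s₂ ≤ t' ∨ t' ≤ s₁)
    (hd1 : (2 * q ^ 34)⁻¹ ≤ ‖x s₁ - ξ α s₁‖) (hd2 : (2 * q ^ 34)⁻¹ ≤ ‖x s₂ - ξ α s₂‖)
    (hd1' : (2 * q ^ 34)⁻¹ ≤ ‖x' s₁ - ξ α' s₁‖) (hd2' : (2 * q ^ 34)⁻¹ ≤ ‖x' s₂ - ξ α' s₂‖)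
    (hrel : q ^ 18 < ‖v s₁ - v' s₁‖) :
    q ^ 18 / 2 * (s₂ - s₁) ≤ ‖(x' s₂ - x s₂) - (x' s₁ - x s₁)‖ := by
  have hsub : Icc s₁ s₂ ⊆ Icc a b := Icc_subset_Icc h1 h2
  set u : Space := v' s₁ - v s₁ with hu
  have hder : ∀ r ∈ Icc s₁ s₂, HasDerivWithinAt (fun r => (x' r - x r) - r • u)
      ((v' r - v r) - u) (Icc s₁ s₂) r := by
    intro r hr
    have h3 := (((hx' r (hsub hr)).sub (hx r (hsub hr))).mono hsub).sub
      ((hasDerivWithinAt_id r (Icc s₁ s₂)).smul_const u)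
    exact h3.congr_deriv (by simp)
  -- Each velocity varies by at most q^18/10 on its side of its passage, so the relative
  -- displacement is within q^18/5 (s₂ - s₁) of the linear one, whose speed exceeds q^18.
  have hb : ∀ r ∈ Icc s₁ s₂, ‖(v' r - v r) - u‖ ≤ q ^ 18 / 5 := by
    intro r hr
    have h3 := h.vel s₁ r s₂ h1 hr.1 hr.2 h2 hside hd1 hd2
    have h4 := h'.vel s₁ r s₂ h1 hr.1 hr.2 h2 hside' hd1' hd2'
    have e : (v' r - v r) - u = (v' r - v' s₁) - (v r - v s₁) := by rw [hu]; abel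
    rw [e]
    have h5 := norm_sub_le (v' r - v' s₁) (v r - v s₁)
    linarith
  have hmv := Convex.norm_image_sub_le_of_norm_hasDerivWithin_le hder hb (convex_Icc s₁ s₂)
    (left_mem_Icc.2 h12) (right_mem_Icc.2 h12)
  rw [Real.norm_eq_abs, abs_of_nonneg (by linarith)] at hmv
  have e : (s₂ - s₁) • u = ((x' s₂ - x s₂) - (x' s₁ - x s₁)) -
      (((x' s₂ - x s₂) - s₂ • u) - ((x' s₁ - x s₁) - s₁ • u)) := by
    rw [sub_smul]; abel
  have h6 := norm_sub_le ((x' s₂ - x s₂) - (x' s₁ - x s₁))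
    (((x' s₂ - x s₂) - s₂ • u) - ((x' s₁ - x s₁) - s₁ • u))
  rw [← e, norm_smul, Real.norm_eq_abs, abs_of_nonneg (by linarith)] at h6
  rw [norm_sub_rev] at hrel
  have h7 : (s₂ - s₁) * q ^ 18 ≤ (s₂ - s₁) * ‖u‖ := by
    have : 0 ≤ s₂ - s₁ := by linarith
    gcongr
  have h8 : 0 ≤ q ^ 18 * (s₂ - s₁) := mul_nonneg (by positivity) (by linarith)
  linarith

/-- The contribution of a fast particle `x` to the force on a test particle `x'`, except at the times
when the latter passes close to a charge. -/
theorem lintegral_fastPair_le (h : IsChargePassage a b H q ξ x v α t)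
    (h' : IsChargePassage a b H q ξ x' v' α' t') (hq : 10 ^ 4 ≤ q) (hq' : 4 * (H + 1) ≤ q)
    (hx : ∀ s ∈ Icc a b, HasDerivWithinAt x (v s) (Icc a b) s)
    (hx' : ∀ s ∈ Icc a b, HasDerivWithinAt x' (v' s) (Icc a b) s) {S : Set ℝ}
    (hS : ∀ s ∈ Icc a b, s ∉ S → (q ^ 34)⁻¹ ≤ ‖x' s - ξ α' s‖) :
    ∫⁻ s in Icc a b, Sᶜ.indicator (fun s => fastPair q ((x' s, v' s), (x s, v s))) s ≤
      ENNReal.ofReal (‖v a‖ ^ 2 / 2 + ∑ β, ‖x a - ξ β a‖⁻¹) := by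
  have hq0 : 0 < q := by linarith
  have hq1 : 1 ≤ q := by linarith
  have hdd : (2 * q ^ 34)⁻¹ ≤ (q ^ 34)⁻¹ := by
    gcongr
    have : 0 < q ^ 34 := by positivity
    linarith
  rcases h.slow_or_fast with hsl | ⟨hf, hlin⟩
  · refine le_of_eq_of_le ?_ zero_le
    rw [setLIntegral_congr_fun (g := fun _ => 0) measurableSet_Icc, lintegral_zero]
    intro s hs
    by_cases h1 : s ∈ S
    · simp [h1]
    · simp only [indicator_of_mem (mem_compl h1)]
      exact fastPair_eq_zero _ _ _ (hsl s hs).1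
  refine le_trans ?_ (ENNReal.ofReal_le_ofReal hf)
  -- The two passage times cut the step into four pieces. The set `D i` keeps the times of one piece
  -- at which both bodies are away from their charges and relatively fast; it need not be an
  -- interval, which is why linear separation is stated for arbitrary sets of times.
  set D : Bool × Bool → Set ℝ := fun i => {s | s ∈ Icc a b ∧ s ∉ S ∧
    (2 * q ^ 34)⁻¹ ≤ ‖x s - ξ α s‖ ∧ q ^ 18 < ‖v s - v' s‖ ∧ s ∈ timeSide t i.1 ∧
    s ∈ timeSide t' i.2} with hD
  have hex : ∀ i, ∃ r, ∀ s ∈ D i, max (q ^ 48)⁻¹ (q ^ 18 / 2 / 3 * |s - r|) ≤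
      max (q ^ 48)⁻¹ ‖x' s - x s‖ := by
    intro i
    refine exists_le_max_norm (Z := fun s => x' s - x s) (c := q ^ 18 / 2) (by positivity)
      fun s₁ hs₁ s₂ hs₂ h12 => ?_
    exact h.norm_sub_sub_ge h' hq0 hx hx' hs₁.1.1 h12 hs₂.1.2
      (timeSide_or hs₁.2.2.2.2.1 hs₂.2.2.2.2.1) (timeSide_or hs₁.2.2.2.2.2 hs₂.2.2.2.2.2)
      hs₁.2.2.1 hs₂.2.2.1 (hdd.trans (hS s₁ hs₁.1 hs₁.2.1)) (hdd.trans (hS s₂ hs₂.1 hs₂.2.1))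
      hs₁.2.2.2.1
  choose r hr using hex
  -- Linear escape at speed q^17/8 confines the times at distance less than 1/(2q^34) from the
  -- charge to J.
  set J : Set ℝ := Icc (t - 4 / q ^ 51) (t + 4 / q ^ 51) with hJ
  set B : ℝ → ℝ → ℝ≥0∞ := fun r s =>
    ENNReal.ofReal (((max (q ^ 48)⁻¹ (q ^ 18 / 2 / 3 * |s - r|)) ^ 2)⁻¹) with hB
  have hBm : ∀ r, Measurable (B r) := fun r => by rw [hB]; fun_prop
  have hpt : ∀ s ∈ Icc a b, Sᶜ.indicator (fun s => fastPair q ((x' s, v' s), (x s, v s))) s ≤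
      J.indicator (fun _ => ENNReal.ofReal (4 * q ^ 68)) s + ∑ i, B (r i) s := by
    intro s hs
    by_cases h1 : s ∈ S
    · simp [h1]
    rw [indicator_of_mem (mem_compl h1)]
    rcases lt_or_ge ‖x s - ξ α s‖ (2 * q ^ 34)⁻¹ with h2 | h2
    · refine le_trans ?_ le_self_add
      have h3 : s ∈ J := by
        have h4 := (hlin s hs).trans_lt h2
        have h5 : |s - t| ≤ 4 / q ^ 51 := by
          rw [le_div_iff₀ (by positivity)]
          have h6 : q ^ 17 / 8 * |s - t| * (2 * q ^ 34) ≤ 1 := by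
            have := h4.le
            rwa [← one_div, le_div_iff₀ (by positivity)] at this
          have e : q ^ 51 = q ^ 17 * q ^ 34 := by ring
          rw [e]
          linarith
        rw [abs_le] at h5
        exact ⟨by linarith, by linarith⟩
      rw [indicator_of_mem h3]
      -- While the fast particle is within 1/(2q^34) of its charge, the test particle is at least
      -- 1/q^34 away from that same charge: by the choice of S if it is also the charge of the test
      -- particle, by isolation otherwise. The two particles are then at distance at least
      -- 1/(2q^34).
      have h4 : (q ^ 34)⁻¹ ≤ ‖x' s - ξ α s‖ := by
        by_cases h5 : α = α'
        · rw [h5]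
          exact hS s hs h1
        · refine le_trans ?_ (h'.inv_le_dist_other hq0 hq' h5 hs)
          gcongr
          exact le_self_pow₀ hq1 (by norm_num)
      have h5 : (2 * q ^ 34)⁻¹ ≤ ‖x' s - x s‖ := by
        have h6 := norm_sub_le_norm_sub_add_norm_sub (x' s) (x s) (ξ α s)
        rw [mul_inv] at h2 ⊢
        linarith
      have h7 : 0 < (2 * q ^ 34)⁻¹ := by positivity
      refine (fastPair_le_of_le _ _ h7 (le_max_of_le_right h5)).trans_eq ?_
      congr 1
      field_simp
      ring
    · refine le_trans ?_ le_add_self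
      by_cases h3 : ‖v s - v' s‖ ≤ q ^ 18
      · rw [fastPair_eq_zero_of_sub _ _ h3]
        exact zero_le
      obtain ⟨i, hi⟩ := exists_mem_timeSide t s
      obtain ⟨j, hj⟩ := exists_mem_timeSide t' s
      refine le_trans ?_ (Finset.single_le_sum (f := fun i => B (r i) s) (fun i _ => zero_le)
        (Finset.mem_univ (i, j)))
      have h4 : 0 < max (q ^ 48)⁻¹ (q ^ 18 / 2 / 3 * |s - r (i, j)|) :=
        lt_max_of_lt_left (by positivity)
      exact fastPair_le_of_le _ _ h4 (hr (i, j) s ⟨hs, h1, h2, not_le.1 h3, hi, hj⟩)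
  have hJv : volume J = ENNReal.ofReal (8 / q ^ 51) := by
    rw [hJ, Real.volume_Icc]
    congr 1
    ring
  calc _ ≤ ∫⁻ s in Icc a b, (J.indicator (fun _ => ENNReal.ofReal (4 * q ^ 68)) s +
        ∑ i, B (r i) s) := setLIntegral_mono' measurableSet_Icc hpt
    _ ≤ ∫⁻ s, (J.indicator (fun _ => ENNReal.ofReal (4 * q ^ 68)) s + ∑ i, B (r i) s) :=
        setLIntegral_le_lintegral _ _
    _ = ENNReal.ofReal (4 * q ^ 68) * ENNReal.ofReal (8 / q ^ 51) + ∑ i, ∫⁻ s, B (r i) s := by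
        rw [lintegral_add_left (measurable_const.indicator measurableSet_Icc),
          lintegral_finsetSum _ (fun i _ => hBm (r i)), lintegral_indicator measurableSet_Icc,
          setLIntegral_const, hJv]
    _ ≤ ENNReal.ofReal (4 * q ^ 68) * ENNReal.ofReal (8 / q ^ 51) +
        ∑ _i : Bool × Bool, ENNReal.ofReal (8 / (q ^ 18 / 2 / 3 * (q ^ 48)⁻¹)) := by
        gcongr with i
        exact lintegral_inv_max_sq_le (by positivity) (by positivity) (r i)
    -- The window J contributes 4q^68 · 8/q^51, and each of the four pieces 48q^30; both are
    -- negligible against the energy q^34/16.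
    _ = ENNReal.ofReal (32 * q ^ 17 + 192 * q ^ 30) := by
        rw [← ENNReal.ofReal_sum_of_nonneg (fun _ _ => by positivity),
          ← ENNReal.ofReal_mul (by positivity), ← ENNReal.ofReal_add (by positivity)
          (by positivity)]
        congr 1
        simp only [Finset.sum_const, Finset.card_univ, Fintype.card_prod, Fintype.card_bool]
        field_simp
        ring
    _ ≤ _ := by
        apply ENNReal.ofReal_le_ofReal
        have h1 : q ^ 17 ≤ q ^ 30 := pow_le_pow_right₀ hq1 (by norm_num)
        have h2 : 10 ^ 4 * q ^ 30 ≤ q ^ 34 := by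
          calc 10 ^ 4 * q ^ 30 ≤ q * q ^ 30 := by gcongr
            _ = q ^ 31 := by ring
            _ ≤ q ^ 34 := pow_le_pow_right₀ hq1 (by norm_num)
        have h3 : 0 < q ^ 30 := by positivity
        linarith

end IsChargePassage

end PlasmaCharge

/-! ### Growth of the energies during a short step. -/

namespace PlasmaCharge

open MeasureTheory Set Filter Topology
open scoped ENNReal NNReal Interval RealInnerProductSpace

variable {K : Set Phase} {μ : Measure Phase} {X V : Phase → ℝ → Space}
variable {N : ℕ} {ξ η : Fin N → ℝ → Space} {a b A W δ T H Q q s : ℝ} {z : Phase}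

/-- Above the power `24` of this speed, fast and slow particles are told apart. -/
noncomputable def speedThreshold (A H : ℝ) : ℝ :=
  10 ^ 4 + (32 * fieldConst A H + 17 * H ^ 2 + 4 * (H + 1))

/-- The bound for the time integral of the field during a short step. -/
noncomputable def fieldTimeConst (A H : ℝ) : ℝ :=
  16 * fieldConst A H * speedThreshold A H ^ 32 + 262 * fieldConst A H + H

/-- The bound for the growth of the square roots of the energies during a short step. -/
noncomputable def growthConst (A H : ℝ) : ℝ := 2 * fieldTimeConst A H + 17 * H ^ 2 + 4 * (H + 1)

theorem fieldTimeConst_nonneg (hA : 0 ≤ A) (hH : 0 ≤ H) : 0 ≤ fieldTimeConst A H := by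
  have := fieldConst_nonneg hA hH
  unfold fieldTimeConst speedThreshold
  positivity

theorem IsShortStep.sub_le_one (hS : IsShortStep a b H Q T K ξ η X V) (hH : 0 ≤ H) : b - a ≤ 1 := by
  have h1 := hS.short
  have h2 := hS.one_le
  have h3 := hS.le
  have h4 : 1 * (b - a) ≤ Q * (b - a) := mul_le_mul_of_nonneg_right h2 (by linarith)
  nlinarith

namespace IsLagrangian

/-- Below the threshold Q is bounded in terms of A and H, and so is the field; the step has length
at most 1. -/
theorem lintegral_fieldMajorant_le_of_slow (h : IsLagrangian T A W δ K μ ξ η X V)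
    (hE : HasEnergyBound H T μ ξ η X V) (hS : IsShortStep a b H (q ^ 24) T K ξ η X V) (hq0 : 0 < q)
    (hq : q ≤ speedThreshold A H) (x : ℝ → Space) :
    ∫⁻ s in Icc a b, fieldMajorant μ X s (x s) ≤ ENNReal.ofReal (fieldTimeConst A H) := by
  have hM := fieldConst_nonneg h.density_nonneg hE.nonneg
  have hH := hE.nonneg
  calc _ ≤ ∫⁻ s in Icc a b, ENNReal.ofReal (16 * fieldConst A H * q ^ 32) :=
        setLIntegral_mono' measurableSet_Icc fun s hs => (h.norm_field_le_pow hE (hS.subset hs) hq0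
          (fun z hz => hS.speed z hz s hs) (x s)).1
    _ ≤ _ := by
        rw [setLIntegral_const, Real.volume_Icc, ← ENNReal.ofReal_mul (by positivity)]
        apply ENNReal.ofReal_le_ofReal
        have h1 := hS.sub_le_one hH
        have h2 := hS.le
        have h3 : 16 * fieldConst A H * q ^ 32 ≤ 16 * fieldConst A H * speedThreshold A H ^ 32 := by
          gcongr
        have h4 : 16 * fieldConst A H * q ^ 32 * (b - a) ≤ 16 * fieldConst A H * q ^ 32 * 1 := by
          gcongr
        rw [fieldTimeConst]
        linarith

theorem speedThreshold_le (h : IsLagrangian T A W δ K μ ξ η X V) (hE : HasEnergyBound H T μ ξ η X V)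
    (hq : speedThreshold A H ≤ q) : 10 ^ 4 ≤ q ∧
      32 * fieldConst A H + 17 * H ^ 2 + 4 * (H + 1) ≤ q ∧ 4 * (H + 1) ≤ q := by
  have hM := fieldConst_nonneg h.density_nonneg hE.nonneg
  have hH := hE.nonneg
  have h1 : 0 ≤ H ^ 2 := sq_nonneg H
  unfold speedThreshold at hq
  refine ⟨?_, ?_, ?_⟩ <;> linarith

theorem lintegral_fieldMajorant_plasma_le (h : IsLagrangian T A W δ K μ ξ η X V)
    (hE : HasEnergyBound H T μ ξ η X V) (hN : 1 ≤ N) (hS : IsShortStep a b H Q T K ξ η X V)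
    (hz : z ∈ K) :
    ∫⁻ s in Icc a b, fieldMajorant μ X s (X z s) ≤ ENNReal.ofReal (fieldTimeConst A H) := by
  have hM := fieldConst_nonneg h.density_nonneg hE.nonneg
  have hH := hE.nonneg
  -- The 24th root turns all the fractional powers of Q in the argument into integer powers of q.
  obtain ⟨q, hq0, rfl⟩ : ∃ q : ℝ, 0 < q ∧ q ^ 24 = Q :=
    ⟨Q ^ ((24 : ℕ) : ℝ)⁻¹, Real.rpow_pos_of_pos (by linarith [hS.one_le]) _,
      Real.rpow_inv_natCast_pow (by linarith [hS.one_le]) (by norm_num)⟩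
  rcases le_total q (speedThreshold A H) with hq | hq
  · exact h.lintegral_fieldMajorant_le_of_slow hE hS hq0 hq _
  obtain ⟨hq4, hq', hq''⟩ := h.speedThreshold_le hE hq
  obtain ⟨α₀, t₀, hz₀⟩ := h.exists_passage hE hN hS hq4 hq' hz
  have hpos : ∀ z ∈ K, ∀ s ∈ Icc a b, HasDerivWithinAt (X z) (V z s) (Icc a b) s :=
    fun z hz s hs => (h.pos z hz s (hS.subset hs)).mono hS.subset
  have hvel : ContinuousOn (V z) (Icc a b) := fun s hs =>
    ((h.vel z hz s (hS.subset hs)).mono hS.subset).continuousWithinAt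
  -- The exceptional set is the passage of the test particle itself. Outside it, linear escape gives
  -- a distance of at least (q^17/8)(8/q^51) = q^(-34) to the charge; on it, the pointwise bound of
  -- order q^32 over a length 16/q^51 is harmless.
  refine (h.lintegral_fieldMajorant_le hE hS hq0 (x := X z) (w := V z)
    (S := Icc (t₀ - 8 / q ^ 51) (t₀ + 8 / q ^ 51)) (e := 16 / q ^ 51)
    (fun s hs => (hpos z hz s hs).continuousWithinAt) hvel measurableSet_Icc (by positivity)
    ?_ ?_).trans (ENNReal.ofReal_le_ofReal ?_)
  · rw [Real.volume_Icc]
    exact ENNReal.ofReal_le_ofReal (le_of_eq (by ring))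
  · intro y hy
    obtain ⟨α, t, hy'⟩ := h.exists_passage hE hN hS hq4 hq' hy
    refine hy'.lintegral_fastPair_le hz₀ hq4 hq'' (hpos y hy) (hpos z hz) fun s hs hsS => ?_
    rcases hz₀.slow_or_fast with hsl | ⟨-, hlin⟩
    · exact (hsl s hs).2
    · refine le_trans ?_ (hlin s hs)
      have h1 : 8 / q ^ 51 ≤ |s - t₀| := by
        by_contra! h2
        rw [abs_lt] at h2
        exact hsS ⟨by linarith, by linarith⟩
      calc (q ^ 34)⁻¹ = q ^ 17 / 8 * (8 / q ^ 51) := by field_simp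
        _ ≤ _ := by gcongr
  · have h1 : 1 ≤ q ^ 19 := one_le_pow₀ (by linarith)
    have h2 : 16 * fieldConst A H * q ^ 32 * (16 / q ^ 51) ≤ 256 * fieldConst A H := by
      have e : 16 * fieldConst A H * q ^ 32 * (16 / q ^ 51) = 256 * fieldConst A H / q ^ 19 := by
        field_simp
        ring
      rw [e]
      exact div_le_self (by positivity) h1
    have h3 : 0 ≤ 16 * fieldConst A H * speedThreshold A H ^ 32 := by
      unfold speedThreshold; positivity
    rw [fieldTimeConst]
    linarith

/-- Along a charge no exceptional set is needed: the passages of the fast particles already describe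
their distances to every charge. -/
theorem lintegral_fieldMajorant_charge_le (h : IsLagrangian T A W δ K μ ξ η X V)
    (hE : HasEnergyBound H T μ ξ η X V) (hN : 1 ≤ N) (hS : IsShortStep a b H Q T K ξ η X V)
    (β : Fin N) :
    ∫⁻ s in Icc a b, fieldMajorant μ X s (ξ β s) ≤ ENNReal.ofReal (fieldTimeConst A H) := by
  have hM := fieldConst_nonneg h.density_nonneg hE.nonneg
  have hH := hE.nonneg
  obtain ⟨q, hq0, rfl⟩ : ∃ q : ℝ, 0 < q ∧ q ^ 24 = Q :=
    ⟨Q ^ ((24 : ℕ) : ℝ)⁻¹, Real.rpow_pos_of_pos (by linarith [hS.one_le]) _,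
      Real.rpow_inv_natCast_pow (by linarith [hS.one_le]) (by norm_num)⟩
  rcases le_total q (speedThreshold A H) with hq | hq
  · exact h.lintegral_fieldMajorant_le_of_slow hE hS hq0 hq _
  obtain ⟨hq4, hq', hq''⟩ := h.speedThreshold_le hE hq
  refine (h.lintegral_fieldMajorant_le hE hS hq0 (x := ξ β) (w := η β) (S := ∅) (e := 0)
    (fun s hs => ((h.charge_pos β s (hS.subset hs)).mono hS.subset).continuousWithinAt)
    (fun s hs => ((h.charge_vel β s (hS.subset hs)).mono hS.subset).continuousWithinAt)
    MeasurableSet.empty le_rfl (by simp) ?_).trans (ENNReal.ofReal_le_ofReal ?_)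
  · intro y hy
    obtain ⟨α, t, hy'⟩ := h.exists_passage hE hN hS hq4 hq' hy
    simp only [compl_empty, indicator_univ]
    exact hy'.lintegral_fastPair_charge_le hq4 hq'' (hS.sub_le_one hH) β
  · have h3 : 0 ≤ 16 * fieldConst A H * speedThreshold A H ^ 32 := by
      unfold speedThreshold; positivity
    rw [fieldTimeConst]
    linarith

theorem aemeasurable_fieldMajorant (h : IsLagrangian T A W δ K μ ξ η X V) (hab : Icc a b ⊆ Icc 0 T)
    {x : ℝ → Space} (hx : ContinuousOn x (Icc a b)) :
    AEMeasurable (fun s => fieldMajorant μ X s (x s)) (volume.restrict (Icc a b)) := by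
  have := h.prob
  refine AEMeasurable.lintegral_prod_right'
    (f := fun p : ℝ × Phase => ENNReal.ofReal ((‖x p.1 - X p.2 p.1‖ ^ 2)⁻¹)) ?_
  have h1 : AEMeasurable (fun p : ℝ × Phase => x p.1) ((volume.restrict (Icc a b)).prod μ) :=
    (hx.aemeasurable measurableSet_Icc).comp_fst
  have h2 : AEMeasurable (fun p : ℝ × Phase => X p.2 p.1) ((volume.restrict (Icc a b)).prod μ) :=
    measurable_fst.comp_aemeasurable (h.aemeasurable_pos_vel hab)
  exact ((h1.sub h2).norm.pow_const 2).inv.ennreal_ofReal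

/-- The energy relative to the nearest charge during a short step. -/
theorem sqrt_energy_le_of_nearest (h : IsLagrangian T A W δ K μ ξ η X V)
    (hE : HasEnergyBound H T μ ξ η X V) (hN : 1 ≤ N) (hS : IsShortStep a b H Q T K ξ η X V)
    (hz : z ∈ K) {α : Fin N}
    (hα : ∀ β ≠ α, ∀ s ∈ Icc a b, ‖ξ α a - ξ β a‖ / 4 ≤ ‖X z s - ξ β s‖) {k : ℝ} (hk : 0 ≤ k)
    {t : ℝ} (ht : t ∈ Icc a b) :
    √(‖V z t - η α t‖ ^ 2 / 2 + 1 / ‖X z t - ξ α t‖ + k) ≤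
      √(‖V z a - η α a‖ ^ 2 / 2 + 1 / ‖X z a - ξ α a‖ + k) +
        (2 * fieldTimeConst A H + 17 * H ^ 2) := by
  have hH := hE.nonneg
  have hA := h.density_nonneg
  have hW := h.speed_nonneg
  have hv := ballVolume_nonneg
  have hC := fieldTimeConst_nonneg hA hH
  have haI : a ∈ Icc a b := left_mem_Icc.2 hS.le
  have hsub : Icc a t ⊆ Icc a b := Icc_subset_Icc_right ht.2
  have hM := h.isRelativeMotion hz α hS.nonneg hS.le hS.le_end
  have hpert : ∀ s ∈ Icc a t, ‖perturbation μ ξ X α z s‖ ≤ ‖lagrangianField μ X s (X z s)‖ +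
      ‖lagrangianField μ X s (ξ α s)‖ + 17 * H ^ 2 := fun s hs =>
    h.norm_perturbation_le_of_nearest hE (hS.subset haI) (hS.subset (hsub hs))
      fun β hβ => hα β hβ s (hsub hs)
  have hxc : ContinuousOn (X z) (Icc a b) := fun s hs =>
    ((h.pos z hz s (hS.subset hs)).mono hS.subset).continuousWithinAt
  -- The constant C uses the qualitative field bound and is only there for integrability. The bound
  -- B comes from the time integrals along the particle and along the charge, and from 17H² over a
  -- length at most 1.
  have key := norm_sub_le_of_lintegral_deriv (E := ℝ) (a := a) (b := t)
    (C := 2 * (A * (3 * ballVolume) * (ballVolume * W ^ 3) + 1) + 17 * H ^ 2)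
    (B := 2 * fieldTimeConst A H + 17 * H ^ 2) ht.1 (by positivity)
    (fun s hs => (hM.hasDerivWithinAt_sqrt_energy hk (hsub hs)).mono hsub)
    (fun s hs => by
      have h1 := h.norm_field_le (hS.subset (hsub hs)) (X z s)
      have h2 := h.norm_field_le (hS.subset (hsub hs)) (ξ α s)
      have h3 := hM.abs_deriv_sqrt_energy_le hk (hsub hs)
      rw [← Real.norm_eq_abs] at h3
      linarith [hpert s hs]) ?_
  · have h1 := (abs_le.1 (Real.norm_eq_abs _ ▸ key)).2
    linarith
  calc _ ≤ ∫⁻ s in Icc a t, (fieldMajorant μ X s (X z s) + (fieldMajorant μ X s (ξ α s) +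
        ENNReal.ofReal (17 * H ^ 2))) := by
        refine setLIntegral_mono' measurableSet_Icc fun s hs => ?_
        have h3 := hM.abs_deriv_sqrt_energy_le hk (hsub hs)
        rw [← Real.norm_eq_abs] at h3
        rw [← ofReal_norm]
        refine (ENNReal.ofReal_le_ofReal (h3.trans (hpert s hs))).trans ?_
        rw [ENNReal.ofReal_add (by positivity) (by positivity),
          ENNReal.ofReal_add (by positivity) (by positivity), ofReal_norm, ofReal_norm, ← add_assoc]
        gcongr
        · exact enorm_field_le _
        · exact enorm_field_le _
    _ ≤ ∫⁻ s in Icc a b, (fieldMajorant μ X s (X z s) + (fieldMajorant μ X s (ξ α s) +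
        ENNReal.ofReal (17 * H ^ 2))) := lintegral_mono_set hsub
    _ = (∫⁻ s in Icc a b, fieldMajorant μ X s (X z s)) +
        ((∫⁻ s in Icc a b, fieldMajorant μ X s (ξ α s)) +
        ENNReal.ofReal (17 * H ^ 2) * ENNReal.ofReal (b - a)) := by
        rw [lintegral_add_left' (h.aemeasurable_fieldMajorant hS.subset hxc),
          lintegral_add_right _ measurable_const, setLIntegral_const, Real.volume_Icc]
    _ ≤ ENNReal.ofReal (fieldTimeConst A H) + (ENNReal.ofReal (fieldTimeConst A H) +
        ENNReal.ofReal (17 * H ^ 2)) := by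
        refine add_le_add (h.lintegral_fieldMajorant_plasma_le hE hN hS hz)
          (add_le_add (h.lintegral_fieldMajorant_charge_le hE hN hS α) ?_)
        rw [← ENNReal.ofReal_mul (by positivity)]
        exact ENNReal.ofReal_le_ofReal (mul_le_of_le_one_right (by positivity) (hS.sub_le_one hH))
    _ = _ := by
        rw [← ENNReal.ofReal_add hC (by positivity), ← ENNReal.ofReal_add hC (by positivity)]
        congr 1
        ring

/-- The growth of the energies relative to the charges during a short step. -/
theorem exists_sqrt_chargeEnergy_le (h : IsLagrangian T A W δ K μ ξ η X V)
    (hE : HasEnergyBound H T μ ξ η X V) (hN : 1 ≤ N) (hS : IsShortStep a b H Q T K ξ η X V)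
    (hz : z ∈ K) {k : ℝ} (hk : 0 ≤ k) {t : ℝ} (ht : t ∈ Icc a b) (β : Fin N) :
    ∃ α, √(chargeEnergy k (ξ β t) (η β t) (X z t, V z t)) ≤
      √(chargeEnergy k (ξ α a) (η α a) (X z a, V z a)) + growthConst A H := by
  have hH := hE.nonneg
  obtain ⟨α, hα⟩ := h.exists_nearest hE hN hS hz
  refine ⟨α, ?_⟩
  have h1 := h.sqrt_energy_le_of_nearest hE hN hS hz hα hk ht
  simp only [chargeEnergy]
  by_cases hβ : β = α
  · subst hβ
    rw [growthConst]
    linarith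
  -- The particle is far from β ≠ α, so its potential there is at most 4(H + 1), and the relative
  -- velocities differ by at most 2(H + 1). Changing the reference charge thus costs a bounded
  -- amount on the square root of the energy.
  suffices h2 : √(‖V z t - η β t‖ ^ 2 / 2 + 1 / ‖X z t - ξ β t‖ + k) ≤
      √(‖V z t - η α t‖ ^ 2 / 2 + 1 / ‖X z t - ξ α t‖ + k) + 4 * (H + 1) by
    rw [growthConst]
    linarith
  have haI : a ∈ Icc a b := left_mem_Icc.2 hS.le
  have hη : ∀ γ, ‖η γ t‖ ≤ H + 1 := fun γ =>
    abs_le_of_sq_le_sq' (by nlinarith [hE.charge_speed t (hS.subset ht) γ, sq_nonneg H])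
      (by linarith) |>.2
  have hr : 1 / ‖X z t - ξ β t‖ ≤ 4 * (H + 1) := by
    have h3 := h.one_le_dist_of_nearest hE (hS.subset haI) hβ (hα β hβ t ht)
    rw [div_le_iff₀ (norm_pos_iff.2 (h.sub_ne_zero hz (hS.subset ht) β))]
    exact h3
  have hu : ‖V z t - η β t‖ ≤ ‖V z t - η α t‖ + 2 * (H + 1) := by
    have e : V z t - η β t = (V z t - η α t) + (η α t - η β t) := by abel
    rw [e]
    have h3 := norm_add_le (V z t - η α t) (η α t - η β t)
    have h4 := norm_sub_le (η α t) (η β t)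
    linarith [hη α, hη β]
  set u := ‖V z t - η α t‖
  have hu0 : 0 ≤ u := norm_nonneg _
  have hpos : 0 ≤ 1 / ‖X z t - ξ α t‖ := by positivity
  set g := √(u ^ 2 / 2 + 1 / ‖X z t - ξ α t‖ + k) with hg
  have hg0 : 0 ≤ g := Real.sqrt_nonneg _
  have hg2 : g ^ 2 = u ^ 2 / 2 + 1 / ‖X z t - ξ α t‖ + k := Real.sq_sqrt (by positivity)
  have hug : u ≤ 2 * g := abs_le_of_sq_le_sq' (by nlinarith) (by positivity) |>.2
  rw [Real.sqrt_le_left (by positivity)]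
  have h3 : ‖V z t - η β t‖ ^ 2 ≤ (u + 2 * (H + 1)) ^ 2 := by gcongr
  have h4 : (H + 1) * u ≤ (H + 1) * (2 * g) := by gcongr
  have h5 : H + 1 ≤ (H + 1) ^ 2 := by nlinarith
  have h6 : 0 ≤ (H + 1) * g := by positivity
  nlinarith

end IsLagrangian

end PlasmaCharge

/-! ### Back to the quantities of the theorem. -/

namespace PlasmaCharge

open MeasureTheory Set Filter Topology
open scoped ENNReal NNReal Interval RealInnerProductSpace

variable {N : ℕ} {T K₁ K₂ : ℝ} {f₀ : Phase → ℝ} {ξ₀ η₀ : Fin N → Space}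
  {ξ η : Fin N → ℝ → Space} {f : ℝ → Phase → ℝ} {Φ : ℝ → ℝ → Phase → Phase}

/-- The last step ends at T instead of at n ΔT; since n is the integer part of T/ΔT, it is shorter
than 2ΔT. -/
theorem node_bounds {T ΔT : ℝ} (hΔ : 0 < ΔT) {j : ℕ} (hj : j + 1 ≤ numSteps T ΔT) :
    0 ≤ node T ΔT j ∧ node T ΔT j < node T ΔT (j + 1) ∧ node T ΔT (j + 1) ≤ T ∧
      node T ΔT (j + 1) - node T ΔT j ≤ 2 * ΔT := by
  have hT : 0 ≤ T / ΔT := by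
    by_contra! h
    have : numSteps T ΔT = 0 := Nat.floor_of_nonpos h.le
    omega
  have h1 : (numSteps T ΔT : ℝ) * ΔT ≤ T := by
    rw [← le_div_iff₀ hΔ]
    exact Nat.floor_le hT
  have h2 : T < (numSteps T ΔT + 1) * ΔT := by
    rw [← div_lt_iff₀ hΔ]
    exact Nat.lt_floor_add_one _
  have h3 : node T ΔT j = j * ΔT := if_neg (by omega)
  rw [h3]
  by_cases h4 : j + 1 = numSteps T ΔT
  · have h5 : node T ΔT (j + 1) = T := if_pos h4
    rw [← h4] at h1 h2
    push_cast at h1 h2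
    rw [h5]
    exact ⟨by positivity, by linarith, le_rfl, by linarith⟩
  · have h5 : node T ΔT (j + 1) = (j + 1) * ΔT := by rw [node, if_neg h4]; push_cast; rfl
    have h6 : ((j : ℝ) + 1) * ΔT ≤ numSteps T ΔT * ΔT := by
      gcongr
      exact_mod_cast hj
    rw [h5]
    exact ⟨by positivity, by linarith, by linarith, by linarith⟩

theorem node_zero {T ΔT : ℝ} (h : 1 ≤ numSteps T ΔT) : node T ΔT 0 = 0 := by
  rw [node, if_neg (by omega)]
  simp

namespace IsSolution

/-- By the flow property and the transport of the support, every step can be described by the same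
labels, the points of the support of f₀ at time 0. -/
theorem energyValues_eq (h0 : IsInitialDatum f₀ ξ₀) (hS : IsSolution T f₀ ξ₀ η₀ ξ η f Φ)
    (hT : 0 ≤ T) {τ : ℝ} (hτ : τ ∈ Icc 0 T) {I : Set ℝ} (hI : I ⊆ Icc 0 T) (α : Fin N) :
    energyValues K₁ ξ η Φ τ (tsupport (f τ)) I α = energyValues K₁ ξ η Φ 0 (tsupport f₀) I α := by
  have hc : ∀ t ∈ I, ∀ z ∈ tsupport f₀, Φ τ t (Φ 0 τ z) = Φ 0 t z := fun t ht z hz =>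
    hS.flow_comp 0 (left_mem_Icc.2 hT) τ hτ t (hI ht) z
      (hS.tsupport_initial_subset_freePhase h0 hz)
  ext q
  simp only [energyValues, hS.tsupport_eq h0 hT hτ, mem_ofPred_eq, exists_mem_image]
  constructor
  · rintro ⟨t, ht, z, hz, rfl⟩
    exact ⟨t, ht, z, hz, by rw [hc t ht z hz]⟩
  · rintro ⟨t, ht, z, hz, rfl⟩
    exact ⟨t, ht, z, hz, by rw [hc t ht z hz]⟩

/-- Finiteness is qualitative: the speeds are bounded by W and the distances to the charges are at
least δ, both depending on the solution. -/
theorem bddAbove_energyValues (h0 : IsInitialDatum f₀ ξ₀) (hS : IsSolution T f₀ ξ₀ η₀ ξ η f Φ)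
    (hT : 0 ≤ T) (α : Fin N) :
    BddAbove (energyValues K₁ ξ η Φ 0 (tsupport f₀) (Icc 0 T) α) := by
  obtain ⟨W, δ, hL⟩ := hS.exists_isLagrangian h0 hT
  have hE := hS.hasEnergyBound h0 hT
  set H := totalEnergy f₀ ξ₀ η₀
  have hH := hE.nonneg
  refine ⟨√((W + (H + 1)) ^ 2 / 2 + 1 / δ + K₁), ?_⟩
  rintro _ ⟨t, ht, z, hz, rfl⟩
  apply Real.sqrt_le_sqrt
  have h1 := hL.speed_le z hz t ht
  have h2 := hL.away z hz t ht α
  have h3 : ‖η α t‖ ≤ H + 1 :=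
    abs_le_of_sq_le_sq' (by nlinarith [hE.charge_speed t ht α, sq_nonneg H]) (by linarith) |>.2
  have hd := hL.dist_pos
  unfold chargeEnergy
  gcongr
  exact (norm_sub_le _ _).trans (add_le_add h1 h3)

theorem nonempty_tsupport (h0 : IsInitialDatum f₀ ξ₀) : (tsupport f₀).Nonempty := by
  rw [nonempty_iff_ne_empty]
  intro h
  have h1 : f₀ = 0 := tsupport_eq_empty_iff.1 h
  have := h0.integral_eq_one
  simp [h1] at this

theorem sqrt_chargeEnergy_le_globalQ (h0 : IsInitialDatum f₀ ξ₀)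
    (hS : IsSolution T f₀ ξ₀ η₀ ξ η f Φ) (hT : 0 ≤ T) {t : ℝ} (ht : t ∈ Icc 0 T) {z : Phase}
    (hz : z ∈ tsupport f₀) (α : Fin N) :
    √(chargeEnergy K₁ (ξ α t) (η α t) (Φ 0 t z)) ≤ globalQ K₁ T f₀ ξ η Φ :=
  (le_csSup (hS.bddAbove_energyValues h0 hT α) ⟨t, ht, z, hz, rfl⟩).trans
    (le_ciSup (f := fun α => sSup (energyValues K₁ ξ η Φ 0 (tsupport f₀) (Icc 0 T) α))
      (finite_range _).bddAbove α)

theorem one_le_globalQ (h0 : IsInitialDatum f₀ ξ₀) (hS : IsSolution T f₀ ξ₀ η₀ ξ η f Φ)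
    (hT : 0 ≤ T) (hN : 1 ≤ N) (hK₁ : 1 ≤ K₁) : 1 ≤ globalQ K₁ T f₀ ξ η Φ := by
  obtain ⟨z, hz⟩ := nonempty_tsupport h0
  refine le_trans ?_ (hS.sqrt_chargeEnergy_le_globalQ h0 hT (left_mem_Icc.2 hT) hz ⟨0, hN⟩)
  rw [Real.one_le_sqrt]
  refine hK₁.trans (le_add_of_nonneg_left ?_)
  positivity

theorem isShortStep (h0 : IsInitialDatum f₀ ξ₀) (hS : IsSolution T f₀ ξ₀ η₀ ξ η f Φ) (hT : 0 ≤ T)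
    (hN : 1 ≤ N) (hK₁ : max (8 * totalEnergy f₀ ξ₀ η₀) 1 ≤ K₁)
    (hK₂ : 24 * (totalEnergy f₀ ξ₀ η₀ + 1) ≤ K₂) {a b : ℝ} (ha : 0 ≤ a) (hab : a ≤ b) (hb : b ≤ T)
    (hl : b - a ≤ 2 * timeStep K₂ (globalQ K₁ T f₀ ξ η Φ)) :
    IsShortStep a b (totalEnergy f₀ ξ₀ η₀) (globalQ K₁ T f₀ ξ η Φ) T (tsupport f₀) ξ η
      (fun z t => (Φ 0 t z).1) (fun z t => (Φ 0 t z).2) := by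
  have hE := hS.hasEnergyBound h0 hT
  set H := totalEnergy f₀ ξ₀ η₀
  have hH := hE.nonneg
  have hQ := hS.one_le_globalQ h0 hT hN ((le_max_right _ _).trans hK₁)
  set Q := globalQ K₁ T f₀ ξ η Φ 
  have hQ0 : 0 < Q := by linarith
  have hK1 : 1 ≤ K₁ := (le_max_right _ _).trans hK₁
  have hK8 : 8 * H ≤ K₁ := (le_max_left _ _).trans hK₁
  have hsub : Icc a b ⊆ Icc 0 T := Icc_subset_Icc ha hb
  have hK20 : 0 < K₂ := by linarith
  have hen : ∀ z ∈ tsupport f₀, ∀ t ∈ Icc 0 T, ∀ α,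
      ‖(Φ 0 t z).2 - η α t‖ ^ 2 / 2 + 1 / ‖(Φ 0 t z).1 - ξ α t‖ + K₁ ≤ Q ^ 2 :=
    fun z hz t ht α => (Real.sqrt_le_left hQ0.le).1
      (hS.sqrt_chargeEnergy_le_globalQ h0 hT ht hz α)
  have hrel : ∀ z ∈ tsupport f₀, ∀ t ∈ Icc 0 T, ∀ α, ‖(Φ 0 t z).2 - η α t‖ ≤ 3 / 2 * Q := by
    intro z hz t ht α
    have h1 := hen z hz t ht α
    have h2 : 0 ≤ 1 / ‖(Φ 0 t z).1 - ξ α t‖ := by positivity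
    exact abs_le_of_sq_le_sq' (by nlinarith) (by positivity) |>.2
  -- Here K₁ ≥ 8H acts: |η|² ≤ 2H ≤ K₁/4 ≤ Q²/4. Charges have speed at most Q/2, relative speeds are
  -- at most 3Q/2, hence plasma speeds are at most 2Q.
  have hK1Q : K₁ ≤ Q ^ 2 := by
    obtain ⟨z, hz⟩ := nonempty_tsupport h0
    refine le_trans (le_add_of_nonneg_left ?_) (hen z hz 0 (left_mem_Icc.2 hT) ⟨0, hN⟩)
    positivity
  have hη : ∀ t ∈ Icc 0 T, ∀ α, ‖η α t‖ ≤ Q / 2 := by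
    intro t ht α
    have h1 := hE.charge_speed t ht α
    exact abs_le_of_sq_le_sq' (by nlinarith) (by positivity) |>.2
  refine ⟨ha, hab, hb, hQ, ?_, fun z hz t ht => ?_, fun z hz t ht α => ?_, fun t ht α => ?_⟩
  -- The factor 2, for the longer last step, turns the constant 12 of `IsShortStep` into the 24 of
  -- the threshold on K₂.
  · have h1 : Q * (b - a) ≤ 2 / K₂ := by
      calc Q * (b - a) ≤ Q * (2 * (1 / (K₂ * Q))) := by gcongr; exact hl
        _ = 2 / K₂ := by field_simp
    calc 12 * (H + 1) * (Q * (b - a)) ≤ 12 * (H + 1) * (2 / K₂) := by gcongr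
      _ = 24 * (H + 1) / K₂ := by ring
      _ ≤ 1 := (div_le_one hK20).2 hK₂
  · have h1 := hrel z hz t (hsub ht) ⟨0, hN⟩
    have h2 := hη t (hsub ht) ⟨0, hN⟩
    have h3 := norm_sub_norm_le (Φ 0 t z).2 (η ⟨0, hN⟩ t)
    linarith
  · linarith [hrel z hz t (hsub ht) α]
  · linarith [hη t (hsub ht) α]

theorem bddAbove_stepValues (h0 : IsInitialDatum f₀ ξ₀) (hS : IsSolution T f₀ ξ₀ η₀ ξ η f Φ)
    (hT : 0 ≤ T) {ΔT : ℝ} (hΔ : 0 < ΔT) {j : ℕ} (hj : j + 1 ≤ numSteps T ΔT) (α : Fin N) :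
    BddAbove (stepValues K₁ T ΔT ξ η f Φ j α) := by
  obtain ⟨h1, h2, h3, -⟩ := node_bounds hΔ hj
  rw [stepValues, hS.energyValues_eq h0 hT ⟨h1, h2.le.trans h3⟩
    (Ioo_subset_Icc_self.trans (Icc_subset_Icc h1 h3))]
  refine (hS.bddAbove_energyValues (K₁ := K₁) h0 hT α).mono ?_
  rintro _ ⟨t, ht, z, hz, rfl⟩
  exact ⟨t, Icc_subset_Icc h1 h3 (Ioo_subset_Icc_self ht), z, hz, rfl⟩

/-- The energies at the time `t_j` are bounded by `Q_j`. -/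
theorem sqrt_chargeEnergy_node_le (h0 : IsInitialDatum f₀ ξ₀) (hS : IsSolution T f₀ ξ₀ η₀ ξ η f Φ)
    (hT : 0 ≤ T) (hK₁ : 0 ≤ K₁) {ΔT : ℝ} (hΔ : 0 < ΔT) {j : ℕ} (hj : j + 1 ≤ numSteps T ΔT)
    {z : Phase} (hz : z ∈ tsupport f₀) (α : Fin N) :
    √(chargeEnergy K₁ (ξ α (node T ΔT j)) (η α (node T ΔT j)) (Φ 0 (node T ΔT j) z)) ≤
      stepQ K₁ T ΔT f₀ ξ η f Φ j := by
  obtain ⟨W, δ, hL⟩ := hS.exists_isLagrangian h0 hT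
  cases j with
  | zero =>
    have h00 := left_mem_Icc.2 hT
    have hid : ∀ y ∈ tsupport f₀, Φ 0 0 y = y := fun y hy =>
      hS.flow_self 0 h00 y (hS.tsupport_initial_subset_freePhase h0 hy)
    rw [node_zero (by omega), stepQ, hid z hz]
    have hb : BddAbove ((fun z => √(chargeEnergy K₁ (ξ α 0) (η α 0) z)) '' tsupport f₀) := by
      refine (hS.bddAbove_energyValues (K₁ := K₁) h0 hT α).mono ?_
      rintro _ ⟨y, hy, rfl⟩
      exact ⟨0, h00, y, hy, by rw [hid y hy]⟩
    exact (le_csSup hb ⟨z, hz, rfl⟩).trans (le_ciSup (f := fun α =>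
      sSup ((fun z => √(chargeEnergy K₁ (ξ α 0) (η α 0) z)) '' tsupport f₀))
      (finite_range _).bddAbove α)
  | succ j =>
    obtain ⟨h1, h2, h3, -⟩ := node_bounds hΔ (show j + 1 ≤ numSteps T ΔT by omega)
    have hM := hL.isRelativeMotion hz α h1 h2.le h3
    have hc := (hM.hasDerivWithinAt_sqrt_energy hK₁ (right_mem_Icc.2 h2.le)).continuousWithinAt
    -- The supremum defining `stepQ` runs over an open interval; continuity of the energy along the
    -- trajectory extends the bound to its right endpoint, where the next step begins.
    refine ContinuousWithinAt.closure_le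
      (f := fun t => √(chargeEnergy K₁ (ξ α t) (η α t) (Φ 0 t z))) (s := Ioo (node T ΔT j) (node T ΔT (j + 1)))
      (g := fun _ => stepQ K₁ T ΔT f₀ ξ η f Φ (j + 1)) ?_ (hc.mono Ioo_subset_Icc_self)
      continuousWithinAt_const fun t ht => ?_
    · rw [closure_Ioo h2.ne]
      exact right_mem_Icc.2 h2.le
    · rw [stepQ]
      refine le_trans (le_csSup (hS.bddAbove_stepValues h0 hT hΔ (by omega) α) ?_)
        (le_ciSup (f := fun α => sSup (stepValues K₁ T ΔT ξ η f Φ j α))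
          (finite_range _).bddAbove α)
      rw [stepValues, hS.energyValues_eq h0 hT ⟨h1, h2.le.trans h3⟩
        (Ioo_subset_Icc_self.trans (Icc_subset_Icc h1 h3))]
      exact ⟨t, ht, z, hz, rfl⟩

/-- The growth of the quantities `Q_j` in one step. -/
theorem stepQ_succ_le (h0 : IsInitialDatum f₀ ξ₀) (hS : IsSolution T f₀ ξ₀ η₀ ξ η f Φ) (hT : 0 ≤ T)
    (hN : 1 ≤ N) (hK₁ : max (8 * totalEnergy f₀ ξ₀ η₀) 1 ≤ K₁)
    (hK₂ : 24 * (totalEnergy f₀ ξ₀ η₀ + 1) ≤ K₂) {ΔT : ℝ} (hΔ : 0 < ΔT)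
    (hΔT : ΔT = timeStep K₂ (globalQ K₁ T f₀ ξ η Φ)) {j : ℕ} (hj : j + 1 ≤ numSteps T ΔT) :
    stepQ K₁ T ΔT f₀ ξ η f Φ (j + 1) ≤ stepQ K₁ T ΔT f₀ ξ η f Φ j +
      growthConst (eLpNorm f₀ ∞ volume).toReal (totalEnergy f₀ ξ₀ η₀) := by
  obtain ⟨W, δ, hL⟩ := hS.exists_isLagrangian h0 hT
  have hE := hS.hasEnergyBound h0 hT
  have hK0 : 0 ≤ K₁ := zero_le_one.trans ((le_max_right _ _).trans hK₁)
  have : Nonempty (Fin N) := ⟨⟨0, hN⟩⟩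
  obtain ⟨h1, h2, h3, h4⟩ := node_bounds hΔ hj
  have hstep := hS.isShortStep h0 hT hN hK₁ hK₂ h1 h2.le h3 (hΔT ▸ h4)
  have hnn : 0 ≤ stepQ K₁ T ΔT f₀ ξ η f Φ j := by
    obtain ⟨z, hz⟩ := nonempty_tsupport h0
    exact (Real.sqrt_nonneg _).trans (hS.sqrt_chargeEnergy_node_le h0 hT hK0 hΔ hj hz ⟨0, hN⟩)
  have hg : 0 ≤ growthConst (eLpNorm f₀ ∞ volume).toReal (totalEnergy f₀ ξ₀ η₀) := by
    have := fieldTimeConst_nonneg hL.density_nonneg hE.nonneg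
    have := hE.nonneg
    unfold growthConst
    positivity
  conv_lhs => rw [stepQ]
  -- `Real.sSup_le` also covers the empty set, whose supremum is 0; this is why the right-hand side
  -- must be nonnegative.
  refine ciSup_le fun β => Real.sSup_le ?_ (add_nonneg hnn hg)
  rw [stepValues, hS.energyValues_eq h0 hT ⟨h1, h2.le.trans h3⟩
    (Ioo_subset_Icc_self.trans (Icc_subset_Icc h1 h3))]
  rintro _ ⟨t, ht, z, hz, rfl⟩
  obtain ⟨α, hα⟩ := hL.exists_sqrt_chargeEnergy_le hE hN hstep hz hK0 (Ioo_subset_Icc_self ht) β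
  have h5 := hS.sqrt_chargeEnergy_node_le h0 hT hK0 hΔ hj hz α
  linarith

end IsSolution

end PlasmaCharge

theorem mainTheorem5 (A H K₁ : ℝ) (hK₁ : max (8 * H) 1 ≤ K₁) :
    ∃ K₂₀ : ℝ, 0 < K₂₀ ∧ ∀ K₂ : ℝ, K₂₀ ≤ K₂ → ∃ C₁ : ℝ, 0 < C₁ ∧
      ∀ (N : ℕ), 1 ≤ N → ∀ (T : ℝ), 0 < T →
      ∀ (f₀ : Phase → ℝ) (ξ₀ η₀ : Fin N → Space)
        (ξ η : Fin N → ℝ → Space) (f : ℝ → Phase → ℝ) (Φ : ℝ → ℝ → Phase → Phase),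
        IsInitialDatum f₀ ξ₀ →
        (eLpNorm f₀ ∞ volume).toReal = A →
        totalEnergy f₀ ξ₀ η₀ = H →
        IsSolution T f₀ ξ₀ η₀ ξ η f Φ →
        (∀ α, BddAbove (energyValues K₁ ξ η Φ 0 (tsupport f₀) (Icc 0 T) α)) ∧
        ∀ Q ΔT : ℝ, Q = globalQ K₁ T f₀ ξ η Φ → ΔT = timeStep K₂ Q → ΔT < T →
          ∀ i : ℕ, 1 ≤ i → i ≤ numSteps T ΔT →
            (∀ α, BddAbove (stepValues K₁ T ΔT ξ η f Φ (i - 1) α)) ∧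
            stepQ K₁ T ΔT f₀ ξ η f Φ i ≤ stepQ K₁ T ΔT f₀ ξ η f Φ (i - 1) + C₁ * Q * ΔT := by
  -- The number H is nonnegative only once a solution is given, hence the absolute value.
  refine ⟨24 * (|H| + 1), by positivity, fun K₂ hK₂ => ?_⟩
  have hK₂0 : 0 < K₂ := lt_of_lt_of_le (by positivity) hK₂
  -- The factor K₂ compensates Q ΔT = 1/K₂, so that C₁ Q ΔT dominates the growth constant.
  refine ⟨K₂ * (|growthConst A H| + 1), by positivity, ?_⟩
  intro N hN T hT f₀ ξ₀ η₀ ξ η f Φ h0 hA hH hS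
  subst hA hH
  have hK₂' : 24 * (totalEnergy f₀ ξ₀ η₀ + 1) ≤ K₂ := by
    linarith [le_abs_self (totalEnergy f₀ ξ₀ η₀)]
  refine ⟨hS.bddAbove_energyValues h0 hT.le, ?_⟩
  rintro _ ΔT rfl hΔT - i hi hin
  obtain ⟨j, rfl⟩ : ∃ j, i = j + 1 := ⟨i - 1, by omega⟩
  have hQ := hS.one_le_globalQ h0 hT.le hN ((le_max_right _ _).trans hK₁)
  have hQ0 : 0 < globalQ K₁ T f₀ ξ η Φ := by linarith
  have hΔ : 0 < ΔT := by
    rw [hΔT, timeStep]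
    positivity
  rw [Nat.add_sub_cancel]
  refine ⟨hS.bddAbove_stepValues h0 hT.le hΔ hin, ?_⟩
  refine (hS.stepQ_succ_le h0 hT.le hN hK₁ hK₂' hΔ hΔT hin).trans (add_le_add_right ?_ _)
  have e : ∀ c : ℝ, K₂ * c * globalQ K₁ T f₀ ξ η Φ * ΔT = c := by
    intro c
    rw [hΔT, timeStep]
    field_simp
  rw [e]
  linarith [le_abs_self
    (growthConst (eLpNorm f₀ ∞ volume).toReal (totalEnergy f₀ ξ₀ η₀))]
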